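/- Let $G$ be a finite abelian group. *Notation.* For a finite group $H$ let $R(H)$ be the ring of complex virtual characters of $H$, a $\lambda$-ring through exterior powers, with augmentation ideal $I$ (virtual characters of degree $0$) and operations $\gamma^n(x)=\lambda^n(x+n-1)$. Let $\Gamma^n(H)\subseteq R(H)$ be the additive subgroup generated by the products $\gamma^{n_1}(x_1)\cdots\gamma^{n_k}(x_k)$ with $x_i\in I$ and $\sum_i n_i\ge n$ (the Grothendieck filtration), and let $R^*_{\mathbb C}(H)=\bigoplus_{n\ge 0}\Gamma^n(H)/\Gamma^{n+1}(H)$ be the graded character ring. For a finite $G$-set $X$ let $K_G(X)$ be the Grothendieck ring of finite-dimensional $G$-equivariant complex vector bundles over $X$ (functors from the action category of $X$ to vector spaces). For $v\in K_G(X)$ and $x\in X$ let $v_x\in R(\mathrm{Stab}(x))$ be the fibre of $v$ over $x$. Put $\Gamma^n(X)=\{v\in K_G(X): v_x\in\Gamma^n(\mathrm{Stab}(x))\text{ for all }x\in X\}$ and $R^*_{\mathbb C}(X)=\bigoplus_{n\ge0}\Gamma^n(X)/\Gamma^{n+1}(X)$. For $v\in\Gamma^n(X)$ write $[v]_n$ for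 its class in degree $n$. For a map $f:X\to Y$ of finite $G$-sets and bundles $V$ over $X$, $W$ over $Y$, put $(f^*W)_x=W_{f(x)}$ (restriction), $(f_*V)_y=\bigoplus_{f(x)=y}V_x$ (induction) and $(f_\sharp V)_y=\bigotimes_{f(x)=y}V_x$ (tensor induction, or norm), with the evident actions of $G$. A Tambara functor for $G$ assigns to every finite $G$-set $X$ a commutative ring $S(X)$ and to every map $f:X\to Y$ of finite $G$-sets a ring homomorphism $f^*:S(Y)\to S(X)$, an additive homomorphism $f_*:S(X)\to S(Y)$ and a multiplicative monoid homomorphism $f_\sharp:S(X)\to S(Y)$, all functorial in $f$, such that: for every pullback square, with $\gamma\alpha=\delta\beta$, one has $\delta^*\gamma_*=\beta_*\alpha^*$ and $\delta^*\gamma_\sharp=\beta_\sharp\alpha^*$; for the inclusions $i:X\to X\sqcup Y$ and $j:Y\to X\sqcup Y$ the maps $S(X)\times S(Y)\to S(X\sqcup Y)$, $(a,b)\mapsto i_*a+j_*b$ and $(a,b)\mapsto i_\sharp a\cdot j_\sharp b$, are bijective; and $f_\sharp p_*=q_*f'_\sharp e^*$ for every exponential diagram $X'\xrightarrow{e}Z\xrightarrow{p}X\xrightarrow{f}Y$,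 $X'\xrightarrow{f'}Y'\xrightarrow{q}Y$, that is, every diagram isomorphic to the one with $Y'=\Pi_fZ$ (pairs of a point $y\in Y$ and a section of $p$ over $f^{-1}(y)$), $X'=X\times_Y\Pi_fZ$, $f'$ and $q$ the projections, and $e$ the evaluation. **Theorem.** 1. There are Tambara functor structures for $G$ on $X\mapsto K_G(X)$ and on $X\mapsto R^*_{\mathbb C}(X)$ such that * the structure on $K_G$ is given on classes of actual bundles by restriction, induction and tensor induction; * the structure on $R^*_{\mathbb C}$ is induced by that on $K_G$. That is, for every map $f:X\to Y$ of finite $G$-sets and every $n\ge 0$: $f^*(\Gamma^n(Y))\subseteq\Gamma^n(X)$ and $f^*[v]_n=[f^*v]_n$ for $v\in\Gamma^n(Y)$; $f_*(\Gamma^n(X))\subseteq\Gamma^n(Y)$ and $f_*[v]_n=[f_*v]_n$ for $v\in\Gamma^n(X)$; and if all fibres of $f$ have $k$ points, then $f_\sharp(\Gamma^n(X))\subseteq\Gamma^{nk}(Y)$ and $f_\sharp[v]_n=[f_\sharp v]_{nk}$ for $v\in\Gamma^n(X)$. 2. For every transitive finite $G$-set $X$ and $x\in X$, there is a ring isomorphism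 $R^*_{\mathbb C}(X)\cong R^*_{\mathbb C}(\mathrm{Stab}(x))$ with $[v]_n\mapsto[v_x]_n$ for all $n\ge0$ and $v\in\Gamma^n(X)$. In particular the value of the Tambara functor $R^*_{\mathbb C}$ on $G/H$ is the graded character ring $R^*_{\mathbb C}(H)$. -/

import Mathlib

open scoped TensorProduct DirectSum

universe u

namespace GradedChar

noncomputable section

/-! ## Associated graded rings of multiplicative filtrations -/

/-- A decreasing multiplicative filtration `F⁰ ⊇ F¹ ⊇ ⋯` of a commutative ring by additive
subgroups. -/
structure MulFiltration (A : Type*) [CommRing A] where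
  level : ℕ → AddSubgroup A
  antitone_level : Antitone level
  one_mem_level : (1 : A) ∈ level 0
  mul_mem_level : ∀ {m n : ℕ} {a b : A}, a ∈ level m → b ∈ level n → a * b ∈ level (m + n)

namespace MulFiltration

variable {A : Type*} [CommRing A] (F : MulFiltration A)

/-- The graded piece `Fⁿ / Fⁿ⁺¹`. -/
abbrev piece (n : ℕ) : Type _ :=
  F.level n ⧸ (F.level (n + 1)).addSubgroupOf (F.level n)

/-- The class in `Fⁿ / Fⁿ⁺¹` of an element of `Fⁿ`. -/
def pieceMk (n : ℕ) (a : A) (ha : a ∈ F.level n) : F.piece n :=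
  QuotientAddGroup.mk ⟨a, ha⟩

theorem pieceMk_eq_iff (n : ℕ) (a b : A) (ha : a ∈ F.level n) (hb : b ∈ F.level n) :
    F.pieceMk n a ha = F.pieceMk n b hb ↔ -a + b ∈ F.level (n + 1) := by
  unfold pieceMk
  rw [QuotientAddGroup.eq, AddSubgroup.mem_addSubgroupOf]
  rfl

theorem exists_pieceMk {n : ℕ} (x : F.piece n) : ∃ a ha, F.pieceMk n a ha = x := by
  induction x using QuotientAddGroup.induction_on with
  | H z => exact ⟨z.1, z.2, rfl⟩

theorem pieceMk_add (n : ℕ) (a b : A) (ha : a ∈ F.level n) (hb : b ∈ F.level n) :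
    F.pieceMk n a ha + F.pieceMk n b hb = F.pieceMk n (a + b) (add_mem ha hb) := rfl

theorem pieceMk_zero (n : ℕ) : F.pieceMk n 0 (zero_mem _) = 0 := rfl

theorem pieceMk_congr (n : ℕ) {a b : A} (ha : a ∈ F.level n) (h : a = b) :
    F.pieceMk n a ha = F.pieceMk n b (h ▸ ha) := by subst h; rfl

theorem sigma_pieceMk_congr {m n : ℕ} (hmn : m = n) {a b : A} (h : a = b)
    (ha : a ∈ F.level m) (hb : b ∈ F.level n) :
    GradedMonoid.mk (A := F.piece) m (F.pieceMk m a ha) =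
      GradedMonoid.mk n (F.pieceMk n b hb) := by
  subst hmn; subst h; rfl

/-- Multiplication `Fᵐ / Fᵐ⁺¹ × Fⁿ / Fⁿ⁺¹ → Fᵐ⁺ⁿ / Fᵐ⁺ⁿ⁺¹`, induced by that of the ring. -/
def pieceMul {m n : ℕ} (x : F.piece m) (y : F.piece n) : F.piece (m + n) :=
  Quotient.map₂ (fun (a : F.level m) (b : F.level n) =>
      (⟨a.1 * b.1, F.mul_mem_level (m := m) (n := n) a.2 b.2⟩ : F.level (m + n)))
    (by
      intro a a' h b b' h'
      rw [← Quotient.eq_iff_equiv] at h h' ⊢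
      have h1 : -a.1 + a'.1 ∈ F.level (m + 1) := (F.pieceMk_eq_iff m _ _ a.2 a'.2).1 h
      have h2 : -b.1 + b'.1 ∈ F.level (n + 1) := (F.pieceMk_eq_iff n _ _ b.2 b'.2).1 h'
      refine (F.pieceMk_eq_iff (m + n) _ _ (F.mul_mem_level (m := m) (n := n) a.2 b.2)
        (F.mul_mem_level (m := m) (n := n) a'.2 b'.2)).2 ?_
      have e : -(a.1 * b.1) + a'.1 * b'.1
          = (-a.1 + a'.1) * b'.1 + a.1 * (-b.1 + b'.1) := by ring
      rw [e]
      refine add_mem ?_ ?_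
      · have := F.mul_mem_level (n := n) h1 b'.2
        rwa [show m + 1 + n = m + n + 1 by ring] at this
      · exact F.mul_mem_level (m := m) (n := n + 1) a.2 h2) x y

theorem pieceMul_mk {m n : ℕ} (a b : A) (ha : a ∈ F.level m) (hb : b ∈ F.level n) :
    F.pieceMul (F.pieceMk m a ha) (F.pieceMk n b hb)
      = F.pieceMk (m + n) (a * b) (F.mul_mem_level ha hb) := rfl

theorem natCast_mem (n : ℕ) : (n : A) ∈ F.level 0 := by
  rw [← nsmul_one]; exact nsmul_mem F.one_mem_level n

theorem intCast_mem (n : ℤ) : (n : A) ∈ F.level 0 := by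
  rw [← zsmul_one]; exact zsmul_mem F.one_mem_level n

instance : GradedMonoid.GMul F.piece := ⟨fun x y => F.pieceMul x y⟩

instance : GradedMonoid.GOne F.piece := ⟨F.pieceMk 0 1 F.one_mem_level⟩

/-- The graded pieces form a graded commutative ring. -/
instance : DirectSum.GCommRing F.piece where
  mul x y := F.pieceMul x y
  one := F.pieceMk 0 1 F.one_mem_level
  one_mul := by
    rintro ⟨n, x⟩
    obtain ⟨a, ha, rfl⟩ := F.exists_pieceMk x
    exact F.sigma_pieceMk_congr (zero_add n) (one_mul a) (F.mul_mem_level F.one_mem_level ha) ha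
  mul_one := by
    rintro ⟨n, x⟩
    obtain ⟨a, ha, rfl⟩ := F.exists_pieceMk x
    exact F.sigma_pieceMk_congr (add_zero n) (mul_one a) (F.mul_mem_level ha F.one_mem_level) ha
  mul_assoc := by
    rintro ⟨m, x⟩ ⟨n, y⟩ ⟨k, z⟩
    obtain ⟨a, ha, rfl⟩ := F.exists_pieceMk x
    obtain ⟨b, hb, rfl⟩ := F.exists_pieceMk y
    obtain ⟨c, hc, rfl⟩ := F.exists_pieceMk z
    exact F.sigma_pieceMk_congr (add_assoc m n k) (mul_assoc a b c)
      (F.mul_mem_level (F.mul_mem_level ha hb) hc) (F.mul_mem_level ha (F.mul_mem_level hb hc))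
  mul_comm := by
    rintro ⟨m, x⟩ ⟨n, y⟩
    obtain ⟨a, ha, rfl⟩ := F.exists_pieceMk x
    obtain ⟨b, hb, rfl⟩ := F.exists_pieceMk y
    exact F.sigma_pieceMk_congr (add_comm m n) (mul_comm a b)
      (F.mul_mem_level ha hb) (F.mul_mem_level hb ha)
  mul_zero := by
    intro i j x
    obtain ⟨a, ha, rfl⟩ := F.exists_pieceMk x
    rw [← pieceMk_zero, ← pieceMk_zero, pieceMul_mk]
    exact F.pieceMk_congr _ _ (mul_zero a)
  zero_mul := by
    intro i j x
    obtain ⟨a, ha, rfl⟩ := F.exists_pieceMk x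
    rw [← pieceMk_zero, ← pieceMk_zero, pieceMul_mk]
    exact F.pieceMk_congr _ _ (zero_mul a)
  mul_add := by
    intro i j x y z
    obtain ⟨a, ha, rfl⟩ := F.exists_pieceMk x
    obtain ⟨b, hb, rfl⟩ := F.exists_pieceMk y
    obtain ⟨c, hc, rfl⟩ := F.exists_pieceMk z
    rw [pieceMk_add, pieceMul_mk, pieceMul_mk, pieceMul_mk, pieceMk_add]
    exact F.pieceMk_congr _ _ (mul_add a b c)
  add_mul := by
    intro i j x y z
    obtain ⟨a, ha, rfl⟩ := F.exists_pieceMk x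
    obtain ⟨b, hb, rfl⟩ := F.exists_pieceMk y
    obtain ⟨c, hc, rfl⟩ := F.exists_pieceMk z
    rw [pieceMk_add, pieceMul_mk, pieceMul_mk, pieceMul_mk, pieceMk_add]
    exact F.pieceMk_congr _ _ (add_mul a b c)
  natCast n := F.pieceMk 0 n (F.natCast_mem n)
  natCast_zero := F.pieceMk_congr _ _ Nat.cast_zero
  natCast_succ n := F.pieceMk_congr _ _ (Nat.cast_succ n)
  intCast n := F.pieceMk 0 n (F.intCast_mem n)
  intCast_ofNat n := F.pieceMk_congr _ _ (Int.cast_natCast n)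
  intCast_negSucc_ofNat n := F.pieceMk_congr _ _ (Int.cast_negSucc n)

/-- The associated graded ring `⨁ₙ Fⁿ / Fⁿ⁺¹`. -/
abbrev gr : Type _ := ⨁ n, F.piece n

/-- The homogeneous element of degree `n` of the associated graded ring defined by `a ∈ Fⁿ`. -/
def cls (n : ℕ) (a : A) (ha : a ∈ F.level n) : F.gr :=
  DirectSum.of F.piece n (F.pieceMk n a ha)

end MulFiltration

/-! ## Complex representations and the character ring of a group -/

/-- A finite-dimensional complex representation of a group. -/
structure FinRep (H : Type u) [Group H] where
  carrier : Type
  [addCommGroup : AddCommGroup carrier]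
  [module : Module ℂ carrier]
  [finiteDimensional : FiniteDimensional ℂ carrier]
  ρ : Representation ℂ H carrier

attribute [instance] FinRep.addCommGroup FinRep.module FinRep.finiteDimensional

namespace FinRep

variable {H : Type u} [Group H]

/-- The tensor product of two representations. -/
def tensor (V W : FinRep H) : FinRep H := ⟨V.carrier ⊗[ℂ] W.carrier, V.ρ.tprod W.ρ⟩

/-- The one-dimensional trivial representation. -/
def triv : FinRep H := ⟨ℂ, Representation.trivial ℂ H ℂ⟩

/-- The `n`-th exterior power of a representation. -/
def extPow (n : ℕ) (V : FinRep H) : FinRep H where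
  carrier := ⋀[ℂ]^n V.carrier
  ρ :=
    { toFun := fun h => exteriorPower.map n (V.ρ h)
      map_one' := by rw [map_one]; exact exteriorPower.map_id
      map_mul' := fun g h => by rw [map_mul]; exact exteriorPower.map_comp _ _ }

end FinRep

/-- The ring `R(H)` of complex virtual characters of `H`: the additive group generated by the
characters of finite-dimensional complex representations. -/
def charRing (H : Type u) [Group H] : Subring (H → ℂ) where
  __ := AddSubgroup.closure (Set.range fun V : FinRep H => V.ρ.character)
  one_mem' := by
    refine AddSubgroup.subset_closure ⟨FinRep.triv, ?_⟩
    funext h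
    change LinearMap.trace ℂ ℂ LinearMap.id = 1
    simp
  mul_mem' := by
    intro a b ha hb
    refine AddSubgroup.closure_induction₂
      (p := fun a b _ _ => a * b ∈ AddSubgroup.closure
        (Set.range fun V : FinRep H => V.ρ.character))
      ?_ ?_ ?_ ?_ ?_ ?_ ?_ ha hb
    · rintro _ _ ⟨V, rfl⟩ ⟨W, rfl⟩
      exact AddSubgroup.subset_closure ⟨V.tensor W, Representation.char_tensor V.ρ W.ρ⟩
    · intro x _; rw [zero_mul]; exact zero_mem _
    · intro x _; rw [mul_zero]; exact zero_mem _
    · intro x y z _ _ _ h1 h2; rw [add_mul]; exact add_mem h1 h2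
    · intro x y z _ _ _ h1 h2; rw [mul_add]; exact add_mem h1 h2
    · intro x y _ _ h; rw [neg_mul]; exact neg_mem h
    · intro x y _ _ h; rw [mul_neg]; exact neg_mem h

namespace FinRep

variable {H : Type u} [Group H]

/-- The class of a representation in the character ring. -/
def char (V : FinRep H) : charRing H :=
  ⟨V.ρ.character, AddSubgroup.subset_closure ⟨V, rfl⟩⟩

/-- The power series `∑ₙ [Λⁿ V] tⁿ` over the character ring. -/
def lambdaSeries (V : FinRep H) : PowerSeries (charRing H) :=
  PowerSeries.mk fun n => (V.extPow n).char

end FinRep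

section Filtration

variable (H : Type u) [Group H]

/-- The augmentation ideal of `R(H)`: virtual characters of degree `0`. -/
def augIdeal : Ideal (charRing H) where
  carrier := {x | (x : H → ℂ) 1 = 0}
  add_mem' := by
    intro a b ha hb
    simp only [Set.mem_ofPred_eq] at ha hb ⊢
    simp [ha, hb]
  zero_mem' := by simp
  smul_mem' := by
    intro c x hx
    simp only [Set.mem_ofPred_eq] at hx ⊢
    simp [hx]

variable {H}

/-- `IsLambdaSeries x p`: the power series `p` is `λ_t(x) = ∑ₙ λⁿ(x) tⁿ`. For `x = [V] - [W]` this
is `λ_t(V) / λ_t(W)`, as dictated by `λ_t(x + y) = λ_t(x) λ_t(y)`. -/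
def IsLambdaSeries (x : charRing H) (p : PowerSeries (charRing H)) : Prop :=
  ∃ V W : FinRep H, x = V.char - W.char ∧ p * W.lambdaSeries = V.lambdaSeries

/-- `IsGamma n x z`: the element `z` is `γⁿ(x) = λⁿ(x + n - 1)`. -/
def IsGamma (n : ℕ) (x z : charRing H) : Prop :=
  ∃ p : PowerSeries (charRing H), IsLambdaSeries (x + (n : charRing H) - 1) p ∧
    z = PowerSeries.coeff n p

/-- `IsGammaMonomial n z`: the element `z` is a product `γ^{n₁}(x₁) ⋯ γ^{nₖ}(xₖ)` with all `xᵢ` in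
the augmentation ideal and `n₁ + ⋯ + nₖ ≥ n`. The list consists of the triples
`(nᵢ, xᵢ, γ^{nᵢ}(xᵢ))`. -/
def IsGammaMonomial (n : ℕ) (z : charRing H) : Prop :=
  ∃ l : List (ℕ × charRing H × charRing H),
    (∀ t ∈ l, t.2.1 ∈ augIdeal H ∧ IsGamma t.1 t.2.1 t.2.2) ∧
    n ≤ (l.map fun t => t.1).sum ∧ z = (l.map fun t => t.2.2).prod

variable (H)

/-- The Grothendieck filtration `Γⁿ` on `R(H)`: the additive subgroup generated by the monomials of
weight at least `n` in the `γ`-operations of elements of the augmentation ideal. -/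
def gammaFiltration : MulFiltration (charRing H) where
  level n := AddSubgroup.closure {z | IsGammaMonomial n z}
  antitone_level := by
    intro m n hmn
    refine AddSubgroup.closure_mono ?_
    rintro z ⟨l, h1, h2, h3⟩
    exact ⟨l, h1, hmn.trans h2, h3⟩
  one_mem_level := AddSubgroup.subset_closure ⟨[], by simp, by simp, by simp⟩
  mul_mem_level := by
    intro m n a b ha hb
    refine AddSubgroup.closure_induction
      (p := fun a _ => a * b ∈ AddSubgroup.closure {z | IsGammaMonomial (m + n) z}) ?_ ?_ ?_ ?_ ha
    · rintro _ ⟨l, h1, h2, rfl⟩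
      refine AddSubgroup.closure_induction
        (p := fun b _ => (l.map fun t => t.2.2).prod * b ∈
          AddSubgroup.closure {z | IsGammaMonomial (m + n) z}) ?_ ?_ ?_ ?_ hb
      · rintro _ ⟨l', h1', h2', rfl⟩
        refine AddSubgroup.subset_closure ⟨l ++ l', ?_, ?_, ?_⟩
        · intro t ht
          rcases List.mem_append.1 ht with h | h
          · exact h1 t h
          · exact h1' t h
        · rw [List.map_append, List.sum_append]; exact add_le_add h2 h2'
        · rw [List.map_append, List.prod_append]
      · rw [mul_zero]; exact zero_mem _
      · intro x y _ _ h1 h2; rw [mul_add]; exact add_mem h1 h2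
      · intro x _ h; rw [mul_neg]; exact neg_mem h
    · rw [zero_mul]; exact zero_mem _
    · intro x y _ _ h1 h2; rw [add_mul]; exact add_mem h1 h2
    · intro x _ h; rw [neg_mul]; exact neg_mem h

/-- The graded character ring `R*(H) = ⨁ₙ Γⁿ / Γⁿ⁺¹`. -/
abbrev gradedCharRing : Type u := (gammaFiltration H).gr

end Filtration

/-! ## Finite `G`-sets, pullbacks and exponential diagrams -/

/-- A finite `G`-set. -/
structure FinGSet (G : Type u) [Group G] where
  carrier : Type
  [mulAction : MulAction G carrier]
  [finite : Finite carrier]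

namespace FinGSet

variable {G : Type u} [Group G]

instance : CoeSort (FinGSet G) Type := ⟨FinGSet.carrier⟩

attribute [instance] FinGSet.mulAction FinGSet.finite

/-- The disjoint union of two finite `G`-sets. -/
def sum (X Y : FinGSet G) : FinGSet G := ⟨X ⊕ Y⟩

/-- The inclusion of the first summand. -/
def inl (X Y : FinGSet G) : X →[G] X.sum Y := ⟨Sum.inl, fun _ _ => rfl⟩

/-- The inclusion of the second summand. -/
def inr (X Y : FinGSet G) : Y →[G] X.sum Y := ⟨Sum.inr, fun _ _ => rfl⟩

/-- A commutative square `γ ∘ α = δ ∘ β` of finite `G`-sets is a pullback square. -/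
def IsPullback {P X Y Z : FinGSet G} (α : P →[G] X) (β : P →[G] Y) (γ : X →[G] Z)
    (δ : Y →[G] Z) : Prop :=
  (∀ t, γ (α t) = δ (β t)) ∧ ∀ x y, γ x = δ y → ∃! t, α t = x ∧ β t = y

/-- The fibre product `X ×_Y Z`. -/
def fibreProd {X Y Z : FinGSet G} (f : X →[G] Y) (q : Z →[G] Y) : FinGSet G where
  carrier := {t : X × Z // f t.1 = q t.2}
  mulAction :=
    { smul := fun g t => ⟨(g • t.1.1, g • t.1.2), by
        change f (g • t.1.1) = q (g • t.1.2)
        rw [map_smul, map_smul, t.2]⟩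
      one_smul := fun t => Subtype.ext (Prod.ext (one_smul G t.1.1) (one_smul G t.1.2))
      mul_smul := fun g h t =>
        Subtype.ext (Prod.ext (mul_smul g h t.1.1) (mul_smul g h t.1.2)) }

/-- The first projection of the fibre product. -/
def fibreProd.fst {X Y Z : FinGSet G} (f : X →[G] Y) (q : Z →[G] Y) : fibreProd f q →[G] X :=
  ⟨fun t => t.1.1, fun _ _ => rfl⟩

/-- The second projection of the fibre product. -/
def fibreProd.snd {X Y Z : FinGSet G} (f : X →[G] Y) (q : Z →[G] Y) : fibreProd f q →[G] Z :=
  ⟨fun t => t.1.2, fun _ _ => rfl⟩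

section DepProd

variable {A X Y : FinGSet G} (p : A →[G] X) (f : X →[G] Y)

/-- The set underlying `Π_f A`: pairs of a point `y` of `Y` and a section of `p` over `f⁻¹(y)`. -/
structure Sections where
  pt : Y
  sec : {x : X // f x = pt} → A
  sec_spec : ∀ x, p (sec x) = x.1

variable {p f} in
theorem Sections.ext_of {s t : Sections p f} (h : s.pt = t.pt)
    (h' : ∀ x hs ht, s.sec ⟨x, hs⟩ = t.sec ⟨x, ht⟩) : s = t := by
  obtain ⟨y, s, hs⟩ := s
  obtain ⟨y', t, ht⟩ := t
  obtain rfl : y = y' := h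
  have : s = t := funext fun x => h' x.1 x.2 x.2
  subst this
  rfl

variable {p f} in
theorem Sections.sec_congr (s : Sections p f) {x x' : X} (h : x = x') (hx : f x = s.pt)
    (hx' : f x' = s.pt) : s.sec ⟨x, hx⟩ = s.sec ⟨x', hx'⟩ := by
  subst h; rfl

theorem smul_inv_fibre {X Y : FinGSet G} (f : X →[G] Y) {g : G} {x : X} {y y' : Y}
    (h : g • y = y') (hx : f x = y') : f (g⁻¹ • x) = y := by
  rw [map_smul, hx, ← h, inv_smul_smul]

/-- The action on sections: `(g • s)(x) = g • s(g⁻¹ • x)` for `x` over `g • y`. -/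
instance : MulAction G (Sections p f) where
  smul g s := ⟨g • s.pt, fun x => g • s.sec ⟨g⁻¹ • x.1, smul_inv_fibre f rfl x.2⟩, fun x => by
    rw [map_smul, s.sec_spec, smul_inv_smul]⟩
  one_smul s := by
    refine Sections.ext_of (one_smul G s.pt) fun x hs ht => ?_
    exact (one_smul G _).trans (s.sec_congr (by rw [inv_one, one_smul]) _ _)
  mul_smul g h s := by
    refine Sections.ext_of (mul_smul g h s.pt) fun x hs ht => ?_
    refine (mul_smul g h _).trans (congrArg (fun a => g • h • a) (s.sec_congr ?_ _ _))
    rw [mul_inv_rev, mul_smul]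

instance : Finite (Sections p f) := by
  refine Finite.of_injective
    (β := Σ y : Y, ({x : X // f x = y} → A)) (fun s => ⟨s.pt, s.sec⟩) ?_
  rintro ⟨y, s, hs⟩ ⟨y', s', hs'⟩ h
  obtain ⟨rfl, h⟩ := Sigma.mk.inj_iff.1 h
  obtain rfl := eq_of_heq h
  rfl

/-- The finite `G`-set `Π_f A` over `Y`, for `p : A → X` and `f : X → Y`. -/
def depProd : FinGSet G := ⟨Sections p f⟩

/-- The projection `Π_f A → Y`. -/
def depProd.proj : depProd p f →[G] Y := ⟨fun s => Sections.pt s, fun _ _ => rfl⟩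

/-- The evaluation `X ×_Y Π_f A → A`, `(x, s) ↦ s(x)`. -/
def depProd.eval : fibreProd f (depProd.proj p f) →[G] A where
  toFun t := Sections.sec t.1.2 ⟨t.1.1, t.2⟩
  map_smul' g t :=
    congrArg (fun a => g • a)
      (Sections.sec_congr (p := p) (f := f) t.1.2 (inv_smul_smul g t.1.1) _ t.2)

end DepProd

/-- The diagram formed by `p : Z → X`, `f : X → Y`, `e : X' → Z`, `f' : X' → Y'`, `q : Y' → Y` is an
exponential diagram: it is isomorphic to the one with `Y' = Π_f Z`, `X' = X ×_Y Π_f Z`, `f'` and `q`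
the projections, and `e` the evaluation. -/
def IsExponential {X Y Z X' Y' : FinGSet G} (p : Z →[G] X) (f : X →[G] Y) (e : X' →[G] Z)
    (f' : X' →[G] Y') (q : Y' →[G] Y) : Prop :=
  ∃ (i : X' →[G] fibreProd f (depProd.proj p f)) (j : Y' →[G] depProd p f),
    Function.Bijective i ∧ Function.Bijective j ∧
    (∀ t, e t = depProd.eval p f (i t)) ∧
    (∀ t, j (f' t) = fibreProd.snd f (depProd.proj p f) (i t)) ∧
    (∀ s, q s = depProd.proj p f (j s))

end FinGSet

/-! ## Tambara functors -/

open FinGSet in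
/-- The structure of a Tambara functor for the group `G` on a family of commutative rings `S X`
indexed by the finite `G`-sets `X`. For a map `f` of finite `G`-sets, `res f`, `ind f`, `norm f` are
the maps `f^*`, `f_*`, `f_♯`. -/
structure TambaraFunctor (G : Type u) [Group G] (S : FinGSet G → Type*)
    [∀ X, CommRing (S X)] where
  res : ∀ {X Y : FinGSet G}, (X →[G] Y) → S Y →+* S X
  ind : ∀ {X Y : FinGSet G}, (X →[G] Y) → S X →+ S Y
  norm : ∀ {X Y : FinGSet G}, (X →[G] Y) → S X →* S Y
  res_id : ∀ (X : FinGSet G) (a : S X), res (MulActionHom.id G) a = a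
  ind_id : ∀ (X : FinGSet G) (a : S X), ind (MulActionHom.id G) a = a
  norm_id : ∀ (X : FinGSet G) (a : S X), norm (MulActionHom.id G) a = a
  res_comp : ∀ {X Y Z : FinGSet G} (f : X →[G] Y) (h : Y →[G] Z) (a : S Z),
    res (h.comp f) a = res f (res h a)
  ind_comp : ∀ {X Y Z : FinGSet G} (f : X →[G] Y) (h : Y →[G] Z) (a : S X),
    ind (h.comp f) a = ind h (ind f a)
  norm_comp : ∀ {X Y Z : FinGSet G} (f : X →[G] Y) (h : Y →[G] Z) (a : S X),
    norm (h.comp f) a = norm h (norm f a)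
  res_ind : ∀ {P X Y Z : FinGSet G} (α : P →[G] X) (β : P →[G] Y) (γ : X →[G] Z) (δ : Y →[G] Z),
    IsPullback α β γ δ → ∀ a : S X, res δ (ind γ a) = ind β (res α a)
  res_norm : ∀ {P X Y Z : FinGSet G} (α : P →[G] X) (β : P →[G] Y) (γ : X →[G] Z) (δ : Y →[G] Z),
    IsPullback α β γ δ → ∀ a : S X, res δ (norm γ a) = norm β (res α a)
  ind_sum : ∀ X Y : FinGSet G,
    Function.Bijective fun a : S X × S Y => ind (inl X Y) a.1 + ind (inr X Y) a.2
  norm_sum : ∀ X Y : FinGSet G,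
    Function.Bijective fun a : S X × S Y => norm (inl X Y) a.1 * norm (inr X Y) a.2
  norm_ind : ∀ {X Y Z X' Y' : FinGSet G} (p : Z →[G] X) (f : X →[G] Y) (e : X' →[G] Z)
    (f' : X' →[G] Y') (q : Y' →[G] Y), IsExponential p f e f' q →
    ∀ a : S Z, norm f (ind p a) = ind q (norm f' (res e a))

/-! ## Equivariant vector bundles over finite `G`-sets -/

/-- A `G`-equivariant complex vector bundle over the `G`-set `X`: a functor to finite-dimensional
complex vector spaces from the category with objects the points of `X` and a morphism `x ⟶ y` for
every `g` with `g • x = y`. -/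
structure Bundle {G : Type u} [Group G] (X : FinGSet G) where
  fib : X → Type
  [addCommGroup : ∀ x, AddCommGroup (fib x)]
  [module : ∀ x, Module ℂ (fib x)]
  [finiteDimensional : ∀ x, FiniteDimensional ℂ (fib x)]
  map : ∀ (g : G) (x y : X), g • x = y → fib x →ₗ[ℂ] fib y
  map_one : ∀ (x : X) (h : (1 : G) • x = x) (v : fib x), map 1 x x h v = v
  map_mul : ∀ (g g' : G) (x y z : X) (h : g' • x = y) (h' : g • y = z) (h'' : (g * g') • x = z)
    (v : fib x), map (g * g') x z h'' v = map g y z h' (map g' x y h v)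

attribute [instance] Bundle.addCommGroup Bundle.module Bundle.finiteDimensional

/-- The pairs `(g, x)` with `g • x = x`. -/
abbrev FixedPair {G : Type u} [Group G] (X : FinGSet G) : Type u :=
  {t : G × X // t.1 • t.2 = t.2}

namespace Bundle

variable {G : Type u} [Group G] {X Y : FinGSet G}

/-- The character of a bundle: the trace of `g` on the fibre over `x`, for `g • x = x`. -/
def character (V : Bundle X) : FixedPair X → ℂ :=
  fun t => LinearMap.trace ℂ (V.fib t.1.2) (V.map t.1.1 t.1.2 t.1.2 t.2)

/-- The trivial line bundle. -/
def triv : Bundle X where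
  fib _ := ℂ
  map _ _ _ _ := LinearMap.id
  map_one _ _ _ := rfl
  map_mul _ _ _ _ _ _ _ _ _ := rfl

/-- The fibrewise tensor product of two bundles. -/
def tensor (V W : Bundle X) : Bundle X where
  fib x := V.fib x ⊗[ℂ] W.fib x
  map g x y h := TensorProduct.map (V.map g x y h) (W.map g x y h)
  map_one x h v := by
    have h1 : V.map 1 x x h = LinearMap.id := LinearMap.ext (V.map_one x h)
    have h2 : W.map 1 x x h = LinearMap.id := LinearMap.ext (W.map_one x h)
    rw [h1, h2, TensorProduct.map_id]; rfl
  map_mul g g' x y z h h' h'' v := by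
    have h1 : V.map (g * g') x z h'' = V.map g y z h' ∘ₗ V.map g' x y h :=
      LinearMap.ext (V.map_mul g g' x y z h h' h'')
    have h2 : W.map (g * g') x z h'' = W.map g y z h' ∘ₗ W.map g' x y h :=
      LinearMap.ext (W.map_mul g g' x y z h h' h'')
    rw [h1, h2, TensorProduct.map_comp]; rfl

/-- The restriction `f^* V`, with fibre `V_{f(x)}` over `x`. -/
def pullback (f : X →[G] Y) (V : Bundle Y) : Bundle X where
  fib x := V.fib (f x)
  map g x y h := V.map g (f x) (f y) (by rw [← map_smul, h])
  map_one x _ v := V.map_one (f x) _ v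
  map_mul g g' x y z _ _ _ v := V.map_mul g g' (f x) (f y) (f z) _ _ _ v

/-- The bijection `f⁻¹(y) ≃ f⁻¹(y')`, `x ↦ g • x`, for `g • y = y'`. -/
def fibreEquiv (f : X →[G] Y) (g : G) {y y' : Y} (h : g • y = y') :
    {x : X // f x = y} ≃ {x : X // f x = y'} where
  toFun x := ⟨g • x.1, by rw [map_smul, x.2, h]⟩
  invFun x := ⟨g⁻¹ • x.1, FinGSet.smul_inv_fibre f h x.2⟩
  left_inv x := Subtype.ext (inv_smul_smul g x.1)
  right_inv x := Subtype.ext (smul_inv_smul g x.1)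

/-- The action of `g` from the fibre of `V` over `g⁻¹ • x` to the fibre over `x`. -/
def fibreMap (f : X →[G] Y) (V : Bundle X) (g : G) {y y' : Y} (h : g • y = y')
    (x : {x : X // f x = y'}) : V.fib ((fibreEquiv f g h).symm x).1 →ₗ[ℂ] V.fib x.1 :=
  V.map g ((fibreEquiv f g h).symm x).1 x.1 (smul_inv_smul g x.1)

/-- The action on families `(eₓ)` along fibres: `(g • e)ₓ = g • e_{g⁻¹ x}`. -/
def sumMap (f : X →[G] Y) (V : Bundle X) (g : G) {y y' : Y} (h : g • y = y') :
    (∀ x : {x : X // f x = y}, V.fib x.1) →ₗ[ℂ] ∀ x : {x : X // f x = y'}, V.fib x.1 :=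
  LinearMap.pi fun x => fibreMap f V g h x ∘ₗ LinearMap.proj ((fibreEquiv f g h).symm x)

theorem sumMap_apply (f : X →[G] Y) (V : Bundle X) (g : G) {y y' : Y} (h : g • y = y')
    (e : ∀ x : {x : X // f x = y}, V.fib x.1) (x : {x : X // f x = y'}) :
    sumMap f V g h e x = fibreMap f V g h x (e ((fibreEquiv f g h).symm x)) := rfl

theorem sumMap_one (f : X →[G] Y) (V : Bundle X) {y : Y} (h : (1 : G) • y = y)
    (e : ∀ x : {x : X // f x = y}, V.fib x.1) : sumMap f V 1 h e = e := by
  funext x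
  have key : ∀ (x' : {x : X // f x = y}) (h1 : (1 : G) • x'.1 = x.1), x' = x →
      V.map 1 x'.1 x.1 h1 (e x') = e x := by
    rintro x' h1 rfl
    exact V.map_one _ _ _
  exact key _ _ (Subtype.ext (by
    change (1 : G)⁻¹ • x.1 = x.1
    rw [inv_one, one_smul]))

theorem sumMap_mul (f : X →[G] Y) (V : Bundle X) (g g' : G) {y y' y'' : Y} (h : g' • y = y')
    (h' : g • y' = y'') (h'' : (g * g') • y = y'') (e : ∀ x : {x : X // f x = y}, V.fib x.1) :
    sumMap f V (g * g') h'' e = sumMap f V g h' (sumMap f V g' h e) := by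
  funext x
  have key : ∀ (x₁ x₂ : {x : X // f x = y}) (x₃ : X) (h1 : (g * g') • x₁.1 = x.1)
      (h2 : g' • x₂.1 = x₃) (h3 : g • x₃ = x.1), x₁ = x₂ →
      V.map (g * g') x₁.1 x.1 h1 (e x₁) = V.map g x₃ x.1 h3 (V.map g' x₂.1 x₃ h2 (e x₂)) := by
    rintro x₁ x₂ x₃ h1 h2 h3 rfl
    exact V.map_mul _ _ _ _ _ _ _ _ _
  exact key _ _ _ _ _ _ (Subtype.ext (by
    change (g * g')⁻¹ • x.1 = g'⁻¹ • g⁻¹ • x.1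
    rw [mul_inv_rev, mul_smul]))

/-- The induction `f_* V`, with fibre the direct sum of the `V_x`, for `x ∈ f⁻¹(y)`, over `y`, and
action `(g • e)_x = g • e_{g⁻¹ x}`. -/
def pushforward (f : X →[G] Y) (V : Bundle X) : Bundle Y where
  fib y := ∀ x : {x : X // f x = y}, V.fib x.1
  map g _ _ h := sumMap f V g h
  map_one _ h e := sumMap_one f V h e
  map_mul g g' _ _ _ h h' h'' e := sumMap_mul f V g g' h h' h'' e

/-- The action on tensor products along fibres: `g • ⨂ₓ eₓ = ⨂ₓ g • e_{g⁻¹ x}`. -/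
def tensorMap (f : X →[G] Y) (V : Bundle X) (g : G) {y y' : Y} (h : g • y = y') :
    (⨂[ℂ] x : {x : X // f x = y}, V.fib x.1) →ₗ[ℂ] ⨂[ℂ] x : {x : X // f x = y'}, V.fib x.1 :=
  PiTensorProduct.map (fibreMap f V g h) ∘ₗ
    (PiTensorProduct.reindex ℂ (fun x : {x : X // f x = y} => V.fib x.1)
      (fibreEquiv f g h)).toLinearMap

theorem tensorMap_tprod (f : X →[G] Y) (V : Bundle X) (g : G) {y y' : Y} (h : g • y = y')
    (e : ∀ x : {x : X // f x = y}, V.fib x.1) :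
    tensorMap f V g h (PiTensorProduct.tprod ℂ e) =
      PiTensorProduct.tprod ℂ (sumMap f V g h e) := by
  unfold tensorMap
  rw [LinearMap.comp_apply, LinearEquiv.coe_coe, PiTensorProduct.reindex_tprod,
    PiTensorProduct.map_tprod]
  rfl

/-- The norm (tensor induction) `f_♯ V`, with fibre the tensor product of the `V_x`, for
`x ∈ f⁻¹(y)`, over `y`. -/
def tensorInd (f : X →[G] Y) (V : Bundle X) : Bundle Y where
  fib y := ⨂[ℂ] x : {x : X // f x = y}, V.fib x.1
  map g _ _ h := tensorMap f V g h
  map_one y h v := by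
    have : tensorMap f V 1 h = LinearMap.id := by
      refine PiTensorProduct.ext (MultilinearMap.ext fun e => ?_)
      simp only [LinearMap.compMultilinearMap_apply, LinearMap.id_apply]
      rw [tensorMap_tprod, sumMap_one]
    rw [this]; rfl
  map_mul g g' y y' y'' h h' h'' v := by
    have : tensorMap f V (g * g') h'' = tensorMap f V g h' ∘ₗ tensorMap f V g' h := by
      refine PiTensorProduct.ext (MultilinearMap.ext fun e => ?_)
      simp only [LinearMap.compMultilinearMap_apply, LinearMap.comp_apply]
      rw [tensorMap_tprod, tensorMap_tprod, tensorMap_tprod, sumMap_mul f V g g' h h' h'']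
    rw [this]; rfl

/-- The fibre over `x`, as a representation of the stabilizer of `x`. -/
def fibreRep (V : Bundle X) (x : X) : FinRep (MulAction.stabilizer G x) where
  carrier := V.fib x
  ρ :=
    { toFun := fun h => V.map h.1 x x h.2
      map_one' := LinearMap.ext fun v => V.map_one x _ v
      map_mul' := fun g h => LinearMap.ext fun v => V.map_mul g.1 h.1 x x x _ _ _ v }

end Bundle

/-! ## Equivariant K-theory and its Grothendieck filtration -/

section KRing

variable {G : Type u} [Group G]

/-- The ring `K_G(X)` of virtual bundles over `X`, realised through characters: the additive group
generated by the characters of bundles. -/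
def KRing (X : FinGSet G) : Subring (FixedPair X → ℂ) where
  __ := AddSubgroup.closure (Set.range fun V : Bundle X => V.character)
  one_mem' := by
    refine AddSubgroup.subset_closure ⟨Bundle.triv, ?_⟩
    funext t
    change LinearMap.trace ℂ ℂ LinearMap.id = 1
    simp
  mul_mem' := by
    intro a b ha hb
    refine AddSubgroup.closure_induction₂
      (p := fun a b _ _ => a * b ∈ AddSubgroup.closure
        (Set.range fun V : Bundle X => V.character))
      ?_ ?_ ?_ ?_ ?_ ?_ ?_ ha hb
    · rintro _ _ ⟨V, rfl⟩ ⟨W, rfl⟩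
      refine AddSubgroup.subset_closure ⟨V.tensor W, ?_⟩
      funext t
      exact LinearMap.trace_tensorProduct' _ _
    · intro x _; rw [zero_mul]; exact zero_mem _
    · intro x _; rw [mul_zero]; exact zero_mem _
    · intro x y z _ _ _ h1 h2; rw [add_mul]; exact add_mem h1 h2
    · intro x y z _ _ _ h1 h2; rw [mul_add]; exact add_mem h1 h2
    · intro x y _ _ h; rw [neg_mul]; exact neg_mem h
    · intro x y _ _ h; rw [mul_neg]; exact neg_mem h

/-- The class of a bundle in `K_G(X)`. -/
def Bundle.cls {X : FinGSet G} (V : Bundle X) : KRing X :=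
  ⟨V.character, AddSubgroup.subset_closure ⟨V, rfl⟩⟩

/-- The ring homomorphism `K_G(X) → R(Stab x)` taking a virtual bundle to its fibre over `x`. -/
def fibreHom (X : FinGSet G) (x : X) : KRing X →+* charRing (MulAction.stabilizer G x) where
  toFun v := ⟨fun h => v.1 ⟨(h.1, x), h.2⟩, by
    obtain ⟨v, hv⟩ := v
    refine AddSubgroup.closure_induction
      (p := fun (v : FixedPair X → ℂ) _ =>
        (fun h : MulAction.stabilizer G x => v ⟨(h.1, x), h.2⟩) ∈
          charRing (MulAction.stabilizer G x)) ?_ ?_ ?_ ?_ hv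
    · rintro _ ⟨V, rfl⟩
      exact (V.fibreRep x).char.2
    · exact (charRing _).zero_mem
    · intro a b _ _ ha hb; exact (charRing _).add_mem ha hb
    · intro a _ ha; exact (charRing _).neg_mem ha⟩
  map_one' := rfl
  map_mul' _ _ := rfl
  map_zero' := rfl
  map_add' _ _ := rfl

/-- The Grothendieck filtration on `K_G(X)`: a virtual bundle is in `Γⁿ` when, for every point `x`,
its fibre over `x` is in `Γⁿ(R(Stab x))`. -/
def KFiltration (X : FinGSet G) : MulFiltration (KRing X) where
  level n := ⨅ x : X,
    ((gammaFiltration (MulAction.stabilizer G x)).level n).comap (fibreHom X x).toAddMonoidHom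
  antitone_level := by
    intro m n hmn
    exact iInf_mono fun x =>
      AddSubgroup.comap_mono ((gammaFiltration (MulAction.stabilizer G x)).antitone_level hmn)
  one_mem_level := by
    simp only [AddSubgroup.mem_iInf, AddSubgroup.mem_comap]
    intro x
    exact (map_one (fibreHom X x)).symm ▸ (gammaFiltration _).one_mem_level
  mul_mem_level := by
    intro m n a b ha hb
    simp only [AddSubgroup.mem_iInf, AddSubgroup.mem_comap] at ha hb ⊢
    intro x
    exact (map_mul (fibreHom X x) a b).symm ▸ (gammaFiltration _).mul_mem_level (ha x) (hb x)

theorem fibreHom_mem {X : FinGSet G} {n : ℕ} {v : KRing X} (hv : v ∈ (KFiltration X).level n)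
    (x : X) : fibreHom X x v ∈ (gammaFiltration (MulAction.stabilizer G x)).level n :=
  (AddSubgroup.mem_iInf.1 hv) x

/-- The graded character ring of the finite `G`-set `X`; over an orbit `G/H` it is `R*(H)`. -/
abbrev gradedK (X : FinGSet G) : Type u := (KFiltration X).gr

end KRing

/-! ## Compatibilities -/

variable {G : Type u} [Group G]

/-- The Tambara structure on `K_G` is given on actual bundles by restriction, induction and tensor
induction. -/
structure ExtendsBundles (T : TambaraFunctor G fun X => KRing X) : Prop where
  res : ∀ {X Y : FinGSet G} (f : X →[G] Y) (V : Bundle Y), T.res f V.cls = (V.pullback f).cls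
  ind : ∀ {X Y : FinGSet G} (f : X →[G] Y) (V : Bundle X), T.ind f V.cls = (V.pushforward f).cls
  norm : ∀ {X Y : FinGSet G} (f : X →[G] Y) (V : Bundle X), T.norm f V.cls = (V.tensorInd f).cls

/-- The Tambara structure `T'` on graded character rings is induced by the Tambara structure `T`
on `K_G`: restriction and induction preserve the filtration, the norm along a map all of whose
fibres have `k` points takes `Γⁿ` to `Γⁿᵏ`, and the operations of `T'` on homogeneous elements are
the operations of `T` on representatives. -/
structure IsInducedBy (T' : TambaraFunctor G fun X => gradedK X)
    (T : TambaraFunctor G fun X => KRing X) : Prop where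
  res : ∀ {X Y : FinGSet G} (f : X →[G] Y) (n : ℕ) (v : KRing Y)
    (hv : v ∈ (KFiltration Y).level n), ∃ h : T.res f v ∈ (KFiltration X).level n,
      T'.res f ((KFiltration Y).cls n v hv) = (KFiltration X).cls n (T.res f v) h
  ind : ∀ {X Y : FinGSet G} (f : X →[G] Y) (n : ℕ) (v : KRing X)
    (hv : v ∈ (KFiltration X).level n), ∃ h : T.ind f v ∈ (KFiltration Y).level n,
      T'.ind f ((KFiltration X).cls n v hv) = (KFiltration Y).cls n (T.ind f v) h
  norm : ∀ {X Y : FinGSet G} (f : X →[G] Y) (k : ℕ), (∀ y, Nat.card {x : X // f x = y} = k) →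
    ∀ (n : ℕ) (v : KRing X) (hv : v ∈ (KFiltration X).level n),
      ∃ h : T.norm f v ∈ (KFiltration Y).level (n * k),
        T'.norm f ((KFiltration X).cls n v hv) = (KFiltration Y).cls (n * k) (T.norm f v) h

end

end GradedChar

open GradedChar

/-!
All rings in the theorem are subquotients of one ring on which the three operations have closed
formulas. For a finite `G`-set `X` let `Ghost X` be the ring of invariant functions on the pairs
`(g, x)` with `g • x = x` with values in `ℂ[t]`. Restriction is composition with the map, induction
is the sum over the fixed points in the fibre, and the norm at `(g, y)` is the product, over the
cycles of `g` on the fibre of `y`, of `φ (gᵐ, x)` with `t` replaced by `tᵐ`, where `m` is the length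
of the cycle and `x` a point of it. The laws of a Tambara functor are identities between such sums
and products; the main one is the exponential formula `gNorm_gInd_eval`, which expands a product of
sums as a sum over fixed sections. Subrings and quotients stable under the operations are then
again Tambara functors (`GhostSubquotient.tambara`).

Virtual bundles are constant ghosts, by their characters. On actual bundles the operations are the
geometric ones: as `G` is abelian, every bundle has bases of its fibres that `G` permutes up to
scalars (`exists_monomial_basis`), so it is induced from a line bundle over a `G`-set `Z`, and the
character of the tensor induction becomes a sum over the fixed sections of `Z`, as in the
exponential formula (`gNorm_degreeGhost_cls`).

The graded ring is the quotient of the ring of ghosts `∑ₙ vₙ tⁿ` with `vₙ ∈ Γⁿ` (weight zero) by the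
ideal of those with `vₙ ∈ Γⁿ⁺¹` (weight one), that is, of the Rees ring `⨁ₙ Γⁿ tⁿ` by its shift. So
restriction, induction and norm have to respect weights, and the norm has to respect congruence
modulo weight one. For an abelian group `H`, the filtration `Γⁿ` is the filtration by powers of the
augmentation ideal (`mem_gamma_iff`), generated by products of a character and factors `χ - 1`. As
characters of subgroups extend, everything may be written with characters of `G`.
* For induction, the factor `|K / H|` on `H` that appears in the character is the sum of the
  characters `θ` of `K / H`, and these lie in `Γ⁰` (`HasWeight.ind`).
* The norm from `H` to `K` of `χ - 1`, for a character `χ` of `K`, is `∏ (χ - θ)` over the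
  characters `θ` of `K / H` (`prod_dual_sub`), which lies in the power `[K : H]` of the augmentation
  ideal. So `χ - 1`, `(χ - 1) t` and their products with characters have norms of the expected
  weight; such functions are called admissible.
* A general ghost is a sum of admissible ones, hence induced along a projection `X × Fin M → X` from
  an admissible one, and the exponential formula gives the weight of its norm (`HasWeight.norm`).
* In the exponential formula for the norm of `a + b`, with `b` of weight one, every section that
  meets the summand `b` contributes weight at least one (`hasWeight_gNorm_add_sub`).

Over a transitive `G`-set, the value of a virtual bundle at one point determines it, and every
virtual character of the stabilizer occurs, because it extends to `G`; this gives the identification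
with the graded character ring of the stabilizer (`exists_gradedK_equiv`).
-/

open scoped TensorProduct DirectSum

namespace GradedChar

noncomputable section

open scoped Classical

/-! ### Products over the classes of an equivalence relation -/

section OrbitProducts

variable {X Y : Type*} [Finite X] [Finite Y] {A : Type*} [CommMonoid A]

/-- The classes of `r` whose chosen representative satisfies `p`. It is used for predicates `p`
that are constant on classes. -/
def classesIn (r : Setoid X) (p : X → Prop) : Finset (Quotient r) :=
  (Set.toFinite {o : Quotient r | p o.out}).toFinset

@[simp]
theorem mem_classesIn {r : Setoid X} {p : X → Prop} {o : Quotient r} :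
    o ∈ classesIn r p ↔ p o.out := by
  simp [classesIn]

/-- Transport of a product over equivalence classes along a map `α` that is injective on classes
in `p` and reaches all classes in `q`. -/
theorem prod_classesIn_congr (r : Setoid X) (r' : Setoid Y) (p : X → Prop) (q : Y → Prop)
    (α : X → Y) (F : Y → A) (hp : ∀ x x', r x x' → p x → p x')
    (hq : ∀ y y', r' y y' → q y → q y') (hF : ∀ y y', r' y y' → q y → F y = F y')
    (hpq : ∀ x, p x → q (α x)) (hr : ∀ x x', p x → p x' → (r' (α x) (α x') ↔ r x x'))
    (hsurj : ∀ y, q y → ∃ x, p x ∧ r' (α x) y) :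
    ∏ o ∈ classesIn r p, F (α o.out) = ∏ o ∈ classesIn r' q, F o.out := by
  refine Finset.prod_bij (fun o _ => Quotient.mk r' (α o.out)) ?_ ?_ ?_ ?_
  · intro o ho
    rw [mem_classesIn] at ho ⊢
    exact hq _ _ (r'.symm (Quotient.mk_out (s := r') _)) (hpq _ ho)
  · intro o ho o' ho' h
    rw [mem_classesIn] at ho ho'
    have := (hr _ _ ho ho').1 (Quotient.exact h)
    rw [← Quotient.out_eq o, ← Quotient.out_eq o']
    exact Quotient.sound this
  · intro o ho
    rw [mem_classesIn] at ho
    obtain ⟨x, hx, hxo⟩ := hsurj _ ho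
    have hx' : r x (Quotient.mk r x).out := r.symm (Quotient.mk_out (s := r) x)
    have hpx := hp _ _ hx' hx
    refine ⟨Quotient.mk r x, mem_classesIn.2 hpx, ?_⟩
    rw [← Quotient.out_eq o]
    exact Quotient.sound (r'.trans ((hr _ _ hpx hx).2 (r.symm hx')) hxo)
  · intro o ho
    rw [mem_classesIn] at ho
    exact hF _ _ (r'.symm (Quotient.mk_out (s := r') _)) (hpq _ ho)

/-- A product over the classes of `r` in `p ∘ f` can be taken in two steps, over the classes of `r'`
in `p` and over the classes of `r` above them. -/
theorem prod_classesIn_fiberwise (r : Setoid X) (r' : Setoid Y) (f : X → Y) (p : Y → Prop)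
    (F : X → A) (hp : ∀ y y', r' y y' → p y → p y') :
    ∏ o' ∈ classesIn r' p, ∏ o ∈ classesIn r (fun x => r' (f x) o'.out), F o.out =
      ∏ o ∈ classesIn r (fun x => p (f x)), F o.out := by
  rw [← Finset.prod_fiberwise_of_maps_to (s := classesIn r fun x => p (f x))
    (t := classesIn r' p) (g := fun o => Quotient.mk r' (f o.out))]
  · refine Finset.prod_congr rfl fun o' ho' => Finset.prod_congr ?_ fun _ _ => rfl
    ext o
    rw [mem_classesIn] at ho'
    simp only [mem_classesIn, Finset.mem_filter]
    constructor
    · intro h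
      refine ⟨hp _ _ (r'.symm h) ho', ?_⟩
      rw [← Quotient.out_eq o']
      exact Quotient.sound h
    · rintro ⟨_, rfl⟩
      exact r'.symm (Quotient.mk_out (s := r') _)
  · intro o ho
    rw [mem_classesIn] at ho ⊢
    exact hp _ _ (r'.symm (Quotient.mk_out (s := r') _)) ho

end OrbitProducts

/-! ### The cycles of a group element -/

section Cycles

variable {G : Type u} [CommGroup G] {X Y : Type*} [MulAction G X] [MulAction G Y]

/-- The equivalence relation on `X` whose classes are the cycles of `g`. -/
def cycleRel (g : G) (X : Type*) [MulAction G X] : Setoid X where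
  r x x' := ∃ k : ℤ, g ^ k • x = x'
  iseqv :=
    { refl := fun x => ⟨0, by simp⟩
      symm := by
        rintro x _ ⟨k, rfl⟩
        exact ⟨-k, by rw [smul_smul, ← zpow_add]; simp⟩
      trans := by
        rintro x _ _ ⟨k, rfl⟩ ⟨l, rfl⟩
        exact ⟨l + k, by rw [zpow_add, mul_smul]⟩ }

theorem cycleRel_iff {g : G} {x x' : X} : cycleRel g X x x' ↔ ∃ k : ℤ, g ^ k • x = x' := Iff.rfl

theorem cycleRel_map (f : X →[G] Y) {g : G} {x x' : X} (h : cycleRel g X x x') :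
    cycleRel g Y (f x) (f x') := by
  obtain ⟨k, rfl⟩ := h
  exact ⟨k, (map_smul f _ _).symm⟩

theorem zpow_smul_of_fixed {g : G} {y : Y} (hy : g • y = y) (k : ℤ) : g ^ k • y = y := by
  have : g ∈ MulAction.stabilizer G y := hy
  exact (zpow_mem this k : g ^ k ∈ MulAction.stabilizer G y)

theorem pow_smul_of_fixed {g : G} {y : Y} (hy : g • y = y) (k : ℕ) : g ^ k • y = y := by
  simpa using zpow_smul_of_fixed hy k

theorem map_eq_of_cycleRel (f : X →[G] Y) {g : G} {y : Y} (hy : g • y = y) {x x' : X}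
    (h : cycleRel g X x x') (hx : f x = y) : f x' = y := by
  obtain ⟨k, rfl⟩ := h
  rw [map_smul, hx, zpow_smul_of_fixed hy]

theorem period_smul (g h : G) (x : X) : MulAction.period g (h • x) = MulAction.period g x := by
  refine Nat.dvd_antisymm ?_ ?_ <;> rw [← MulAction.pow_smul_eq_iff_period_dvd]
  · rw [smul_comm, MulAction.pow_period_smul]
  · have := MulAction.pow_period_smul g (h • x)
    rwa [smul_comm, smul_left_cancel_iff] at this

theorem period_eq_of_smul_iff {g : G} {x : X} {y : Y}
    (h : ∀ k : ℕ, g ^ k • x = x ↔ g ^ k • y = y) :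
    MulAction.period g x = MulAction.period g y := by
  refine Nat.dvd_antisymm ?_ ?_ <;> rw [← MulAction.pow_smul_eq_iff_period_dvd]
  · rw [h, MulAction.pow_period_smul]
  · rw [← h, MulAction.pow_period_smul]

theorem period_pos [Finite G] (g : G) (x : X) : 0 < MulAction.period g x :=
  MulAction.period_pos_of_orderOf_pos (orderOf_pos g) x

end Cycles

/-! ### Ghost rings and their operations -/

section Ghost

variable {G : Type u} [CommGroup G]

instance (X : FinGSet G) : Fintype X := Fintype.ofFinite X

/-- The ghost ring of `X`: functions on the pairs `(g, x)` with `g • x = x`, invariant under the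
action of `G` on the second entry, with values in `ℂ[t]`. The variable `t` keeps track of the
degree, so that an element of the ghost ring is a polynomial `∑ₙ vₙ tⁿ` whose coefficients are
class functions. -/
def Ghost (X : FinGSet G) : Subring (FixedPair X → Polynomial ℂ) where
  carrier := {φ | ∀ (g h : G) (x : X) (hx : g • x = x) (hx' : g • h • x = h • x),
    φ ⟨(g, h • x), hx'⟩ = φ ⟨(g, x), hx⟩}
  mul_mem' ha hb := by
    intro g h x hx hx'
    simp only [Pi.mul_apply]
    rw [ha g h x hx hx', hb g h x hx hx']
  one_mem' := by intro g h x hx hx'; rfl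
  add_mem' ha hb := by
    intro g h x hx hx'
    simp only [Pi.add_apply]
    rw [ha g h x hx hx', hb g h x hx hx']
  zero_mem' := by intro g h x hx hx'; rfl
  neg_mem' ha := by
    intro g h x hx hx'
    simp only [Pi.neg_apply]
    rw [ha g h x hx hx']

/-- The value of a function on fixed pairs, extended by zero to all pairs `(g, x)`. -/
def ev {X : FinGSet G} {A : Type*} [Zero A] (φ : FixedPair X → A) (g : G) (x : X) : A :=
  if h : g • x = x then φ ⟨(g, x), h⟩ else 0

theorem ev_of_fixed {X : FinGSet G} {A : Type*} [Zero A] (φ : FixedPair X → A) {g : G} {x : X}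
    (h : g • x = x) : ev φ g x = φ ⟨(g, x), h⟩ := dif_pos h

theorem ev_of_not_fixed {X : FinGSet G} {A : Type*} [Zero A] (φ : FixedPair X → A) {g : G} {x : X}
    (h : g • x ≠ x) : ev φ g x = 0 := dif_neg h

theorem fixedPair_ext {X : FinGSet G} {A : Type*} [Zero A] {φ φ' : FixedPair X → A}
    (h : ∀ (g : G) (x : X), g • x = x → ev φ g x = ev φ' g x) : φ = φ' := by
  funext ⟨⟨g, x⟩, hx⟩
  have := h g x hx
  rwa [ev_of_fixed _ hx, ev_of_fixed _ hx] at this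

theorem ghost_ext {X : FinGSet G} {φ φ' : Ghost X}
    (h : ∀ (g : G) (x : X), g • x = x → ev φ.1 g x = ev φ'.1 g x) : φ = φ' :=
  Subtype.ext (fixedPair_ext h)

theorem ev_add {X : FinGSet G} {A : Type*} [AddMonoid A] (φ φ' : FixedPair X → A) (g : G) (x : X) :
    ev (φ + φ') g x = ev φ g x + ev φ' g x := by
  unfold ev; split_ifs <;> simp

theorem ev_mul {X : FinGSet G} {A : Type*} [MulZeroClass A] (φ φ' : FixedPair X → A) (g : G)
    (x : X) : ev (φ * φ') g x = ev φ g x * ev φ' g x := by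
  unfold ev; split_ifs <;> simp

theorem ev_zero {X : FinGSet G} {A : Type*} [Zero A] (g : G) (x : X) :
    ev (0 : FixedPair X → A) g x = 0 := by
  unfold ev; split_ifs <;> rfl

theorem ev_neg {X : FinGSet G} {A : Type*} [AddGroup A] (φ : FixedPair X → A) (g : G)
    (x : X) : ev (-φ) g x = -ev φ g x := by
  unfold ev; split_ifs <;> simp

theorem ev_sub {X : FinGSet G} {A : Type*} [AddGroup A] (φ φ' : FixedPair X → A) (g : G)
    (x : X) : ev (φ - φ') g x = ev φ g x - ev φ' g x := by
  unfold ev; split_ifs <;> simp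

theorem ev_one {X : FinGSet G} {A : Type*} [Zero A] [One A] {g : G} {x : X} (h : g • x = x) :
    ev (1 : FixedPair X → A) g x = 1 := by
  rw [ev_of_fixed _ h]; rfl

theorem fixed_smul_iff {X : Type*} [MulAction G X] {g h : G} {x : X} :
    g • h • x = h • x ↔ g • x = x := by
  rw [smul_comm, smul_left_cancel_iff]

theorem ev_smul {X : FinGSet G} (φ : Ghost X) (g h : G) (x : X) :
    ev φ.1 g (h • x) = ev φ.1 g x := by
  by_cases hx : g • x = x
  · rw [ev_of_fixed _ hx, ev_of_fixed _ (fixed_smul_iff.2 hx)]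
    exact φ.2 g h x hx _
  · rw [ev_of_not_fixed _ hx, ev_of_not_fixed _ (fun h' => hx (fixed_smul_iff.1 h'))]

variable {X Y Z : FinGSet G}

/-- Restriction of ghosts. -/
def gRes (f : X →[G] Y) : Ghost Y →+* Ghost X where
  toFun φ := ⟨fun t => φ.1 ⟨(t.1.1, f t.1.2), by rw [← map_smul, t.2]⟩, by
    intro g h x hx hx'
    have key := ev_smul φ g h (f x)
    have hf : g • f x = f x := by rw [← map_smul, hx]
    rw [ev_of_fixed _ hf, ← map_smul, ev_of_fixed _ (by rw [← map_smul, hx'])] at key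
    exact key⟩
  map_one' := rfl
  map_mul' _ _ := rfl
  map_zero' := rfl
  map_add' _ _ := rfl

theorem ev_gRes (f : X →[G] Y) (φ : Ghost Y) {g : G} {x : X} (hx : g • x = x) :
    ev (gRes f φ).1 g x = ev φ.1 g (f x) := by
  rw [ev_of_fixed _ hx, ev_of_fixed]; rfl

/-- Induction of ghosts. -/
def gInd (f : X →[G] Y) : Ghost X →+ Ghost Y where
  toFun φ := ⟨fun t => ∑ x : X with f x = t.1.2, ev φ.1 t.1.1 x, by
    intro g h y hy hy'
    refine Finset.sum_bij' (fun x _ => h⁻¹ • x) (fun x _ => h • x) ?_ ?_ ?_ ?_ ?_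
    · intro x hx
      rw [Finset.mem_filter] at hx ⊢
      simp [map_smul, hx.2]
    · intro x hx
      rw [Finset.mem_filter] at hx ⊢
      simp [map_smul, hx.2]
    · intro x hx; simp
    · intro x hx; simp
    · intro x hx; rw [ev_smul]⟩
  map_zero' := Subtype.ext (funext fun t => by
    change ∑ x : X with f x = t.1.2, ev (0 : FixedPair X → Polynomial ℂ) t.1.1 x = 0
    simp [ev_zero])
  map_add' φ φ' := Subtype.ext (funext fun t => by
    change ∑ x : X with f x = t.1.2, ev (φ.1 + φ'.1) t.1.1 x = _
    simp_rw [ev_add, Finset.sum_add_distrib]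
    rfl)

theorem ev_gInd (f : X →[G] Y) (φ : Ghost X) {g : G} {y : Y} (hy : g • y = y) :
    ev (gInd f φ).1 g y = ∑ x : X with f x = y, ev φ.1 g x := by
  rw [ev_of_fixed _ hy]; rfl

/-- The contribution to the norm of the cycle of `g` through `x`: the value of `φ` at `(gᵐ, x)`,
where `m` is the length of the cycle, with `t` replaced by `tᵐ`. -/
def cycleValue (φ : FixedPair X → Polynomial ℂ) (g : G) (x : X) : Polynomial ℂ :=
  Polynomial.expand ℂ (MulAction.period g x) (ev φ (g ^ MulAction.period g x) x)

theorem cycleValue_eq (φ : FixedPair X → Polynomial ℂ) (g : G) (x : X) {m : ℕ}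
    (hm : MulAction.period g x = m) :
    cycleValue φ g x = Polynomial.expand ℂ m (ev φ (g ^ m) x) := by
  subst hm; rfl

theorem cycleValue_smul (φ : Ghost X) (g h : G) (x : X) :
    cycleValue φ.1 g (h • x) = cycleValue φ.1 g x := by
  unfold cycleValue; rw [period_smul, ev_smul]

theorem cycleValue_congr (φ : Ghost X) {g : G} {x x' : X} (h : cycleRel g X x x') :
    cycleValue φ.1 g x = cycleValue φ.1 g x' := by
  obtain ⟨k, rfl⟩ := h; rw [cycleValue_smul]

theorem cycleValue_mul (φ φ' : Ghost X) (g : G) (x : X) :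
    cycleValue (φ * φ').1 g x = cycleValue φ.1 g x * cycleValue φ'.1 g x := by
  unfold cycleValue
  rw [← map_mul, ← ev_mul]; rfl

theorem cycleValue_one (g : G) (x : X) : cycleValue (1 : Ghost X).1 g x = 1 := by
  unfold cycleValue
  change Polynomial.expand ℂ _ (ev (1 : FixedPair X → Polynomial ℂ) _ _) = 1
  rw [ev_one (MulAction.pow_period_smul g x), map_one]

/-- The norm of ghosts: the product over the cycles of `g` on the fibre of the contributions of
the cycles. -/
def gNorm (f : X →[G] Y) : Ghost X →* Ghost Y where
  toFun φ := ⟨fun t => ∏ o ∈ classesIn (cycleRel t.1.1 X) (fun x => f x = t.1.2),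
      cycleValue φ.1 t.1.1 o.out, by
    intro g h y hy hy'
    symm
    change ∏ o ∈ classesIn (cycleRel g X) (fun x => f x = y), cycleValue φ.1 g o.out =
      ∏ o ∈ classesIn (cycleRel g X) (fun x => f x = h • y), cycleValue φ.1 g o.out
    rw [← prod_classesIn_congr (cycleRel g X) (cycleRel g X) (fun x => f x = y)
      (fun x => f x = h • y) (fun x => h • x) (cycleValue φ.1 g)]
    · simp_rw [cycleValue_smul]
    · exact fun x x' hx => map_eq_of_cycleRel f hy hx
    · exact fun x x' hx => map_eq_of_cycleRel f hy' hx
    · exact fun x x' hx _ => cycleValue_congr φ hx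
    · rintro x rfl; exact map_smul f h x
    · intro x x' _ _
      simp only [cycleRel_iff]
      refine exists_congr fun k => ?_
      rw [smul_comm, smul_left_cancel_iff]
    · intro x hx
      exact ⟨h⁻¹ • x, by simp [map_smul, hx], by simp⟩⟩
  map_one' := Subtype.ext (funext fun t => Finset.prod_eq_one fun o _ => cycleValue_one _ _)
  map_mul' φ φ' := Subtype.ext (funext fun t => by
    change ∏ o ∈ classesIn _ _, cycleValue (φ * φ').1 t.1.1 o.out = _
    simp_rw [cycleValue_mul, Finset.prod_mul_distrib]
    rfl)

theorem ev_gNorm (f : X →[G] Y) (φ : Ghost X) {g : G} {y : Y} (hy : g • y = y) :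
    ev (gNorm f φ).1 g y =
      ∏ o ∈ classesIn (cycleRel g X) (fun x => f x = y), cycleValue φ.1 g o.out := by
  rw [ev_of_fixed _ hy]; rfl

theorem period_of_fixed {g : G} {x : X} (h : g • x = x) : MulAction.period g x = 1 :=
  MulAction.period_eq_one_iff.2 h

theorem cycleValue_of_fixed (φ : FixedPair X → Polynomial ℂ) {g : G} {x : X} (h : g • x = x) :
    cycleValue φ g x = ev φ g x := by
  rw [cycleValue_eq φ g x (period_of_fixed h), pow_one, Polynomial.expand_one]

/-- Change of fibre: the product over the cycles in the fibre of `f` over a point fixed by `g`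
can be computed on a fibre of another map in equivariant bijection with it. -/
theorem prod_fibre_congr {W V : FinGSet G} (f : X →[G] Y) (f' : W →[G] V) (α : W →[G] X)
    {g : G} {y : Y} {v : V} (hy : g • y = y) (hv : g • v = v)
    (hα : ∀ w, f' w = v → f (α w) = y)
    (hbij : ∀ x, f x = y → ∃! w, f' w = v ∧ α w = x)
    (F : X → Polynomial ℂ) (hF : ∀ x x', cycleRel g X x x' → F x = F x') :
    ∏ o ∈ classesIn (cycleRel g W) (fun w => f' w = v), F (α o.out) =
      ∏ o ∈ classesIn (cycleRel g X) (fun x => f x = y), F o.out := by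
  refine prod_classesIn_congr _ _ _ _ α F ?_ ?_ ?_ hα ?_ ?_
  · exact fun x x' h => map_eq_of_cycleRel f' hv h
  · exact fun x x' h => map_eq_of_cycleRel f hy h
  · exact fun x x' h _ => hF x x' h
  · intro w w' hw hw'
    refine ⟨?_, cycleRel_map α⟩
    rintro ⟨k, hk⟩
    refine ⟨k, (hbij _ (hα w' hw')).unique ⟨?_, ?_⟩ ⟨hw', rfl⟩⟩
    · rw [map_smul, hw, zpow_smul_of_fixed hv]
    · rw [map_smul, hk]
  · intro x hx
    obtain ⟨w, ⟨hw, rfl⟩, -⟩ := hbij x hx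
    exact ⟨w, hw, (cycleRel g X).refl _⟩

/-- Equivariant bijections of fibres preserve the length of cycles. -/
theorem period_eq_of_fibre {W V : FinGSet G} (f' : W →[G] V) (α : W →[G] X)
    {g : G} {v : V} (hv : g • v = v)
    (hinj : ∀ w w', f' w = v → f' w' = v → α w = α w' → w = w') {w : W} (hw : f' w = v) :
    MulAction.period g w = MulAction.period g (α w) := by
  refine period_eq_of_smul_iff fun k => ⟨fun h => by rw [← map_smul, h], fun h => ?_⟩
  refine hinj _ _ ?_ hw (by rw [map_smul, h])
  rw [map_smul, hw, pow_smul_of_fixed hv]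

/-! ### The laws of a Tambara functor for ghosts -/

theorem gRes_comp (f : X →[G] Y) (h : Y →[G] Z) (a : Ghost Z) :
    gRes (h.comp f) a = gRes f (gRes h a) := rfl

theorem gInd_id (a : Ghost X) : gInd (MulActionHom.id G) a = a := by
  refine ghost_ext fun g x hx => ?_
  rw [ev_gInd _ _ hx]
  have : (Finset.univ.filter fun x' : X => MulActionHom.id G x' = x) = {x} := by
    ext x'; simp
  rw [this, Finset.sum_singleton]

theorem gInd_comp (f : X →[G] Y) (h : Y →[G] Z) (a : Ghost X) :
    gInd (h.comp f) a = gInd h (gInd f a) := by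
  refine ghost_ext fun g z hz => ?_
  rw [ev_gInd _ _ hz, ev_gInd _ _ hz]
  rw [← Finset.sum_fiberwise_of_maps_to (s := Finset.univ.filter fun x => (h.comp f) x = z)
    (t := Finset.univ.filter fun y => h y = z) (g := f)]
  · refine Finset.sum_congr rfl fun y hy => ?_
    rw [Finset.mem_filter] at hy
    have hset : (Finset.univ.filter fun x => (h.comp f) x = z).filter (fun x => f x = y)
        = Finset.univ.filter fun x => f x = y := by
      ext x
      simp only [Finset.mem_filter, Finset.mem_univ, true_and]
      refine ⟨fun h => h.2, fun hx => ⟨?_, hx⟩⟩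
      rw [← hy.2, ← hx]; rfl
    rw [hset]
    by_cases hgy : g • y = y
    · rw [ev_gInd _ _ hgy]
    · rw [ev_of_not_fixed _ hgy]
      refine Finset.sum_eq_zero fun x hx => ev_of_not_fixed _ fun hgx => hgy ?_
      rw [Finset.mem_filter] at hx
      rw [← hx.2, ← map_smul, hgx]
  · intro x hx
    rw [Finset.mem_filter] at hx ⊢
    exact ⟨Finset.mem_univ _, hx.2⟩

theorem gNorm_id (a : Ghost X) : gNorm (MulActionHom.id G) a = a := by
  refine ghost_ext fun g x hx => ?_
  rw [ev_gNorm _ _ hx]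
  rw [Finset.prod_eq_single (Quotient.mk (cycleRel g X) x)]
  · rw [cycleValue_congr a (Quotient.mk_out (s := cycleRel g X) x), cycleValue_of_fixed _ hx]
  · intro o ho ho'
    rw [mem_classesIn] at ho
    refine absurd ?_ ho'
    rw [← ho]
    exact (Quotient.out_eq o).symm
  · intro h
    refine absurd (mem_classesIn.2 ?_) h
    exact map_eq_of_cycleRel (MulActionHom.id G) hx
      ((cycleRel g X).symm (Quotient.mk_out (s := cycleRel g X) x)) rfl

theorem pow_zpow_smul_cancel {g : G} {k : ℤ} {x : X} : g ^ (-k) • g ^ k • x = x := by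
  rw [smul_smul, ← zpow_add]; simp

/-- The contribution of a cycle to a norm is again a product over cycles: the cycles of `gᵐ` on the
fibre over `y`, with `m` the length of the cycle of `y`, are in bijection with the cycles of
`g` lying over that of `y`. -/
theorem cycleValue_gNorm [Finite G] (f : X →[G] Y) (a : Ghost X) (g : G) (y : Y) :
    cycleValue (gNorm f a).1 g y =
      ∏ o ∈ classesIn (cycleRel g X) (fun x => cycleRel g Y (f x) y), cycleValue a.1 g o.out := by
  obtain ⟨m, hm⟩ : ∃ m, MulAction.period g y = m := ⟨_, rfl⟩
  have hmpos : 0 < m := hm ▸ period_pos g y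
  have hy : g ^ m • y = y := hm ▸ MulAction.pow_period_smul g y
  have hdvd : ∀ k : ℤ, g ^ k • y = y → ∃ l : ℤ, k = m * l := fun k hk => by
    have := MulAction.zpow_smul_eq_iff_period_dvd.1 hk
    rwa [hm] at this
  have hrel : ∀ x x' : X, cycleRel (g ^ m) X x x' → cycleRel g X x x' := by
    rintro x _ ⟨k, rfl⟩
    exact ⟨m * k, by rw [zpow_mul, zpow_natCast]⟩
  rw [cycleValue_eq _ _ _ hm, ev_gNorm f a hy, map_prod]
  rw [← prod_classesIn_congr (cycleRel (g ^ m) X) (cycleRel g X) (fun x => f x = y)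
    (fun x => cycleRel g Y (f x) y) id (cycleValue a.1 g)]
  · refine Finset.prod_congr rfl fun o ho => ?_
    rw [mem_classesIn] at ho
    set x := o.out
    -- the cycle of `g` through `x` is `m` times as long as that of `g ^ m`
    have hper : MulAction.period g x = m * MulAction.period (g ^ m) x := by
      refine Nat.dvd_antisymm ?_ ?_
      · rw [← MulAction.pow_smul_eq_iff_period_dvd, pow_mul, MulAction.pow_period_smul]
      · have hx : g ^ MulAction.period g x • y = y := by
          rw [← ho, ← map_smul, MulAction.pow_period_smul]
        rw [MulAction.pow_smul_eq_iff_period_dvd, hm] at hx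
        obtain ⟨l, hl⟩ := hx
        rw [hl]
        refine Nat.mul_dvd_mul_left m ?_
        rw [← MulAction.pow_smul_eq_iff_period_dvd, ← pow_mul, ← hl, MulAction.pow_period_smul]
    rw [id, cycleValue_eq _ _ _ hper, Polynomial.expand_mul, cycleValue, ← pow_mul]
  · exact fun x x' h => map_eq_of_cycleRel f hy h
  · intro x x' h hx
    exact (cycleRel g Y).trans ((cycleRel g Y).symm (cycleRel_map f h)) hx
  · exact fun x x' h _ => cycleValue_congr a h
  · rintro x rfl
    exact (cycleRel g Y).refl _
  · intro x x' hx hx'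
    refine ⟨?_, hrel x x'⟩
    rintro ⟨k, hk⟩
    change g ^ k • x = x' at hk
    have : g ^ k • y = y := by rw [← hx, ← map_smul, hk, hx', hx]
    obtain ⟨l, rfl⟩ := hdvd k this
    exact ⟨l, by rw [← hk, zpow_mul, zpow_natCast]⟩
  · rintro x ⟨k, hk⟩
    exact ⟨g ^ k • x, by rw [map_smul, hk], -k, pow_zpow_smul_cancel⟩

/-- Norms compose: both sides are the product over the cycles of `g` on the fibre of `h ∘ f`, on the
right grouped by the cycles of `g` on the fibre of `h` below them. -/
theorem gNorm_comp [Finite G] (f : X →[G] Y) (h : Y →[G] Z) (a : Ghost X) :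
    gNorm (h.comp f) a = gNorm h (gNorm f a) := by
  refine ghost_ext fun g z hz => ?_
  rw [ev_gNorm _ _ hz, ev_gNorm _ _ hz]
  simp_rw [cycleValue_gNorm]
  exact (prod_classesIn_fiberwise _ _ f (fun y => h y = z) (cycleValue a.1 g)
    fun y y' hy => map_eq_of_cycleRel h hz hy).symm

theorem gRes_gInd {P : FinGSet G} (α : P →[G] X) (β : P →[G] Y) (γ : X →[G] Z) (δ : Y →[G] Z)
    (h : FinGSet.IsPullback α β γ δ) (a : Ghost X) :
    gRes δ (gInd γ a) = gInd β (gRes α a) := by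
  refine ghost_ext fun g y hy => ?_
  have hδ : g • δ y = δ y := by rw [← map_smul, hy]
  rw [ev_gRes _ _ hy, ev_gInd _ _ hδ, ev_gInd _ _ hy]
  symm
  refine Finset.sum_bij (fun t _ => α t) ?_ ?_ ?_ ?_
  · intro t ht
    rw [Finset.mem_filter] at ht ⊢
    exact ⟨Finset.mem_univ _, by rw [h.1, ht.2]⟩
  · intro t ht t' ht' htt
    rw [Finset.mem_filter] at ht ht'
    exact (h.2 (α t') y (by rw [h.1, ht'.2])).unique ⟨htt, ht.2⟩ ⟨rfl, ht'.2⟩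
  · intro x hx
    rw [Finset.mem_filter] at hx
    obtain ⟨t, ⟨h1, h2⟩, -⟩ := h.2 x y hx.2
    exact ⟨t, by simp [h2], h1⟩
  · intro t ht
    rw [Finset.mem_filter] at ht
    by_cases hgt : g • t = t
    · rw [ev_gRes _ _ hgt]
    · rw [ev_of_not_fixed _ hgt, ev_of_not_fixed _ fun hgx => hgt ?_]
      refine (h.2 (α t) y (by rw [h.1, ht.2])).unique ⟨?_, ?_⟩ ⟨rfl, ht.2⟩
      · rw [map_smul, hgx]
      · rw [map_smul, ht.2, hy]

theorem gRes_gNorm {P : FinGSet G} (α : P →[G] X) (β : P →[G] Y) (γ : X →[G] Z) (δ : Y →[G] Z)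
    (h : FinGSet.IsPullback α β γ δ) (a : Ghost X) :
    gRes δ (gNorm γ a) = gNorm β (gRes α a) := by
  refine ghost_ext fun g y hy => ?_
  have hδ : g • δ y = δ y := by rw [← map_smul, hy]
  rw [ev_gRes _ _ hy, ev_gNorm _ _ hδ, ev_gNorm _ _ hy]
  rw [← prod_fibre_congr γ β α hδ hy (fun w hw => by rw [h.1, hw]) ?_ (cycleValue a.1 g)
    fun x x' => cycleValue_congr a]
  · refine Finset.prod_congr rfl fun o ho => ?_
    rw [mem_classesIn] at ho
    have hper : MulAction.period g o.out = MulAction.period g (α o.out) := by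
      refine period_eq_of_fibre β α hy ?_ ho
      intro w w' hw hw' he
      exact (h.2 (α w') y (by rw [h.1, hw'])).unique ⟨he, hw⟩ ⟨rfl, hw'⟩
    rw [cycleValue_eq _ _ _ hper, ev_gRes, ← cycleValue_eq _ _ _ rfl]
    rw [← hper, MulAction.pow_period_smul]
  · intro x hx
    obtain ⟨t, ⟨h1, h2⟩, h3⟩ := h.2 x y hx
    exact ⟨t, ⟨h2, h1⟩, fun t' ht' => h3 t' ⟨ht'.2, ht'.1⟩⟩

end Ghost

/-! ### The exponential formula for ghosts -/

section Exponential

open FinGSet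

variable {G : Type u} [CommGroup G] {X Y Z : FinGSet G}

theorem sec_eq_of_eq {p : Z →[G] X} {f : X →[G] Y} {s t : Sections p f} (h : s = t) {x : X}
    (hs : f x = s.pt) (ht : f x = t.pt) : s.sec ⟨x, hs⟩ = t.sec ⟨x, ht⟩ := by
  subst h; rfl

/-- A section fixed by `h` is equivariant for `h`. -/
theorem sec_smul_of_fixed {p : Z →[G] X} {f : X →[G] Y} {s : Sections p f} {h : G} (hs : h • s = s)
    {x : X} (hx : f x = s.pt) (hx' : f (h • x) = s.pt) :
    s.sec ⟨h • x, hx'⟩ = h • s.sec ⟨x, hx⟩ := by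
  have hx'' : f (h • x) = (h • s).pt := by rw [hs, hx']
  rw [← sec_eq_of_eq hs hx'' hx']
  exact congrArg (fun a => h • a) (s.sec_congr (inv_smul_smul h x) _ _)

/-- Sections over `y` fixed by `g` are given by one value for each cycle `o` of `g` on the fibre of
`f`, namely a point over the representative of `o` that is fixed by `gᵐ`, with `m` the length
of `o`. -/
theorem exists_fixed_section {p : Z →[G] X} {f : X →[G] Y} {g : G} {y : Y} (hy : g • y = y)
    (c : ∀ o ∈ classesIn (cycleRel g X) (fun x => f x = y), Z)
    (hc : ∀ o ho, p (c o ho) = o.out)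
    (hc' : ∀ o ho, g ^ MulAction.period g o.out • c o ho = c o ho) :
    ∃ s : Sections p f, s.pt = y ∧ g • s = s ∧
      ∀ o ho (h : f o.out = s.pt), s.sec ⟨o.out, h⟩ = c o ho := by
  have hmem : ∀ x, f x = y → Quotient.mk (cycleRel g X) x ∈
      classesIn (cycleRel g X) (fun x => f x = y) := fun x hx => mem_classesIn.2
    (map_eq_of_cycleRel f hy ((cycleRel g X).symm (Quotient.mk_out (s := cycleRel g X) x)) hx)
  have hk : ∀ x : X, ∃ k : ℤ, g ^ k • (Quotient.mk (cycleRel g X) x).out = x :=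
    fun x => Quotient.mk_out (s := cycleRel g X) x
  choose k hk using hk
  -- `g ^ k • c o` depends only on `g ^ k • o.out`
  have key : ∀ o ho o' ho' (i j : ℤ), o = o' → g ^ i • o.out = g ^ j • o'.out →
      g ^ i • c o ho = g ^ j • c o' ho' := by
    rintro o ho _ ho' i j rfl hij
    have h1 : g ^ (-j + i) • o.out = o.out := by
      rw [zpow_add, mul_smul, hij, pow_zpow_smul_cancel]
    obtain ⟨l, hl⟩ := MulAction.zpow_smul_eq_iff_period_dvd.1 h1
    have h2 : g ^ (-j + i) • c o ho = c o ho := by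
      rw [hl, zpow_mul, zpow_natCast]
      exact zpow_smul_of_fixed (hc' o ho) l
    rw [show i = j + (-j + i) by ring, zpow_add, mul_smul, h2]
  refine ⟨⟨y, fun x => g ^ k x.1 • c _ (hmem x.1 x.2), fun x => ?_⟩, rfl, ?_, ?_⟩
  · rw [map_smul, hc, hk]
  · refine Sections.ext_of hy fun x hs ht => ?_
    change g • g ^ k (g⁻¹ • x) • c _ _ = g ^ k x • c _ _
    rw [smul_smul, ← zpow_one_add]
    refine key _ _ _ _ _ _ (Quotient.sound ⟨1, ?_⟩) ?_
    · simp
    · rw [zpow_one_add, mul_smul, hk, hk, smul_inv_smul]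
  · intro o ho h
    change g ^ k o.out • c _ _ = c o ho
    rw [← one_smul G (c o ho), ← zpow_zero g]
    refine key _ _ _ _ _ _ (Quotient.out_eq o) ?_
    rw [hk, zpow_zero, one_smul]

/-- The norm along the projection `X ×_Y Π_f Z → Π_f Z` of a restriction along the evaluation map,
at a section `s` fixed by `g`, as a product over the cycles of `g` on the fibre of `f`. -/
theorem ev_gNorm_gRes_eval (p : Z →[G] X) (f : X →[G] Y) (a : Ghost Z) {g : G}
    {s : depProd p f} (hs : g • s = s) {y : Y} (hy : depProd.proj p f s = y)
    (F : X → Polynomial ℂ)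
    (hF : ∀ x (hx : f x = y), F x = Polynomial.expand ℂ (MulAction.period g x)
      (ev a.1 (g ^ MulAction.period g x) (Sections.sec s ⟨x, hx.trans hy.symm⟩))) :
    ev (gNorm (fibreProd.snd f (depProd.proj p f)) (gRes (depProd.eval p f) a)).1 g s =
      ∏ o ∈ classesIn (cycleRel g X) (fun x => f x = y), F o.out := by
  have hgy : g • y = y := by rw [← hy, ← map_smul, hs]
  rw [ev_gNorm _ _ hs]
  set F' : X → Polynomial ℂ := fun x => if f x = y then F x else 0 with hF'
  have hFinv : ∀ x x', cycleRel g X x x' → F' x = F' x' := by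
    intro x x' h
    by_cases hx : f x = y
    · have hx' := map_eq_of_cycleRel f hgy h hx
      obtain ⟨k, rfl⟩ := h
      simp only [hF', hx, hx', if_true]
      rw [hF _ hx, hF _ hx', period_smul]
      rw [sec_smul_of_fixed (zpow_smul_of_fixed hs k) (hx.trans hy.symm), ev_smul]
    · have hx' : f x' ≠ y := fun h' => hx (map_eq_of_cycleRel f hgy ((cycleRel g X).symm h) h')
      simp only [hF', hx, hx', if_false]
  have e1 : ∏ o ∈ classesIn (cycleRel g X) (fun x => f x = y), F o.out =
      ∏ o ∈ classesIn (cycleRel g X) (fun x => f x = y), F' o.out := by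
    refine Finset.prod_congr rfl fun o ho => ?_
    rw [mem_classesIn] at ho
    simp only [hF', ho, if_true]
  rw [e1, ← prod_fibre_congr f (fibreProd.snd f (depProd.proj p f))
    (fibreProd.fst f (depProd.proj p f)) hgy hs (fun w hw => ?_) ?_ F' hFinv]
  · refine Finset.prod_congr rfl fun o ho => ?_
    rw [mem_classesIn] at ho
    have hper : MulAction.period g o.out =
        MulAction.period g (fibreProd.fst f (depProd.proj p f) o.out) := by
      refine period_eq_of_fibre _ _ hs ?_ ho
      intro w w' hw hw' he
      exact Subtype.ext (Prod.ext he (hw.trans hw'.symm))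
    have hfo : f (fibreProd.fst f (depProd.proj p f) o.out) = y := by
      rw [← hy, ← ho]; exact o.out.2
    simp only [hF', hfo, if_true]
    rw [hF _ hfo, cycleValue_eq _ _ _ hper, ev_gRes]
    · congr 2
      exact sec_eq_of_eq ho _ _
    · rw [← hper, MulAction.pow_period_smul]
  · intro x hx
    refine ⟨⟨(x, s), hx.trans hy.symm⟩, ⟨rfl, rfl⟩, ?_⟩
    rintro w ⟨hw, hw'⟩
    exact Subtype.ext (Prod.ext hw' hw)
  · rw [← hy, ← hw]; exact w.2

/-- The exponential formula for the standard exponential diagram. On the left, each cycle of `g` on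
the fibre of `f` contributes a sum over points of `Z`; expanding the product of these sums gives one
term for each choice of points, and the choices are the sections fixed by `g`. -/
theorem gNorm_gInd_eval (p : Z →[G] X) (f : X →[G] Y) (a : Ghost Z) :
    gNorm f (gInd p a) = gInd (depProd.proj p f)
      (gNorm (fibreProd.snd f (depProd.proj p f)) (gRes (depProd.eval p f) a)) := by
  refine ghost_ext fun g y hy => ?_
  rw [ev_gNorm _ _ hy, ev_gInd _ _ hy]
  set C := classesIn (cycleRel g X) (fun x => f x = y)
  set E : X → Z → Polynomial ℂ := fun x z =>
    Polynomial.expand ℂ (MulAction.period g x) (ev a.1 (g ^ MulAction.period g x) z) with hE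
  set S : Quotient (cycleRel g X) → Finset Z := fun o =>
    Finset.univ.filter fun z => p z = o.out ∧ g ^ MulAction.period g o.out • z = z with hS
  have e1 : ∀ o ∈ C, cycleValue (gInd p a).1 g o.out = ∑ z ∈ S o, E o.out z := by
    intro o ho
    rw [cycleValue, ev_gInd _ _ (MulAction.pow_period_smul g _), map_sum, hS]
    refine (Finset.sum_subset ?_ ?_).symm
    · intro z hz
      rw [Finset.mem_filter] at hz ⊢
      exact ⟨hz.1, hz.2.1⟩
    · intro z hz hz'
      rw [Finset.mem_filter] at hz hz'
      rw [ev_of_not_fixed, map_zero]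
      exact fun h => hz' ⟨hz.1, hz.2, h⟩
  rw [Finset.prod_congr rfl e1, Finset.prod_sum]
  have e2 : ∑ s : depProd p f with depProd.proj p f s = y ∧ g • s = s,
      ev (gNorm (fibreProd.snd f (depProd.proj p f)) (gRes (depProd.eval p f) a)).1 g s =
      ∑ s : depProd p f with depProd.proj p f s = y,
      ev (gNorm (fibreProd.snd f (depProd.proj p f)) (gRes (depProd.eval p f) a)).1 g s := by
    refine Finset.sum_subset ?_ ?_
    · intro z hz
      rw [Finset.mem_filter] at hz ⊢
      exact ⟨hz.1, hz.2.1⟩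
    · intro z hz hz'
      rw [Finset.mem_filter] at hz hz'
      rw [ev_of_not_fixed]
      exact fun h => hz' ⟨hz.1, hz.2, h⟩
  rw [← e2]
  symm
  refine Finset.sum_bij (fun s hs o ho => Sections.sec s ⟨o.out,
    (mem_classesIn.1 ho).trans (Finset.mem_filter.1 hs).2.1.symm⟩) ?_ ?_ ?_ ?_
  · intro s hs
    rw [Finset.mem_filter] at hs
    rw [Finset.mem_pi]
    intro o ho
    rw [hS, Finset.mem_filter]
    refine ⟨Finset.mem_univ _, Sections.sec_spec s _, ?_⟩
    rw [← sec_smul_of_fixed (pow_smul_of_fixed hs.2.2 _)]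
    · exact Sections.sec_congr s (MulAction.pow_period_smul g _) _ _
    · rw [MulAction.pow_period_smul]
      exact (mem_classesIn.1 ho).trans hs.2.1.symm
  · intro s hs t ht hst
    rw [Finset.mem_filter] at hs ht
    refine Sections.ext_of (hs.2.1.trans ht.2.1.symm) fun x hxs hxt => ?_
    have hxy : f x = y := hxs.trans hs.2.1
    obtain ⟨k, hk⟩ := (cycleRel g X).symm (Quotient.mk_out (s := cycleRel g X) x)
    have hx' : f (g ^ k • x) = y := by rw [map_smul, hxy, zpow_smul_of_fixed hy]
    have hmem : Quotient.mk (cycleRel g X) x ∈ C := mem_classesIn.2 (by rw [← hk, hx'])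
    have h1 := congrFun (congrFun hst _) hmem
    refine smul_left_cancel (g ^ k) ?_
    rw [← sec_smul_of_fixed (zpow_smul_of_fixed hs.2.2 k) hxs (hx'.trans hs.2.1.symm),
      ← sec_smul_of_fixed (zpow_smul_of_fixed ht.2.2 k) hxt (hx'.trans ht.2.1.symm)]
    rw [Sections.sec_congr s hk _ (by rw [← hk]; exact hx'.trans hs.2.1.symm),
      Sections.sec_congr t hk _ (by rw [← hk]; exact hx'.trans ht.2.1.symm)]
    exact h1
  · intro c hc
    rw [Finset.mem_pi] at hc
    obtain ⟨s, h1, h2, h3⟩ := exists_fixed_section hy c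
      (fun o ho => (Finset.mem_filter.1 (hc o ho)).2.1)
      (fun o ho => (Finset.mem_filter.1 (hc o ho)).2.2)
    refine ⟨s, Finset.mem_filter.2 ⟨Finset.mem_univ _, h1, h2⟩, ?_⟩
    funext o ho
    exact h3 o ho _
  · intro s hs
    rw [Finset.mem_filter] at hs
    rw [ev_gNorm_gRes_eval p f a hs.2.2 hs.2.1
      (fun x => if hx : f x = y then E x (Sections.sec s ⟨x, hx.trans hs.2.1.symm⟩) else 0)
      (fun x hx => by rw [dif_pos hx])]
    rw [← Finset.prod_attach]
    refine Finset.prod_congr rfl fun o _ => ?_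
    rw [dif_pos (mem_classesIn.1 o.2)]

theorem gInd_gRes_of_bijective (j : X →[G] Y) (hj : Function.Bijective j) (a : Ghost Y) :
    gInd j (gRes j a) = a := by
  refine ghost_ext fun g y hy => ?_
  obtain ⟨x, rfl⟩ := hj.2 y
  rw [ev_gInd _ _ hy]
  have : (Finset.univ.filter fun x' : X => j x' = j x) = {x} := by
    ext x'; simp [hj.1.eq_iff]
  have hx : g • x = x := hj.1 (by rw [map_smul, hy])
  rw [this, Finset.sum_singleton, ev_gRes _ _ hx]

theorem gNorm_gInd {X' Y' : FinGSet G} (p : Z →[G] X) (f : X →[G] Y) (e : X' →[G] Z)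
    (f' : X' →[G] Y') (q : Y' →[G] Y) (h : IsExponential p f e f' q) (a : Ghost Z) :
    gNorm f (gInd p a) = gInd q (gNorm f' (gRes e a)) := by
  obtain ⟨i, j, hi, hj, h1, h2, h3⟩ := h
  have he : e = (depProd.eval p f).comp i := MulActionHom.ext h1
  have hq : q = (depProd.proj p f).comp j := MulActionHom.ext h3
  have hpb : IsPullback i f' (fibreProd.snd f (depProd.proj p f)) j := by
    refine ⟨fun t => (h2 t).symm, fun x y hxy => ?_⟩
    obtain ⟨t, rfl⟩ := hi.2 x
    refine ⟨t, ⟨rfl, hj.1 (by rw [h2, hxy])⟩, fun t' ht' => hi.1 ht'.1⟩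
  rw [gNorm_gInd_eval, he, hq, gRes_comp, ← gRes_gNorm _ _ _ _ hpb, gInd_comp,
    gInd_gRes_of_bijective j hj]

end Exponential

/-! ### Disjoint unions -/

section Sums

open FinGSet

variable {G : Type u} [CommGroup G] (X Y : FinGSet G)

theorem inl_injective : Function.Injective (inl X Y) := Sum.inl_injective

theorem inr_injective : Function.Injective (inr X Y) := Sum.inr_injective

variable {X Y} {W : FinGSet G}

theorem gRes_gInd_of_injective {i : X →[G] W} (hi : Function.Injective i) (a : Ghost X) :
    gRes i (gInd i a) = a := by
  refine ghost_ext fun g x hx => ?_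
  rw [ev_gRes _ _ hx, ev_gInd _ _ (by rw [← map_smul, hx])]
  have : (Finset.univ.filter fun x' : X => i x' = i x) = {x} := by
    ext x'; simp [hi.eq_iff]
  rw [this, Finset.sum_singleton]

theorem gRes_gInd_of_disjoint {i : X →[G] W} {j : Y →[G] W} (h : ∀ x y, i x ≠ j y) (a : Ghost X) :
    gRes j (gInd i a) = 0 := by
  refine ghost_ext fun g y hy => ?_
  rw [ev_gRes _ _ hy, ev_gInd _ _ (by rw [← map_smul, hy])]
  have : (Finset.univ.filter fun x' : X => i x' = j y) = ∅ := by
    ext x'; simp [h]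
  rw [this, Finset.sum_empty]
  exact (ev_zero g y).symm

theorem gRes_gNorm_of_injective {i : X →[G] W} (hi : Function.Injective i) (a : Ghost X) :
    gRes i (gNorm i a) = a := by
  have := gRes_gNorm (MulActionHom.id G) (MulActionHom.id G) i i
    ⟨fun _ => rfl, fun x y hxy => ⟨x, ⟨rfl, hi hxy⟩, fun t ht => ht.1⟩⟩ a
  rw [this, gNorm_id]; rfl

theorem ev_gNorm_of_empty (i : X →[G] W) (a : Ghost X) {g : G} {w : W} (hw : g • w = w)
    (h : ∀ x, i x ≠ w) : ev (gNorm i a).1 g w = 1 := by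
  rw [ev_gNorm _ _ hw]
  refine Finset.prod_eq_one fun o ho => ?_
  exact absurd (mem_classesIn.1 ho) (h _)

theorem gRes_gNorm_of_disjoint {i : X →[G] W} {j : Y →[G] W} (h : ∀ x y, i x ≠ j y) (a : Ghost X) :
    gRes j (gNorm i a) = 1 := by
  refine ghost_ext fun g y hy => ?_
  rw [ev_gRes _ _ hy, ev_gNorm_of_empty _ _ (by rw [← map_smul, hy]) fun x => h x y]
  exact (ev_one hy).symm

/-- Ghosts on a disjoint union are determined by their restrictions to the summands. -/
theorem ghost_sum_ext {a b : Ghost (X.sum Y)} (hl : gRes (inl X Y) a = gRes (inl X Y) b)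
    (hr : gRes (inr X Y) a = gRes (inr X Y) b) : a = b := by
  refine ghost_ext fun g w hw => ?_
  rcases w with x | y
  · have hx : g • x = x := Sum.inl_injective hw
    have := congrArg (fun c => ev c.1 g x) hl
    simp only [ev_gRes _ _ hx] at this
    exact this
  · have hy : g • y = y := Sum.inr_injective hw
    have := congrArg (fun c => ev c.1 g y) hr
    simp only [ev_gRes _ _ hy] at this
    exact this

theorem inl_ne_inr (x : X) (y : Y) : inl X Y x ≠ inr X Y y := Sum.inl_ne_inr

theorem gInd_sum_eq (a : Ghost (X.sum Y)) :
    gInd (inl X Y) (gRes (inl X Y) a) + gInd (inr X Y) (gRes (inr X Y) a) = a := by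
  refine ghost_sum_ext ?_ ?_
  · rw [map_add, gRes_gInd_of_injective (inl_injective X Y),
      gRes_gInd_of_disjoint fun y x => (inl_ne_inr x y).symm, add_zero]
  · rw [map_add, gRes_gInd_of_injective (inr_injective X Y), gRes_gInd_of_disjoint inl_ne_inr,
      zero_add]

theorem gNorm_sum_eq (a : Ghost (X.sum Y)) :
    gNorm (inl X Y) (gRes (inl X Y) a) * gNorm (inr X Y) (gRes (inr X Y) a) = a := by
  refine ghost_sum_ext ?_ ?_
  · rw [map_mul, gRes_gNorm_of_injective (inl_injective X Y),
      gRes_gNorm_of_disjoint fun y x => (inl_ne_inr x y).symm, mul_one]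
  · rw [map_mul, gRes_gNorm_of_injective (inr_injective X Y), gRes_gNorm_of_disjoint inl_ne_inr,
      one_mul]

end Sums

/-! ### Tambara functors as subquotients of ghosts -/

section Subquotient

open FinGSet

variable {G : Type u} [CommGroup G]

/-- A family of rings that are subquotients of the ghost rings, stable under restriction,
induction and norm: subrings `sub X` of the ghost rings with surjections `proj X` to the rings
`S X`, such that restriction, induction and norm descend. -/
structure GhostSubquotient (S : FinGSet G → Type*) [∀ X, CommRing (S X)] where
  sub : ∀ X : FinGSet G, Subring (Ghost X)
  proj : ∀ X : FinGSet G, sub X →+* S X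
  proj_surjective : ∀ X, Function.Surjective (proj X)
  res_mem : ∀ {X Y : FinGSet G} (f : X →[G] Y), ∀ a ∈ sub Y, gRes f a ∈ sub X
  ind_mem : ∀ {X Y : FinGSet G} (f : X →[G] Y), ∀ a ∈ sub X, gInd f a ∈ sub Y
  norm_mem : ∀ {X Y : FinGSet G} (f : X →[G] Y), ∀ a ∈ sub X, gNorm f a ∈ sub Y
  res_congr : ∀ {X Y : FinGSet G} (f : X →[G] Y) (a b : sub Y), proj Y a = proj Y b →
    proj X ⟨gRes f a.1, res_mem f a.1 a.2⟩ = proj X ⟨gRes f b.1, res_mem f b.1 b.2⟩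
  ind_congr : ∀ {X Y : FinGSet G} (f : X →[G] Y) (a b : sub X), proj X a = proj X b →
    proj Y ⟨gInd f a.1, ind_mem f a.1 a.2⟩ = proj Y ⟨gInd f b.1, ind_mem f b.1 b.2⟩
  norm_congr : ∀ {X Y : FinGSet G} (f : X →[G] Y) (a b : sub X), proj X a = proj X b →
    proj Y ⟨gNorm f a.1, norm_mem f a.1 a.2⟩ = proj Y ⟨gNorm f b.1, norm_mem f b.1 b.2⟩

namespace GhostSubquotient

variable {S : FinGSet G → Type*} [∀ X, CommRing (S X)] (Q : GhostSubquotient S)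

variable {X Y : FinGSet G}

/-- A ghost representing an element of the subquotient. -/
def lift (a : S X) : Q.sub X := (Q.proj_surjective X a).choose

@[simp]
theorem proj_lift (a : S X) : Q.proj X (Q.lift a) = a := (Q.proj_surjective X a).choose_spec

/-- Restriction, on the subquotient. -/
def res (f : X →[G] Y) : S Y →+* S X where
  toFun a := Q.proj X ⟨gRes f (Q.lift a).1, Q.res_mem f _ (Q.lift a).2⟩
  map_one' := (Q.res_congr f (Q.lift 1) 1 (by simp)).trans (map_one (Q.proj X))
  map_mul' a b := (Q.res_congr f (Q.lift (a * b)) (Q.lift a * Q.lift b) (by simp)).trans (by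
    rw [← map_mul]; congr 1)
  map_zero' := (Q.res_congr f (Q.lift 0) 0 (by simp)).trans (map_zero (Q.proj X))
  map_add' a b := (Q.res_congr f (Q.lift (a + b)) (Q.lift a + Q.lift b) (by simp)).trans (by
    rw [← map_add]; congr 1)

/-- Induction, on the subquotient. -/
def ind (f : X →[G] Y) : S X →+ S Y where
  toFun a := Q.proj Y ⟨gInd f (Q.lift a).1, Q.ind_mem f _ (Q.lift a).2⟩
  map_zero' := (Q.ind_congr f (Q.lift 0) 0 (by simp)).trans (by
    rw [← map_zero (Q.proj Y)]; congr 1; exact Subtype.ext (map_zero (gInd f)))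
  map_add' a b := (Q.ind_congr f (Q.lift (a + b)) (Q.lift a + Q.lift b) (by simp)).trans (by
    rw [← map_add]; congr 1; exact Subtype.ext (map_add (gInd f) _ _))

/-- The norm, on the subquotient. -/
def norm (f : X →[G] Y) : S X →* S Y where
  toFun a := Q.proj Y ⟨gNorm f (Q.lift a).1, Q.norm_mem f _ (Q.lift a).2⟩
  map_one' := (Q.norm_congr f (Q.lift 1) 1 (by simp)).trans (by
    rw [← map_one (Q.proj Y)]; congr 1; exact Subtype.ext (map_one (gNorm f)))
  map_mul' a b := (Q.norm_congr f (Q.lift (a * b)) (Q.lift a * Q.lift b) (by simp)).trans (by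
    rw [← map_mul]; congr 1; exact Subtype.ext (map_mul (gNorm f) _ _))

theorem res_proj (f : X →[G] Y) (a : Q.sub Y) :
    Q.res f (Q.proj Y a) = Q.proj X ⟨gRes f a.1, Q.res_mem f _ a.2⟩ :=
  Q.res_congr f _ a (Q.proj_lift _)

theorem ind_proj (f : X →[G] Y) (a : Q.sub X) :
    Q.ind f (Q.proj X a) = Q.proj Y ⟨gInd f a.1, Q.ind_mem f _ a.2⟩ :=
  Q.ind_congr f _ a (Q.proj_lift _)

theorem norm_proj (f : X →[G] Y) (a : Q.sub X) :
    Q.norm f (Q.proj X a) = Q.proj Y ⟨gNorm f a.1, Q.norm_mem f _ a.2⟩ :=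
  Q.norm_congr f _ a (Q.proj_lift _)

/-- A subquotient of the ghost rings stable under the operations is a Tambara functor. -/
def tambara [Finite G] : TambaraFunctor G S where
  res f := Q.res f
  ind f := Q.ind f
  norm f := Q.norm f
  res_id X a := by
    obtain ⟨a, rfl⟩ := Q.proj_surjective X a
    rw [res_proj]; rfl
  ind_id X a := by
    obtain ⟨a, rfl⟩ := Q.proj_surjective X a
    rw [ind_proj]; congr 1; exact Subtype.ext (gInd_id a.1)
  norm_id X a := by
    obtain ⟨a, rfl⟩ := Q.proj_surjective X a
    rw [norm_proj]; congr 1; exact Subtype.ext (gNorm_id a.1)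
  res_comp f h a := by
    obtain ⟨a, rfl⟩ := Q.proj_surjective _ a
    simp only [res_proj]; rfl
  ind_comp f h a := by
    obtain ⟨a, rfl⟩ := Q.proj_surjective _ a
    simp only [ind_proj]; congr 1; exact Subtype.ext (gInd_comp f h a.1)
  norm_comp f h a := by
    obtain ⟨a, rfl⟩ := Q.proj_surjective _ a
    simp only [norm_proj]; congr 1; exact Subtype.ext (gNorm_comp f h a.1)
  res_ind α β γ δ hpb a := by
    obtain ⟨a, rfl⟩ := Q.proj_surjective _ a
    simp only [res_proj, ind_proj]; congr 1; exact Subtype.ext (gRes_gInd α β γ δ hpb a.1)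
  res_norm α β γ δ hpb a := by
    obtain ⟨a, rfl⟩ := Q.proj_surjective _ a
    simp only [res_proj, norm_proj]; congr 1; exact Subtype.ext (gRes_gNorm α β γ δ hpb a.1)
  ind_sum X Y := by
    have hl : ∀ (a : S X) (b : S Y),
        Q.res (inl X Y) (Q.ind (inl X Y) a + Q.ind (inr X Y) b) = a := by
      intro a b
      obtain ⟨a, rfl⟩ := Q.proj_surjective _ a
      obtain ⟨b, rfl⟩ := Q.proj_surjective _ b
      rw [ind_proj, ind_proj, ← map_add, res_proj]
      congr 1
      refine Subtype.ext ?_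
      change gRes (inl X Y) (gInd _ a.1 + gInd _ b.1) = a.1
      rw [map_add, gRes_gInd_of_injective (inl_injective X Y),
        gRes_gInd_of_disjoint fun y x => (inl_ne_inr x y).symm, add_zero]
    have hr : ∀ (a : S X) (b : S Y),
        Q.res (inr X Y) (Q.ind (inl X Y) a + Q.ind (inr X Y) b) = b := by
      intro a b
      obtain ⟨a, rfl⟩ := Q.proj_surjective _ a
      obtain ⟨b, rfl⟩ := Q.proj_surjective _ b
      rw [ind_proj, ind_proj, ← map_add, res_proj]
      congr 1
      refine Subtype.ext ?_
      change gRes (inr X Y) (gInd _ a.1 + gInd _ b.1) = b.1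
      rw [map_add, gRes_gInd_of_injective (inr_injective X Y), gRes_gInd_of_disjoint inl_ne_inr,
        zero_add]
    refine ⟨fun a b hab => ?_, fun c => ⟨(Q.res (inl X Y) c, Q.res (inr X Y) c), ?_⟩⟩
    · have h1 := congrArg (Q.res (inl X Y)) hab
      have h2 := congrArg (Q.res (inr X Y)) hab
      simp only [hl] at h1
      simp only [hr] at h2
      exact Prod.ext h1 h2
    · obtain ⟨c, rfl⟩ := Q.proj_surjective _ c
      simp only [res_proj, ind_proj]
      rw [← map_add]
      congr 1
      exact Subtype.ext (gInd_sum_eq c.1)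
  norm_sum X Y := by
    have hl : ∀ (a : S X) (b : S Y),
        Q.res (inl X Y) (Q.norm (inl X Y) a * Q.norm (inr X Y) b) = a := by
      intro a b
      obtain ⟨a, rfl⟩ := Q.proj_surjective _ a
      obtain ⟨b, rfl⟩ := Q.proj_surjective _ b
      rw [norm_proj, norm_proj, ← map_mul, res_proj]
      congr 1
      refine Subtype.ext ?_
      change gRes (inl X Y) (gNorm _ a.1 * gNorm _ b.1) = a.1
      rw [map_mul, gRes_gNorm_of_injective (inl_injective X Y),
        gRes_gNorm_of_disjoint fun y x => (inl_ne_inr x y).symm, mul_one]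
    have hr : ∀ (a : S X) (b : S Y),
        Q.res (inr X Y) (Q.norm (inl X Y) a * Q.norm (inr X Y) b) = b := by
      intro a b
      obtain ⟨a, rfl⟩ := Q.proj_surjective _ a
      obtain ⟨b, rfl⟩ := Q.proj_surjective _ b
      rw [norm_proj, norm_proj, ← map_mul, res_proj]
      congr 1
      refine Subtype.ext ?_
      change gRes (inr X Y) (gNorm _ a.1 * gNorm _ b.1) = b.1
      rw [map_mul, gRes_gNorm_of_injective (inr_injective X Y), gRes_gNorm_of_disjoint inl_ne_inr,
        one_mul]
    refine ⟨fun a b hab => ?_, fun c => ⟨(Q.res (inl X Y) c, Q.res (inr X Y) c), ?_⟩⟩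
    · have h1 := congrArg (Q.res (inl X Y)) hab
      have h2 := congrArg (Q.res (inr X Y)) hab
      simp only [hl] at h1
      simp only [hr] at h2
      exact Prod.ext h1 h2
    · obtain ⟨c, rfl⟩ := Q.proj_surjective _ c
      simp only [res_proj, norm_proj]
      rw [← map_mul]
      congr 1
      exact Subtype.ext (gNorm_sum_eq c.1)
  norm_ind p f e f' q h a := by
    obtain ⟨a, rfl⟩ := Q.proj_surjective _ a
    simp only [res_proj, norm_proj, ind_proj]
    congr 1; exact Subtype.ext (gNorm_gInd p f e f' q h a.1)

end GhostSubquotient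

end Subquotient

/-! ### Characters of finite abelian groups -/

section Dual

variable {H : Type*} [CommGroup H] [Finite H]

theorem exists_char_ne_one {h : H} (hh : h ≠ 1) : ∃ φ : H →* ℂˣ, φ h ≠ 1 :=
  CommGroup.exists_apply_ne_one_of_hasEnoughRootsOfUnity H ℂ hh

theorem exists_char_extension (K : Subgroup H) (χ : K →* ℂˣ) :
    ∃ ψ : H →* ℂˣ, ∀ k : K, ψ k = χ k := by
  obtain ⟨ψ, rfl⟩ := MonoidHom.domRestrict_surjective ℂ K χ
  exact ⟨ψ, fun _ => rfl⟩

instance fintypeDual : Fintype (H →* ℂˣ) := Fintype.ofFinite _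

theorem sum_char_apply (h : H) :
    ∑ χ : H →* ℂˣ, ((χ h : ℂˣ) : ℂ) = if h = 1 then (Nat.card H : ℂ) else 0 := by
  split_ifs with hh
  · subst hh
    simp only [map_one, Units.val_one, Finset.sum_const, nsmul_eq_mul, mul_one,
      Finset.card_univ]
    rw [← Nat.card_eq_fintype_card, CommGroup.card_monoidHom_of_hasEnoughRootsOfUnity H ℂ]
  · obtain ⟨φ, hφ⟩ := exists_char_ne_one hh
    have h1 : ∑ χ : H →* ℂˣ, ((χ h : ℂˣ) : ℂ) = (φ h : ℂ) * ∑ χ : H →* ℂˣ, ((χ h : ℂˣ) : ℂ) := by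
      rw [Finset.mul_sum]
      rw [← Equiv.sum_comp (Equiv.mulLeft φ)]
      refine Finset.sum_congr rfl fun χ _ => ?_
      simp
    have h2 : ((φ h : ℂ) - 1) * ∑ χ : H →* ℂˣ, ((χ h : ℂˣ) : ℂ) = 0 := by
      rw [sub_mul, one_mul, ← h1, sub_self]
    rcases mul_eq_zero.1 h2 with h3 | h3
    · exact absurd (Units.ext (sub_eq_zero.1 h3)) hφ
    · exact h3

end Dual

/-! ### Simultaneous diagonalization -/

section Eigenbasis

variable {H : Type*} [CommGroup H] [Finite H] {V : Type*} [AddCommGroup V] [Module ℂ V]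
  (ρ : Representation ℂ H V)

theorem span_eigenvectors :
    (⊤ : Submodule ℂ V) ≤ Submodule.span ℂ
      {v | ∃ χ : H →* ℂˣ, ∀ h, ρ h v = (χ h : ℂ) • v} := by
  intro v _
  have := Fintype.ofFinite H
  -- the projections of `v` to the isotypic components
  set w : (H →* ℂˣ) → V := fun χ => ∑ h : H, ((χ h⁻¹ : ℂˣ) : ℂ) • ρ h v with hw
  have h1 : ∀ χ k, ρ k (w χ) = (χ k : ℂ) • w χ := by
    intro χ k
    simp only [hw, map_sum, map_smul, Finset.smul_sum]
    rw [← Equiv.sum_comp (Equiv.mulLeft k)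
      (fun h => (χ k : ℂ) • ((χ h⁻¹ : ℂˣ) : ℂ) • ρ h v)]
    refine Finset.sum_congr rfl fun h _ => ?_
    rw [Equiv.coe_mulLeft, map_mul ρ, smul_smul, mul_inv_rev, map_mul χ, map_inv χ k, mul_comm]
    simp
  have h2 : (Nat.card H : ℂ) • v = ∑ χ : H →* ℂˣ, w χ := by
    simp only [hw]
    rw [Finset.sum_comm]
    simp_rw [← Finset.sum_smul, sum_char_apply]
    rw [Finset.sum_eq_single 1]
    · simp
    · intro h _ hh; simp [hh]
    · intro h; exact absurd (Finset.mem_univ _) h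
  have h3 : v = (Nat.card H : ℂ)⁻¹ • ∑ χ : H →* ℂˣ, w χ := by
    rw [← h2, smul_smul, inv_mul_cancel₀, one_smul]
    exact Nat.cast_ne_zero.2 Nat.card_pos.ne'
  rw [h3]
  exact Submodule.smul_mem _ _ (Submodule.sum_mem _ fun χ _ =>
    Submodule.subset_span ⟨χ, h1 χ⟩)

/-- A representation of a finite abelian group has a basis of common eigenvectors. -/
theorem exists_eigenbasis [FiniteDimensional ℂ V] :
    ∃ (b : Module.Basis (Fin (Module.finrank ℂ V)) ℂ V)
      (χ : Fin (Module.finrank ℂ V) → (H →* ℂˣ)), ∀ h i, ρ h (b i) = (χ i h : ℂ) • b i := by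
  let b := Module.Basis.ofSpan (span_eigenvectors ρ)
  have : Finite _ := Module.Finite.finite_basis b
  have := Fintype.ofFinite ((linearIndepOn_empty ℂ (id : V → V)).extend
    (Set.empty_subset {v | ∃ χ : H →* ℂˣ, ∀ h, ρ h v = (χ h : ℂ) • v}))
  let e := Fintype.equivFinOfCardEq (Module.finrank_eq_card_basis b).symm
  have hb : ∀ i, ∃ χ : H →* ℂˣ, ∀ h, ρ h (b.reindex e i) = (χ h : ℂ) • b.reindex e i := by
    intro i
    rw [Module.Basis.reindex_apply]
    exact Module.Basis.ofSpan_subset (span_eigenvectors ρ) (Set.mem_range_self _)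
  choose χ hχ using hb
  exact ⟨b.reindex e, χ, fun h i => hχ i h⟩

end Eigenbasis

/-- The trace of a linear map that takes each vector of a basis to a multiple of a vector of the
basis. -/
theorem trace_of_monomial {ι : Type*} [Fintype ι] [DecidableEq ι] {V : Type*} [AddCommGroup V]
    [Module ℂ V] (b : Module.Basis ι ℂ V) (L : V →ₗ[ℂ] V) (π : ι → ι) (c : ι → ℂ)
    (h : ∀ i, L (b i) = c i • b (π i)) :
    LinearMap.trace ℂ V L = ∑ i with π i = i, c i := by
  rw [LinearMap.trace_eq_matrix_trace ℂ b, Matrix.trace, Finset.sum_filter]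
  refine Finset.sum_congr rfl fun i _ => ?_
  rw [Matrix.diag_apply, LinearMap.toMatrix_apply, h, map_smul, Finsupp.smul_apply,
    Module.Basis.repr_self, Finsupp.single_apply]
  split_ifs <;> simp

/-! ### The `γ`-filtration of a finite abelian group -/

section Gamma

variable {H : Type u} [CommGroup H]

/-- The one-dimensional representation with character `χ`. -/
def FinRep.line (χ : H →* ℂˣ) : FinRep H where
  carrier := ℂ
  ρ :=
    { toFun := fun h => (χ h : ℂ) • LinearMap.id
      map_one' := by rw [map_one, Units.val_one, one_smul]; rfl
      map_mul' := fun g h => by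
        ext; simp [mul_comm] }

/-- A one-dimensional character as an element of the character ring. -/
def lineClass (χ : H →* ℂˣ) : charRing H := (FinRep.line χ).char

theorem lineClass_apply (χ : H →* ℂˣ) (h : H) : (lineClass χ).1 h = (χ h : ℂ) := by
  change LinearMap.trace ℂ ℂ ((χ h : ℂ) • LinearMap.id) = _
  rw [map_smul, LinearMap.trace_id]
  simp

/-- Evaluation of virtual characters. -/
def charEval (h : H) : charRing H →+* ℂ :=
  (Pi.evalRingHom (fun _ : H => ℂ) h).comp (charRing H).subtype

theorem charEval_apply (h : H) (x : charRing H) : charEval h x = x.1 h := rfl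

theorem charRing_ext {x y : charRing H} (h : ∀ g, charEval g x = charEval g y) : x = y :=
  Subtype.ext (funext h)

/-- For a representation with an eigenbasis, the character is the sum of the eigencharacters. -/
theorem char_eq_sum {n : ℕ} (V : FinRep H) (b : Module.Basis (Fin n) ℂ V.carrier)
    (χ : Fin n → (H →* ℂˣ)) (hb : ∀ h i, V.ρ h (b i) = (χ i h : ℂ) • b i) :
    V.char = ∑ i, lineClass (χ i) := by
  refine charRing_ext fun h => ?_
  rw [map_sum]
  simp only [charEval_apply, lineClass_apply]
  change LinearMap.trace ℂ _ (V.ρ h) = _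
  rw [trace_of_monomial b (V.ρ h) id (fun i => (χ i h : ℂ)) (hb h)]
  simp

/-- For a representation with an eigenbasis, `λ_t(V) = ∏ᵢ (1 + χᵢ t)`. -/
theorem lambdaSeries_eq_prod {m : ℕ} (V : FinRep H) (b : Module.Basis (Fin m) ℂ V.carrier)
    (χ : Fin m → (H →* ℂˣ)) (hb : ∀ h i, V.ρ h (b i) = (χ i h : ℂ) • b i) :
    V.lambdaSeries = ∏ i, (1 + PowerSeries.C (lineClass (χ i)) * PowerSeries.X) := by
  refine PowerSeries.ext fun n => charRing_ext fun h => ?_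
  have e1 : charEval h (PowerSeries.coeff n V.lambdaSeries) =
      ∑ s : Set.powersetCard (Fin m) n, ∏ i ∈ s.1, (χ i h : ℂ) := by
    rw [FinRep.lambdaSeries, PowerSeries.coeff_mk]
    change LinearMap.trace ℂ _ (exteriorPower.map n (V.ρ h)) = _
    rw [trace_of_monomial (b.exteriorPower n) _ id (fun s => ∏ i ∈ s.1, (χ i h : ℂ))]
    · simp
    · intro s
      rw [exteriorPower.basis_apply, exteriorPower.map_apply_ιMulti_family]
      unfold exteriorPower.ιMulti_family
      have : (⇑(V.ρ h) ∘ ⇑b) ∘ ⇑(Set.powersetCard.ofFinEmbEquiv.symm s) =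
          fun j => (χ (Set.powersetCard.ofFinEmbEquiv.symm s j) h : ℂ) •
            (b ∘ (Set.powersetCard.ofFinEmbEquiv.symm s)) j := by
        funext j
        exact hb h _
      rw [this]
      refine (MultilinearMap.map_smul_univ
        (exteriorPower.ιMulti ℂ n (M := V.carrier)).toMultilinearMap _ _).trans ?_
      rw [← Finset.map_orderEmbOfFin_univ s.1 s.2, Finset.prod_map, id, exteriorPower.basis_apply]
      rfl
  rw [e1, Finset.prod_one_add, map_sum, map_sum]
  have e2 : ∀ t : Finset (Fin m), charEval h (PowerSeries.coeff n
      (∏ i ∈ t, (PowerSeries.C (lineClass (χ i)) * PowerSeries.X))) =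
      if t.card = n then ∏ i ∈ t, (χ i h : ℂ) else 0 := by
    intro t
    rw [Finset.prod_mul_distrib, Finset.prod_const, ← map_prod, PowerSeries.coeff_C_mul,
      PowerSeries.coeff_X_pow]
    by_cases ht : t.card = n
    · rw [if_pos ht, if_pos ht.symm, mul_one, map_prod]
      simp only [charEval_apply, lineClass_apply]
    · rw [if_neg ht, if_neg (Ne.symm ht), mul_zero, map_zero]
  simp_rw [e2]
  rw [← Finset.sum_filter]
  refine Finset.sum_bij (fun s _ => s.1) ?_ ?_ ?_ ?_
  · intro s _; simp
  · intro s _ t _ hst; exact Subtype.ext hst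
  · intro t ht; exact ⟨⟨t, (Finset.mem_filter.1 ht).2⟩, Finset.mem_univ _, rfl⟩
  · intro s _; rfl

variable (H) in
/-- The `n`-th power of the augmentation ideal, as an additive group of functions: the additive
group generated by products of a character and `n` factors of the form `χ - 1`. -/
def augPow (n : ℕ) : AddSubgroup (H → ℂ) :=
  AddSubgroup.closure {f | ∃ (ψ : H →* ℂˣ) (l : List (H →* ℂˣ)), l.length = n ∧
    f = fun h => (ψ h : ℂ) * (l.map fun χ => (χ h : ℂ) - 1).prod}

theorem augPow_gen {n : ℕ} {f : H → ℂ} (ψ : H →* ℂˣ) (l : List (H →* ℂˣ)) (hl : l.length = n)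
    (hf : ∀ h, f h = (ψ h : ℂ) * (l.map fun χ => (χ h : ℂ) - 1).prod) : f ∈ augPow H n :=
  AddSubgroup.subset_closure ⟨ψ, l, hl, funext hf⟩

theorem augPow_induction {n : ℕ} {p : (H → ℂ) → Prop}
    (mem : ∀ (ψ : H →* ℂˣ) (l : List (H →* ℂˣ)), l.length = n →
      p fun h => (ψ h : ℂ) * (l.map fun χ => (χ h : ℂ) - 1).prod)
    (zero : p 0) (add : ∀ x y, p x → p y → p (x + y)) (neg : ∀ x, p x → p (-x))
    {f : H → ℂ} (hf : f ∈ augPow H n) : p f := by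
  refine AddSubgroup.closure_induction (p := fun f _ => p f) ?_ zero
    (fun x y _ _ => add x y) (fun x _ => neg x) hf
  rintro _ ⟨ψ, l, hl, rfl⟩
  exact mem ψ l hl

theorem augPow_mul {m n : ℕ} {a b : H → ℂ} (ha : a ∈ augPow H m) (hb : b ∈ augPow H n) :
    a * b ∈ augPow H (m + n) := by
  refine augPow_induction (p := fun a => a * b ∈ augPow H (m + n)) ?_ ?_ ?_ ?_ ha
  · intro ψ l hl
    refine augPow_induction (p := fun b => _ * b ∈ augPow H (m + n)) ?_ ?_ ?_ ?_ hb
    · intro ψ' l' hl'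
      refine augPow_gen (ψ * ψ') (l ++ l') (by simp [hl, hl']) fun h => ?_
      simp only [Pi.mul_apply, MonoidHom.mul_apply, Units.val_mul, List.map_append,
        List.prod_append]
      ring
    · rw [mul_zero]; exact zero_mem _
    · intro x y h1 h2; rw [mul_add]; exact add_mem h1 h2
    · intro x h; rw [mul_neg]; exact neg_mem h
  · rw [zero_mul]; exact zero_mem _
  · intro x y h1 h2; rw [add_mul]; exact add_mem h1 h2
  · intro x h; rw [neg_mul]; exact neg_mem h

theorem augPow_antitone : Antitone (augPow H) := by
  refine antitone_nat_of_succ_le fun n f hf => ?_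
  refine augPow_induction (p := fun f => f ∈ augPow H n) ?_ (zero_mem _)
    (fun _ _ => add_mem) (fun _ => neg_mem) hf
  intro ψ l hl
  obtain ⟨χ, l, rfl⟩ := List.exists_cons_of_length_eq_add_one hl
  have hl' : l.length = n := by simpa using hl
  -- `ψ (χ - 1) = ψ χ - ψ`
  convert sub_mem (augPow_gen (ψ * χ) l hl' fun h => rfl) (augPow_gen ψ l hl' fun h => rfl)
    using 1
  funext h
  simp only [List.map_cons, List.prod_cons, MonoidHom.mul_apply, Units.val_mul, Pi.sub_apply]
  ring

theorem one_mem_augPow : (1 : H → ℂ) ∈ augPow H 0 :=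
  augPow_gen 1 [] rfl fun h => by simp

theorem char_mem_augPow (ψ : H →* ℂˣ) : (fun h => (ψ h : ℂ)) ∈ augPow H 0 :=
  augPow_gen ψ [] rfl fun h => by simp

theorem char_sub_char_mem_augPow (χ ψ : H →* ℂˣ) : (fun h => (χ h : ℂ) - ψ h) ∈ augPow H 1 := by
  refine augPow_gen ψ [χ * ψ⁻¹] rfl fun h => ?_
  simp only [List.map_cons, List.map_nil, List.prod_singleton, MonoidHom.mul_apply,
    MonoidHom.inv_apply, Units.val_mul]
  rw [mul_sub, mul_one, mul_left_comm, Units.mul_inv, mul_one]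

theorem augPow_comp {K : Type u} [CommGroup K] (φ : K →* H) {n : ℕ} {f : H → ℂ}
    (hf : f ∈ augPow H n) : (fun k => f (φ k)) ∈ augPow K n := by
  refine augPow_induction (p := fun f => (fun k => f (φ k)) ∈ augPow K n) ?_ ?_ ?_ ?_ hf
  · intro ψ l hl
    refine augPow_gen (ψ.comp φ) (l.map fun χ => χ.comp φ) (by simp [hl]) fun k => ?_
    rw [List.map_map]
    rfl
  · exact zero_mem _
  · intro x y hx hy; exact add_mem hx hy
  · intro x hx; exact neg_mem hx

variable (H) in
/-- The `n`-th power of the augmentation ideal, as an additive subgroup of the character ring. -/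
def augPowClass (n : ℕ) : AddSubgroup (charRing H) :=
  (augPow H n).comap (charRing H).subtype.toAddMonoidHom

theorem mem_augPowClass {n : ℕ} {x : charRing H} : x ∈ augPowClass H n ↔ x.1 ∈ augPow H n :=
  Iff.rfl

/-- Power series whose `k`-th coefficient is in the `k`-th power of the augmentation ideal. -/
def AugSeries (q : PowerSeries (charRing H)) : Prop :=
  ∀ k, PowerSeries.coeff k q ∈ augPowClass H k

theorem AugSeries.mul {q r : PowerSeries (charRing H)} (hq : AugSeries q) (hr : AugSeries r) :
    AugSeries (q * r) := by
  intro k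
  rw [PowerSeries.coeff_mul]
  refine sum_mem fun p hp => ?_
  rw [← Finset.HasAntidiagonal.mem_antidiagonal.1 hp]
  exact augPow_mul (hq _) (hr _)

theorem augSeries_one : AugSeries (1 : PowerSeries (charRing H)) := by
  intro k
  rw [PowerSeries.coeff_one]
  split_ifs with h
  · subst h; exact one_mem_augPow
  · exact zero_mem _

theorem lineClass_val (χ : H →* ℂˣ) : (lineClass χ).1 = fun h => (χ h : ℂ) :=
  funext fun h => lineClass_apply χ h

theorem lineClass_one : lineClass (1 : H →* ℂˣ) = 1 :=
  Subtype.ext (by rw [lineClass_val]; rfl)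

theorem lineClass_sub_mem (χ ψ : H →* ℂˣ) : lineClass χ - lineClass ψ ∈ augPowClass H 1 := by
  rw [mem_augPowClass]
  change (lineClass χ).1 - (lineClass ψ).1 ∈ _
  rw [lineClass_val, lineClass_val]
  exact char_sub_char_mem_augPow χ ψ

theorem augSeries_linear (χ : H →* ℂˣ) :
    AugSeries (1 + PowerSeries.C (lineClass χ - 1) * PowerSeries.X) := by
  intro k
  rw [map_add]
  refine add_mem (augSeries_one k) ?_
  rw [PowerSeries.coeff_C_mul, PowerSeries.coeff_X]
  split_ifs with h
  · subst h
    rw [mul_one, ← lineClass_one]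
    exact lineClass_sub_mem χ 1
  · rw [mul_zero]; exact zero_mem _

theorem augSeries_prod {ι : Type*} (s : Finset ι) (q : ι → PowerSeries (charRing H))
    (hq : ∀ i ∈ s, AugSeries (q i)) : AugSeries (∏ i ∈ s, q i) := by
  induction s using Finset.induction_on with
  | empty => rw [Finset.prod_empty]; exact augSeries_one
  | insert i s hi ih =>
    rw [Finset.prod_insert hi]
    exact (hq _ (Finset.mem_insert_self _ _)).mul
      (ih fun j hj => hq _ (Finset.mem_insert_of_mem hj))

/-- Such power series with constant coefficient `1` may be cancelled. -/
theorem AugSeries.of_mul {q r : PowerSeries (charRing H)} (hqr : AugSeries (q * r))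
    (hr : AugSeries r) (hr1 : PowerSeries.coeff 0 r = 1) : AugSeries q := by
  intro k
  induction k using Nat.strong_induction_on with
  | _ k ih =>
    have h := PowerSeries.coeff_mul k q r
    rw [Finset.Nat.sum_antidiagonal_eq_sum_range_succ
      (fun i j => PowerSeries.coeff i q * PowerSeries.coeff j r), Finset.sum_range_succ,
      Nat.sub_self, hr1, mul_one] at h
    rw [← sub_eq_iff_eq_add'.2 h]
    refine sub_mem (hqr k) (sum_mem fun i hi => ?_)
    rw [Finset.mem_range] at hi
    have := augPow_mul (ih i hi) (hr (k - i))
    rwa [show i + (k - i) = k by omega] at this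

end Gamma

/-- Substituting `t = s / (1 - s)` in a power series `p` in `t` and multiplying by `(1 - s) ^ n`
does not change the coefficient of degree `n + 1`. -/
theorem coeff_substitution {R : Type*} [CommRing R] (n : ℕ) (v : PowerSeries R)
    (hv : (1 - PowerSeries.X) * v = 1) (p : PowerSeries R) :
    PowerSeries.coeff (n + 1) ((1 - PowerSeries.X) ^ n * p.subst (PowerSeries.X * v)) =
      PowerSeries.coeff (n + 1) p := by
  have hsub : PowerSeries.HasSubst (PowerSeries.X * v) :=
    PowerSeries.HasSubst.of_constantCoeff_zero' (by simp)
  have hv0 : PowerSeries.coeff 0 v = 1 := by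
    have := congrArg (PowerSeries.coeff 0) hv
    simpa [sub_mul] using this
  have hpow : ∀ k, (1 - PowerSeries.X) ^ k * v ^ k = 1 := fun k => by
    rw [← mul_pow, hv, one_pow]
  -- the contribution of the monomial of degree `k`
  have hmon : ∀ k ∈ Finset.range (n + 2), PowerSeries.coeff (n + 1)
      ((1 - PowerSeries.X) ^ n * (PowerSeries.X * v) ^ k) = if k = n + 1 then 1 else 0 := by
    intro k hk
    rw [Finset.mem_range] at hk
    split_ifs with h
    · subst h
      have : (1 - PowerSeries.X) ^ n * (PowerSeries.X * v) ^ (n + 1) =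
          PowerSeries.X ^ (n + 1) * v := by
        rw [mul_pow, pow_succ v, show (1 - PowerSeries.X) ^ n * (PowerSeries.X ^ (n + 1) *
          (v ^ n * v)) = ((1 - PowerSeries.X) ^ n * v ^ n) * (PowerSeries.X ^ (n + 1) * v) by ring,
          hpow, one_mul]
      rw [this]
      simpa using PowerSeries.coeff_X_pow_mul v (n + 1) 0 |>.trans hv0
    · obtain ⟨m, rfl⟩ : ∃ m, n = m + k := ⟨n - k, by omega⟩
      have : (1 - PowerSeries.X) ^ (m + k) * (PowerSeries.X * v) ^ k =
          PowerSeries.X ^ k * (((1 - Polynomial.X) ^ m : Polynomial R) : PowerSeries R) := by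
        push_cast
        rw [mul_pow, pow_add, show (1 - PowerSeries.X) ^ m * (1 - PowerSeries.X) ^ k *
          (PowerSeries.X ^ k * v ^ k) = ((1 - PowerSeries.X) ^ k * v ^ k) *
            (PowerSeries.X ^ k * (1 - PowerSeries.X) ^ m) by ring, hpow, one_mul]
      rw [this, show m + k + 1 = m + 1 + k by ring, PowerSeries.coeff_X_pow_mul,
        Polynomial.coeff_coe]
      refine Polynomial.coeff_eq_zero_of_natDegree_lt (Nat.lt_succ_of_le ?_)
      refine (Polynomial.natDegree_pow_le.trans (Nat.mul_le_mul_left m (?_ : _ ≤ 1))).trans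
        (by omega)
      exact (Polynomial.natDegree_sub_le _ _).trans (by simp [Polynomial.natDegree_X_le])
  conv_lhs => rw [PowerSeries.eq_X_pow_mul_shift_add_trunc (n + 2) p]
  rw [PowerSeries.subst_add hsub, PowerSeries.subst_mul hsub, PowerSeries.subst_pow hsub,
    PowerSeries.subst_X hsub, PowerSeries.subst_coe hsub, mul_add, map_add]
  have h1 : PowerSeries.coeff (n + 1) ((1 - PowerSeries.X) ^ n * ((PowerSeries.X * v) ^ (n + 2) *
      (PowerSeries.mk fun i => PowerSeries.coeff (i + (n + 2)) p).subst (PowerSeries.X * v))) =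
        0 := by
    refine (PowerSeries.X_pow_dvd_iff (n := n + 2)).1 ?_ _ (by omega)
    rw [mul_pow, mul_assoc, mul_left_comm]
    exact dvd_mul_right _ _
  rw [h1, zero_add]
  rw [Polynomial.aeval_eq_sum_range' (PowerSeries.natDegree_trunc_lt p (n + 1)), Finset.mul_sum,
    map_sum, Finset.sum_eq_single (n + 1)]
  · rw [mul_smul_comm, PowerSeries.coeff_smul, hmon _ (by simp), if_pos rfl,
      PowerSeries.coeff_trunc, if_pos (by omega), smul_eq_mul, mul_one]
  · intro k hk hk'
    rw [mul_smul_comm, PowerSeries.coeff_smul, hmon k hk, if_neg hk', smul_zero]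
  · intro h; exact absurd (by simp) h

/-! ### The `γ`-filtration is the filtration by powers of the augmentation ideal -/

section GammaEq

variable {H : Type u} [CommGroup H]

theorem list_prod_mem_augPowClass {α : Type*} (l : List α) (w : α → ℕ) (z : α → charRing H)
    (h : ∀ a ∈ l, z a ∈ augPowClass H (w a)) :
    (l.map z).prod ∈ augPowClass H (l.map w).sum := by
  induction l with
  | nil => exact one_mem_augPow
  | cons a l ih =>
    rw [List.map_cons, List.map_cons, List.prod_cons, List.sum_cons]
    exact augPow_mul (h a (by simp)) (ih fun b hb => h b (by simp [hb]))

/-- Virtual characters are integral combinations of one-dimensional characters. -/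
theorem charRing_le_augPow [Finite H] (x : charRing H) : x ∈ augPowClass H 0 := by
  refine AddSubgroup.closure_induction (p := fun f _ => f ∈ augPow H 0) ?_ ?_ ?_ ?_ x.2
  · rintro _ ⟨V, rfl⟩
    obtain ⟨b, χ, hb⟩ := exists_eigenbasis V.ρ
    change V.char ∈ augPowClass H 0
    rw [char_eq_sum V b χ hb]
    refine sum_mem fun i _ => ?_
    rw [mem_augPowClass, lineClass_val]
    exact char_mem_augPow _
  · exact zero_mem _
  · intro x y _ _ hx hy; exact add_mem hx hy
  · intro x _ hx; exact neg_mem hx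

theorem subst_one {R : Type*} [CommRing R] {a : PowerSeries R} (ha : PowerSeries.HasSubst a) :
    (1 : PowerSeries R).subst a = 1 := by
  rw [← PowerSeries.coe_substAlgHom ha, map_one]

theorem subst_prod {R : Type*} [CommRing R] {a : PowerSeries R} (ha : PowerSeries.HasSubst a)
    {ι : Type*} (s : Finset ι) (f : ι → PowerSeries R) :
    (∏ i ∈ s, f i).subst a = ∏ i ∈ s, (f i).subst a := by
  rw [← PowerSeries.coe_substAlgHom ha, map_prod]

/-- With `t = s / (1 - s)`, the factor `1 + χ t` becomes `(1 + (χ - 1) s) / (1 - s)`. -/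
theorem subst_linear {R : Type*} [CommRing R] {v : PowerSeries R}
    (hv : (1 - PowerSeries.X) * v = 1) (ha : PowerSeries.HasSubst (PowerSeries.X * v)) (c : R) :
    (1 + PowerSeries.C c * PowerSeries.X).subst (PowerSeries.X * v) =
      (1 + PowerSeries.C (c - 1) * PowerSeries.X) * v := by
  rw [PowerSeries.subst_add ha, PowerSeries.subst_mul ha, subst_one ha, PowerSeries.subst_X ha]
  have : (PowerSeries.C c).subst (PowerSeries.X * v) = PowerSeries.C c := PowerSeries.subst_C c
  rw [this, map_sub, map_one]
  linear_combination -hv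

/-- The operation `γⁿ` takes the augmentation ideal to its `n`-th power. After the substitution
`t = s / (1 - s)` the series `λ_t(x + n - 1)` becomes a quotient of products of factors
`1 + (χ - 1) s`, up to the power of `1 - s` that `coeff_substitution` takes into account. -/
theorem isGamma_mem_augPowClass [Finite H] {n : ℕ} {x z : charRing H} (hx : x ∈ augIdeal H)
    (hz : IsGamma n x z) : z ∈ augPowClass H n := by
  obtain ⟨p, ⟨V, W, hVW, hp⟩, rfl⟩ := hz
  rcases n with _ | n
  -- the argument below needs `n - 1 ≥ 0`; for `n = 0` there is nothing to show
  · exact charRing_le_augPow _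
  obtain ⟨b, χ, hb⟩ := exists_eigenbasis V.ρ
  obtain ⟨b', ψ, hb'⟩ := exists_eigenbasis W.ρ
  -- comparison of degrees: `dim V = dim W + n`
  have hdim : Module.finrank ℂ V.carrier = Module.finrank ℂ W.carrier + n := by
    have h1 := congrArg (charEval 1) hVW
    rw [char_eq_sum V b χ hb, char_eq_sum W b' ψ hb'] at h1
    simp only [map_add, map_sub, map_sum, map_one, map_natCast, charEval_apply, lineClass_apply,
      Units.val_one, Finset.sum_const, Finset.card_univ, Fintype.card_fin, nsmul_eq_mul,
      mul_one] at h1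
    have h2 : x.1 1 = 0 := hx
    rw [h2] at h1
    push_cast at h1
    have h3 : (Module.finrank ℂ V.carrier : ℂ) = (Module.finrank ℂ W.carrier + n : ℕ) := by
      push_cast
      linear_combination -h1
    exact_mod_cast h3
  rw [lambdaSeries_eq_prod V b χ hb, lambdaSeries_eq_prod W b' ψ hb'] at hp
  obtain ⟨v, hv⟩ : ∃ v : PowerSeries (charRing H), (1 - PowerSeries.X) * v = 1 :=
    ⟨PowerSeries.mk 1, by rw [mul_comm]; exact PowerSeries.mk_one_mul_one_sub_eq_one _⟩
  have hsub : PowerSeries.HasSubst (PowerSeries.X * v) :=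
    PowerSeries.HasSubst.of_constantCoeff_zero' (by simp)
  have hp' := congrArg (fun q => PowerSeries.subst (PowerSeries.X * v) q) hp
  simp only [PowerSeries.subst_mul hsub, subst_prod hsub, subst_linear hv hsub,
    Finset.prod_mul_distrib, Finset.prod_const, Finset.card_univ, Fintype.card_fin] at hp'
  rw [show v ^ Module.finrank ℂ V.carrier = v ^ (Module.finrank ℂ W.carrier + n) by rw [hdim]]
    at hp'
  have hpow : ∀ k, (1 - PowerSeries.X) ^ k * v ^ k = 1 := fun k => by
    rw [← mul_pow, hv, one_pow]
  rw [← coeff_substitution n v hv p]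
  refine AugSeries.of_mul (r := ∏ i, (1 + PowerSeries.C (lineClass (ψ i) - 1) * PowerSeries.X))
    ?_ (augSeries_prod _ _ fun i _ => augSeries_linear _) ?_ (n + 1)
  · have : (1 - PowerSeries.X) ^ n * p.subst (PowerSeries.X * v) *
        ∏ i, (1 + PowerSeries.C (lineClass (ψ i) - 1) * PowerSeries.X) =
        ∏ i, (1 + PowerSeries.C (lineClass (χ i) - 1) * PowerSeries.X) := by
      have h1 := hpow (Module.finrank ℂ W.carrier + n)
      have h2 := hpow (Module.finrank ℂ W.carrier)
      rw [pow_add] at h1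
      rw [pow_add v] at h1 hp'
      generalize ∏ i, (1 + PowerSeries.C (lineClass (ψ i) - 1) * PowerSeries.X) = P at hp' ⊢
      generalize ∏ i, (1 + PowerSeries.C (lineClass (χ i) - 1) * PowerSeries.X) = Q at hp' ⊢
      linear_combination ((1 - PowerSeries.X) ^ Module.finrank ℂ W.carrier *
        (1 - PowerSeries.X) ^ n) * hp' -
        ((1 - PowerSeries.X) ^ n * p.subst (PowerSeries.X * v) * P) * h2 + Q * h1
    rw [this]
    exact augSeries_prod _ _ fun i _ => augSeries_linear _
  · simp [PowerSeries.coeff_zero_eq_constantCoeff, map_prod]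

/-- The element `χ - 1` equals `γ¹(χ - 1)`. -/
theorem char_sub_one_mem_gamma (χ : H →* ℂˣ) :
    lineClass χ - 1 ∈ (gammaFiltration H).level 1 := by
  have hb : ∀ (χ : H →* ℂˣ) h (i : Fin 1),
      (FinRep.line χ).ρ h (Module.Basis.singleton (Fin 1) ℂ i) =
        (χ h : ℂ) • (Module.Basis.singleton (Fin 1) ℂ i : ℂ) := fun χ h i => rfl
  refine AddSubgroup.subset_closure ⟨[(1, lineClass χ - 1, lineClass χ - 1)], ?_, by simp, by simp⟩
  intro t ht
  obtain rfl : t = (1, lineClass χ - 1, lineClass χ - 1) := by simpa using ht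
  refine ⟨?_, ?_⟩
  · change (lineClass χ).1 1 - 1 = 0
    rw [lineClass_apply]; simp
  · obtain ⟨v, hv⟩ : ∃ v : PowerSeries (charRing H),
        v * (1 + PowerSeries.C 1 * PowerSeries.X) = 1 := by
      refine ⟨PowerSeries.invOfUnit (1 + PowerSeries.C 1 * PowerSeries.X) 1, ?_⟩
      rw [mul_comm]
      exact PowerSeries.mul_invOfUnit _ _ (by simp)
    have e1 : (FinRep.line (1 : H →* ℂˣ)).lambdaSeries = 1 + PowerSeries.C 1 * PowerSeries.X := by
      rw [lambdaSeries_eq_prod _ _ (fun _ => 1) (hb 1), Fin.prod_univ_one, lineClass_one]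
    have e2 : (FinRep.line χ).lambdaSeries = 1 + PowerSeries.C (lineClass χ) * PowerSeries.X := by
      rw [lambdaSeries_eq_prod _ _ (fun _ => χ) (hb χ), Fin.prod_univ_one]
    refine ⟨(FinRep.line χ).lambdaSeries * v, ⟨FinRep.line χ, FinRep.line 1, ?_, ?_⟩, ?_⟩
    · change lineClass χ - 1 + ((1 : ℕ) : charRing H) - 1 = lineClass χ - lineClass 1
      rw [lineClass_one, Nat.cast_one]; ring
    · rw [mul_assoc, e1, hv, mul_one]
    · have h0 := congrArg (PowerSeries.coeff 0) hv
      have h1 := congrArg (PowerSeries.coeff 1) hv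
      simp [mul_add, PowerSeries.coeff_one] at h0 h1
      have h2 : PowerSeries.coeff 1 v = -1 := by linear_combination h1 - h0
      rw [e2]
      simp [add_mul, mul_assoc, PowerSeries.coeff_succ_X_mul, h0, h2]
      ring

theorem lineClass_mem_gamma (χ : H →* ℂˣ) : lineClass χ ∈ (gammaFiltration H).level 0 := by
  have := add_mem ((gammaFiltration H).antitone_level (Nat.zero_le 1) (char_sub_one_mem_gamma χ))
    (gammaFiltration H).one_mem_level
  rwa [sub_add_cancel] at this

/-- For a finite abelian group, the `γ`-filtration is the filtration by the powers of the
augmentation ideal. -/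
theorem mem_gamma_iff [Finite H] {n : ℕ} {x : charRing H} :
    x ∈ (gammaFiltration H).level n ↔ x.1 ∈ augPow H n := by
  constructor
  · intro hx
    refine AddSubgroup.closure_induction (p := fun x _ => x ∈ augPowClass H n) ?_ (zero_mem _)
      (fun _ _ _ _ => add_mem) (fun _ _ => neg_mem) hx
    rintro _ ⟨l, hl, hn, rfl⟩
    exact augPow_antitone hn (list_prod_mem_augPowClass l _ _ fun t ht =>
      isGamma_mem_augPowClass (hl t ht).1 (hl t ht).2)
  · intro hx
    suffices h : ∃ y ∈ (gammaFiltration H).level n, y.1 = x.1 by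
      obtain ⟨y, hy, hyx⟩ := h
      rwa [← Subtype.ext hyx]
    refine augPow_induction (p := fun f => ∃ y ∈ (gammaFiltration H).level n, y.1 = f)
      ?_ ⟨0, zero_mem _, rfl⟩ ?_ ?_ hx
    · rintro ψ l rfl
      clear hx
      refine ⟨lineClass ψ * (l.map fun χ => lineClass χ - 1).prod, ?_, ?_⟩
      · rw [← Nat.zero_add l.length]
        refine (gammaFiltration H).mul_mem_level (lineClass_mem_gamma ψ) ?_
        induction l with
        | nil => exact (gammaFiltration H).one_mem_level
        | cons χ l ih =>
          rw [List.map_cons, List.prod_cons, List.length_cons, Nat.add_comm]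
          exact (gammaFiltration H).mul_mem_level (char_sub_one_mem_gamma χ) ih
      · funext h
        rw [← charEval_apply, map_mul, map_list_prod, List.map_map, charEval_apply,
          lineClass_apply]
        congr 3
        funext χ
        rw [Function.comp_apply, map_sub, map_one, charEval_apply, lineClass_apply]
    · rintro _ _ ⟨y, hy, rfl⟩ ⟨z, hz, rfl⟩
      exact ⟨y + z, add_mem hy hz, rfl⟩
    · rintro _ ⟨y, hy, rfl⟩
      exact ⟨-y, neg_mem hy, rfl⟩

end GammaEq

/-! ### Polynomials with coefficients in the powers of the augmentation ideal -/

section Rees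

variable {H : Type u} [CommGroup H]

variable (H) in
/-- The functions `F = ∑ₙ fₙ tⁿ : H → ℂ[t]` for which `fₙ` is in the power `n + d` of the
augmentation ideal. For `d = 0` this is the Rees ring of the filtration by powers of the
augmentation ideal, for `d = 1` the kernel of the map from it to the associated graded ring. -/
def reesPow (d : ℕ) : AddSubgroup (H → Polynomial ℂ) where
  carrier := {F | ∀ n, (fun h => (F h).coeff n) ∈ augPow H (n + d)}
  zero_mem' := fun _ => zero_mem _
  add_mem' := fun {F F'} hF hF' n => by
    have := add_mem (hF n) (hF' n)
    simp only [Pi.add_apply, Polynomial.coeff_add]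
    exact this
  neg_mem' := fun {F} hF n => by
    have := neg_mem (hF n)
    simp only [Pi.neg_apply, Polynomial.coeff_neg]
    exact this

theorem reesPow_antitone : Antitone (reesPow H) := fun _ _ hd _ hF n =>
  augPow_antitone (Nat.add_le_add_left hd n) (hF n)

theorem monomial_mem_reesPow {n d : ℕ} {f : H → ℂ} (hf : f ∈ augPow H (n + d)) :
    (fun h => Polynomial.monomial n (f h)) ∈ reesPow H d := by
  intro k
  simp only [Polynomial.coeff_monomial]
  by_cases hk : n = k
  · subst hk; simpa using hf
  · simp only [hk, if_false]
    exact zero_mem _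

theorem reesPow_mul {d e : ℕ} {F F' : H → Polynomial ℂ} (hF : F ∈ reesPow H d)
    (hF' : F' ∈ reesPow H e) : F * F' ∈ reesPow H (d + e) := by
  intro n
  simp only [Pi.mul_apply, Polynomial.coeff_mul]
  have : (fun h => ∑ x ∈ Finset.HasAntidiagonal.antidiagonal n,
      (F h).coeff x.1 * (F' h).coeff x.2) = ∑ x ∈ Finset.HasAntidiagonal.antidiagonal n,
      (fun h => (F h).coeff x.1) * (fun h => (F' h).coeff x.2) := by
    funext h
    simp only [Finset.sum_apply, Pi.mul_apply]
  rw [this]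
  refine sum_mem fun x hx => ?_
  have := augPow_mul (hF x.1) (hF' x.2)
  rw [← Finset.HasAntidiagonal.mem_antidiagonal.1 hx]
  rwa [show x.1 + d + (x.2 + e) = x.1 + x.2 + (d + e) by ring] at this

theorem one_mem_reesPow : (1 : H → Polynomial ℂ) ∈ reesPow H 0 := by
  have := monomial_mem_reesPow (n := 0) (d := 0) (one_mem_augPow (H := H))
  exact this

theorem reesPow_prod {ι : Type*} (s : Finset ι) (d : ι → ℕ) (F : ι → H → Polynomial ℂ)
    (hF : ∀ i ∈ s, F i ∈ reesPow H (d i)) : ∏ i ∈ s, F i ∈ reesPow H (∑ i ∈ s, d i) := by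
  induction s using Finset.induction_on with
  | empty => exact one_mem_reesPow
  | insert i s hi ih =>
    rw [Finset.prod_insert hi, Finset.sum_insert hi]
    exact reesPow_mul (hF _ (Finset.mem_insert_self _ _))
      (ih fun j hj => hF _ (Finset.mem_insert_of_mem hj))

theorem augPow_prod {ι : Type*} (s : Finset ι) (f : ι → H → ℂ) (d : ℕ)
    (hf : ∀ i ∈ s, f i ∈ augPow H d) : ∏ i ∈ s, f i ∈ augPow H (d * s.card) := by
  induction s using Finset.induction_on with
  | empty => exact one_mem_augPow
  | insert i s hi ih =>
    rw [Finset.prod_insert hi, Finset.card_insert_of_notMem hi, Nat.mul_add_one, Nat.add_comm]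
    exact augPow_mul (hf _ (Finset.mem_insert_self _ _))
      (ih fun j hj => hf _ (Finset.mem_insert_of_mem hj))

theorem reesPow_comp {K : Type u} [CommGroup K] (φ : K →* H) {d : ℕ} {F : H → Polynomial ℂ}
    (hF : F ∈ reesPow H d) : (fun k => F (φ k)) ∈ reesPow K d := fun n => augPow_comp φ (hF n)

variable [Finite H]

theorem reesPow_induction {d : ℕ} {p : (H → Polynomial ℂ) → Prop}
    (mem : ∀ (n : ℕ) (ψ : H →* ℂˣ) (l : List (H →* ℂˣ)), l.length = n + d →
      p fun h => Polynomial.monomial n ((ψ h : ℂ) * (l.map fun χ => (χ h : ℂ) - 1).prod))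
    (zero : p 0) (add : ∀ x y, p x → p y → p (x + y)) (neg : ∀ x, p x → p (-x))
    {F : H → Polynomial ℂ} (hF : F ∈ reesPow H d) : p F := by
  have := Fintype.ofFinite H
  have h1 : ∀ n, p fun h => Polynomial.monomial n ((F h).coeff n) := by
    intro n
    refine augPow_induction (p := fun f => p fun h => Polynomial.monomial n (f h)) (mem n)
      ?_ ?_ ?_ (hF n)
    · simp only [Pi.zero_apply, map_zero]
      exact zero
    · intro x y hx hy
      simp only [Pi.add_apply, map_add]
      exact add _ _ hx hy
    · intro x hx
      simp only [Pi.neg_apply, map_neg]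
      exact neg _ hx
  set N := (Finset.univ : Finset H).sup fun h => (F h).natDegree + 1
  have h2 : F = ∑ n ∈ Finset.range N, fun h => Polynomial.monomial n ((F h).coeff n) := by
    funext h
    rw [Finset.sum_apply]
    refine (F h).as_sum_range' N ?_
    exact Nat.lt_of_succ_le (Finset.le_sup (f := fun h => (F h).natDegree + 1) (Finset.mem_univ h))
  rw [h2]
  generalize Finset.range N = s
  induction s using Finset.induction_on with
  | empty => simpa using zero
  | insert n s hn ih =>
    rw [Finset.sum_insert hn]
    exact add _ _ (h1 n) ih

/-- Since characters of subgroups extend, elements of `reesPow` lift from subgroups. -/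
theorem exists_reesPow_lift (K : Subgroup H) {d : ℕ} {F : K → Polynomial ℂ}
    (hF : F ∈ reesPow K d) : ∃ F' ∈ reesPow H d, ∀ k : K, F' k = F k := by
  refine reesPow_induction (p := fun F => ∃ F' ∈ reesPow H d, ∀ k : K, F' k = F k)
    ?_ ⟨0, zero_mem _, fun _ => rfl⟩ ?_ ?_ hF
  · intro n ψ l hl
    obtain ⟨ψ', hψ'⟩ := exists_char_extension K ψ
    choose e he using exists_char_extension K
    refine ⟨_, monomial_mem_reesPow (n := n) (augPow_gen ψ' (l.map e) (by simp [hl])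
      fun h => rfl), ?_⟩
    intro k
    simp only [hψ', List.map_map]
    congr 4
    funext χ
    simp [he]
  · rintro _ _ ⟨x, hx, hx'⟩ ⟨y, hy, hy'⟩
    exact ⟨x + y, add_mem hx hy, fun k => by simp [hx', hy']⟩
  · rintro _ ⟨x, hx, hx'⟩
    exact ⟨-x, neg_mem hx, fun k => by simp [hx']⟩

end Rees

/-! ### Norms of characters -/

section NormChar

/-- For an element `q` of order `m` in a finite abelian group `Q`, the values at `q` of the
characters of `Q` are the `m`-th roots of unity, each taken `|Q| / m` times. -/
theorem prod_dual_sub {Q : Type*} [CommGroup Q] [Finite Q] (q : Q) (a b : ℂ) :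
    ∏ θ : Q →* ℂˣ, (a - θ q * b) = (a ^ orderOf q - b ^ orderOf q) ^ (Nat.card Q / orderOf q) := by
  set m := orderOf q with hm
  have hmpos : 0 < m := orderOf_pos q
  have hmaps : ∀ θ ∈ (Finset.univ : Finset (Q →* ℂˣ)),
      ((θ q : ℂˣ) : ℂ) ∈ Polynomial.nthRootsFinset m (1 : ℂ) := by
    intro θ _
    rw [Polynomial.mem_nthRootsFinset hmpos, ← Units.val_pow_eq_pow_val, ← map_pow, hm,
      pow_orderOf_eq_one, map_one, Units.val_one]
  have hker : Nat.card (MonoidHom.domRestrictHom (Subgroup.zpowers q) ℂˣ).ker = Nat.card Q / m := by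
    rw [CommGroup.card_domRestrictHom_ker, ← Subgroup.index_eq_card, hm, ← Nat.card_zpowers]
    exact (Nat.div_eq_of_eq_mul_left Nat.card_pos
      (Subgroup.index_mul_card (Subgroup.zpowers q)).symm).symm
  have hmem : ∀ θ : Q →* ℂˣ, θ q = 1 →
      θ ∈ (MonoidHom.domRestrictHom (Subgroup.zpowers q) ℂˣ).ker := by
    intro θ hθ
    rw [MonoidHom.mem_ker]
    ext ⟨x, hx⟩
    obtain ⟨k, rfl⟩ := Subgroup.mem_zpowers_iff.1 hx
    simp [hθ]
  have hle : ∀ ζ ∈ Polynomial.nthRootsFinset m (1 : ℂ),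
      (Finset.univ.filter fun θ : Q →* ℂˣ => ((θ q : ℂˣ) : ℂ) = ζ).card ≤ Nat.card Q / m := by
    intro ζ _
    rcases (Finset.univ.filter fun θ : Q →* ℂˣ => ((θ q : ℂˣ) : ℂ) = ζ).eq_empty_or_nonempty
      with h | ⟨θ₀, h₀⟩
    · rw [h]; simp
    · have hk : Nat.card (MonoidHom.domRestrictHom (Subgroup.zpowers q) ℂˣ).ker =
          (Finset.univ.filter fun θ : Q →* ℂˣ =>
            θ ∈ (MonoidHom.domRestrictHom (Subgroup.zpowers q) ℂˣ).ker).card :=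
        Nat.subtype_card _ (by simp)
      rw [← hker, hk]
      refine Finset.card_le_card_of_injOn (fun θ => θ * θ₀⁻¹) ?_
        ((mul_left_injective θ₀⁻¹).injOn)
      intro θ hθ
      rw [Finset.mem_coe, Finset.mem_filter] at hθ ⊢
      refine ⟨Finset.mem_univ _, hmem _ ?_⟩
      have : θ q = θ₀ q := Units.ext (hθ.2.trans (Finset.mem_filter.1 h₀).2.symm)
      rw [MonoidHom.mul_apply, MonoidHom.inv_apply, this, mul_inv_cancel]
  have hsum : ∑ ζ ∈ Polynomial.nthRootsFinset m (1 : ℂ),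
      (Finset.univ.filter fun θ : Q →* ℂˣ => ((θ q : ℂˣ) : ℂ) = ζ).card =
      ∑ ζ ∈ Polynomial.nthRootsFinset m (1 : ℂ), Nat.card Q / m := by
    rw [← Finset.card_eq_sum_card_fiberwise hmaps, Finset.sum_const, Finset.card_univ,
      ← Nat.card_eq_fintype_card, CommGroup.card_monoidHom_of_hasEnoughRootsOfUnity Q ℂ,
      (Complex.isPrimitiveRoot_exp m hmpos.ne').card_nthRootsFinset, smul_eq_mul,
      Nat.mul_div_cancel' (orderOf_dvd_natCard q)]
  have hcard := (Finset.sum_eq_sum_iff_of_le hle).1 hsum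
  rw [(Complex.isPrimitiveRoot_exp m hmpos.ne').pow_sub_pow_eq_prod_sub_mul a b hmpos,
    ← Finset.prod_fiberwise_of_maps_to hmaps, ← Finset.prod_pow]
  refine Finset.prod_congr rfl fun ζ hζ => ?_
  rw [← hcard ζ hζ, Finset.prod_congr rfl (g := fun _ => a - ζ * b), Finset.prod_const]
  intro θ hθ
  rw [(Finset.mem_filter.1 hθ).2]

variable {G : Type u} [CommGroup G]

/-- The norm from `H ⊓ K` to `K` of the restriction of `β : G → ℂ[t]`. The cycles of `k` on
`K / (H ⊓ K)` all have the same length, the order of `k` in this group. -/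
def orbitNorm (K H : Subgroup G) (β : G → Polynomial ℂ) (k : K) : Polynomial ℂ :=
  Polynomial.expand ℂ (orderOf (k : K ⧸ H.subgroupOf K))
    (β ((k : G) ^ orderOf (k : K ⧸ H.subgroupOf K))) ^
    (Nat.card (K ⧸ H.subgroupOf K) / orderOf (k : K ⧸ H.subgroupOf K))

/-- The functions `β : G → ℂ[t]` all of whose norms are as deep in the filtration as the norms of
elements of weight `d` should be. The condition is multiplicative in `β`. -/
def Admissible (d : ℕ) (β : G → Polynomial ℂ) : Prop :=
  ∀ K H : Subgroup G, orbitNorm K H β ∈ reesPow K (d * Nat.card (K ⧸ H.subgroupOf K))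

theorem Admissible.mul {d e : ℕ} {β β' : G → Polynomial ℂ} (h : Admissible d β)
    (h' : Admissible e β') : Admissible (d + e) (β * β') := by
  intro K H
  rw [add_mul]
  convert reesPow_mul (h K H) (h' K H) using 1
  funext k
  simp [orbitNorm, mul_pow]

theorem admissible_char (ψ : G →* ℂˣ) : Admissible 0 fun g => Polynomial.C (ψ g : ℂ) := by
  intro K H
  rw [zero_mul]
  convert monomial_mem_reesPow (n := 0) (d := 0)
    (char_mem_augPow ((ψ.comp K.subtype) ^ Nat.card (K ⧸ H.subgroupOf K))) using 1
  funext k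
  simp only [orbitNorm, map_pow, Polynomial.expand_C, Units.val_pow_eq_pow_val]
  rw [← pow_mul, Nat.mul_div_cancel' (orderOf_dvd_natCard _)]
  simp

variable [Finite G]

theorem admissible_zero (d : ℕ) : Admissible d (0 : G → Polynomial ℂ) := by
  intro K H
  convert zero_mem (reesPow K (d * Nat.card (K ⧸ H.subgroupOf K))) using 1
  funext k
  simp only [orbitNorm, Pi.zero_apply, map_zero]
  refine zero_pow (Nat.div_pos ?_ (orderOf_pos _)).ne'
  exact Nat.le_of_dvd Nat.card_pos (orderOf_dvd_natCard _)

theorem card_dual_quotient (K H : Subgroup G) :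
    (Finset.univ : Finset ((K ⧸ H.subgroupOf K) →* ℂˣ)).card = Nat.card (K ⧸ H.subgroupOf K) := by
  rw [Finset.card_univ, ← Nat.card_eq_fintype_card]
  exact CommGroup.card_monoidHom_of_hasEnoughRootsOfUnity _ ℂ

/-- The norm of `-1` is the product of the `-θ`, for the characters `θ` of `K / (H ⊓ K)`. -/
theorem admissible_neg_one : Admissible 0 fun _ : G => (-1 : Polynomial ℂ) := by
  intro K H
  rw [zero_mul]
  have := augPow_prod (H := K) (Finset.univ : Finset ((K ⧸ H.subgroupOf K) →* ℂˣ))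
    (fun θ k => 0 - (θ k : ℂ) * 1) 0 fun θ _ => by
      convert neg_mem (char_mem_augPow (θ.comp (QuotientGroup.mk' (H.subgroupOf K)))) using 1
      funext k
      simp
  rw [zero_mul] at this
  convert monomial_mem_reesPow (n := 0) (d := 0) this using 1
  funext k
  rw [Finset.prod_apply, prod_dual_sub, zero_pow (orderOf_pos _).ne', one_pow, zero_sub]
  simp [orbitNorm]

/-- The norm of `χ - 1` is the product of the differences `χ - θ`, for the characters `θ` of
`K / (H ⊓ K)`. -/
theorem prod_char_sub_mem (K H : Subgroup G) (χ : G →* ℂˣ) :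
    (fun k : K => (((χ k : ℂ)) ^ orderOf (k : K ⧸ H.subgroupOf K) - 1) ^
      (Nat.card (K ⧸ H.subgroupOf K) / orderOf (k : K ⧸ H.subgroupOf K))) ∈
      augPow K (Nat.card (K ⧸ H.subgroupOf K)) := by
  have := augPow_prod (H := K) (Finset.univ : Finset ((K ⧸ H.subgroupOf K) →* ℂˣ))
    (fun θ k => (χ k : ℂ) - (θ k : ℂ) * 1) 1 fun θ _ => by
      convert char_sub_char_mem_augPow (χ.comp K.subtype)
        (θ.comp (QuotientGroup.mk' (H.subgroupOf K))) using 1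
      funext k
      simp
  rw [one_mul, card_dual_quotient] at this
  convert this using 1
  funext k
  rw [Finset.prod_apply, prod_dual_sub, one_pow]

theorem admissible_char_sub_one (χ : G →* ℂˣ) :
    Admissible 1 fun g => Polynomial.C ((χ g : ℂ) - 1) := by
  intro K H
  rw [one_mul]
  have := prod_char_sub_mem K H χ
  rw [← Nat.zero_add (Nat.card _)] at this
  convert monomial_mem_reesPow this using 1
  funext k
  simp [orbitNorm]

/-- Multiplication by `t` lowers the weight by one: the norm takes `t` to `t ^ [K : H ⊓ K]`. -/
theorem admissible_char_sub_one_mul_X (χ : G →* ℂˣ) :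
    Admissible 0 fun g => Polynomial.C ((χ g : ℂ) - 1) * Polynomial.X := by
  intro K H
  rw [zero_mul]
  convert monomial_mem_reesPow (d := 0) (n := Nat.card (K ⧸ H.subgroupOf K))
    (prod_char_sub_mem K H χ) using 1
  funext k
  simp only [orbitNorm, map_mul, Polynomial.expand_C, Polynomial.expand_X, map_pow,
    Units.val_pow_eq_pow_val]
  rw [mul_pow, ← pow_mul Polynomial.X, Nat.mul_div_cancel' (orderOf_dvd_natCard _),
    ← Polynomial.C_pow, Polynomial.C_mul_X_pow_eq_monomial]

theorem admissible_list : ∀ (n d : ℕ) (l : List (G →* ℂˣ)), l.length = n + d →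
    Admissible d fun g => Polynomial.monomial n (l.map fun χ => (χ g : ℂ) - 1).prod
  | 0, 0, [], _ => by
    convert admissible_char (1 : G →* ℂˣ) using 1
    funext g; simp
  | 0, d + 1, χ :: l, hl => by
    convert (admissible_list 0 d l (by simpa using hl)).mul (admissible_char_sub_one χ) using 1
    funext g; simp [mul_comm]
  | 0, d + 1, [], hl => by simp at hl
  | n + 1, d, [], hl => by rw [List.length_nil] at hl; omega
  | n + 1, d, χ :: l, hl => by
    have hl' : l.length = n + d := by
      rw [List.length_cons] at hl; omega
    have h := (admissible_list n d l hl').mul (admissible_char_sub_one_mul_X χ)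
    rw [add_zero] at h
    convert h using 1
    funext g
    simp only [List.map_cons, List.prod_cons, Pi.mul_apply, ← Polynomial.C_mul_X_pow_eq_monomial,
      map_mul]
    ring

theorem Admissible.neg {d : ℕ} {β : G → Polynomial ℂ} (h : Admissible d β) :
    Admissible d (-β) := by
  have := admissible_neg_one.mul h
  rw [zero_add] at this
  convert this using 1
  funext g; simp

/-- Every element of weight `d` on a subgroup is a sum of restrictions of admissible functions. -/
theorem exists_admissible_list (H : Subgroup G) {d : ℕ} {F : H → Polynomial ℂ}
    (hF : F ∈ reesPow H d) : ∃ l : List (G → Polynomial ℂ), (∀ β ∈ l, Admissible d β) ∧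
      ∀ h : H, F h = (l.map fun β => β h).sum := by
  refine reesPow_induction (p := fun F => ∃ l : List (G → Polynomial ℂ),
    (∀ β ∈ l, Admissible d β) ∧ ∀ h : H, F h = (l.map fun β => β h).sum) ?_ ?_ ?_ ?_ hF
  · intro n ψ l hl
    obtain ⟨ψ', hψ'⟩ := exists_char_extension H ψ
    choose e he using exists_char_extension H
    refine ⟨[(fun g => Polynomial.C (ψ' g : ℂ)) * fun g => Polynomial.monomial n
      ((l.map e).map fun χ => (χ g : ℂ) - 1).prod], ?_, ?_⟩
    · intro β hβ
      rw [List.mem_singleton] at hβ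
      subst hβ
      have := (admissible_char ψ').mul (admissible_list n d (l.map e) (by simp [hl]))
      rwa [zero_add] at this
    · intro h
      simp only [List.map_cons, List.map_nil, List.sum_singleton, Pi.mul_apply, hψ', List.map_map,
        Polynomial.C_mul_monomial]
      congr 4
      funext χ
      simp [he]
  · exact ⟨[], by simp, by simp⟩
  · rintro _ _ ⟨l, hl, hl'⟩ ⟨r, hr, hr'⟩
    refine ⟨l ++ r, ?_, fun h => by simp [hl', hr']⟩
    intro β hβ
    rcases List.mem_append.1 hβ with h | h
    · exact hl β h
    · exact hr β h
  · rintro _ ⟨l, hl, hl'⟩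
    refine ⟨l.map fun β => -β, ?_, fun h => ?_⟩
    · intro β hβ
      obtain ⟨β', h, rfl⟩ := List.mem_map.1 hβ
      exact (hl β' h).neg
    · rw [Pi.neg_apply, hl', List.map_map]
      clear hl hl'
      induction l with
      | nil => simp
      | cons β l ih => simp [← ih, add_comm]

end NormChar

/-! ### Sizes of cycles and orbits -/

section Sizes

@[to_additive]
theorem prod_eq_prod_classesIn_pow {X : Type*} [Fintype X] {A : Type*} [CommMonoid A]
    (r : Setoid X) (p : X → Prop) (F : X → A) (hp : ∀ x x', r x x' → p x → p x')
    (hF : ∀ x x', r x x' → p x → F x = F x') :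
    ∏ x with p x, F x =
      ∏ o ∈ classesIn r p, F o.out ^ (Finset.univ.filter fun x => r o.out x).card := by
  rw [← Finset.prod_fiberwise_of_maps_to (s := Finset.univ.filter p) (t := classesIn r p)
    (g := fun x => Quotient.mk r x)]
  · refine Finset.prod_congr rfl fun o ho => ?_
    rw [mem_classesIn] at ho
    have hset : (Finset.univ.filter p).filter (fun x => Quotient.mk r x = o) =
        Finset.univ.filter fun x => r o.out x := by
      ext x
      simp only [Finset.mem_filter, Finset.mem_univ, true_and]
      constructor
      · rintro ⟨_, rfl⟩
        exact Quotient.mk_out (s := r) x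
      · intro h
        refine ⟨hp _ _ h ho, ?_⟩
        rw [← Quotient.out_eq o]
        exact Quotient.sound (r.symm h)
    rw [hset, ← Finset.prod_const]
    refine Finset.prod_congr rfl fun x hx => ?_
    exact (hF _ _ (Finset.mem_filter.1 hx).2 ho).symm
  · intro x hx
    rw [Finset.mem_filter] at hx
    exact mem_classesIn.2 (hp _ _ (r.symm (Quotient.mk_out (s := r) x)) hx.2)

theorem sum_range_getD {α A : Type*} [AddCommMonoid A] (l : List (α → A)) (g : α) :
    ∑ j ∈ Finset.range l.length, l.getD j 0 g = (l.map fun β => β g).sum := by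
  induction l with
  | nil => rfl
  | cons β l ih =>
    rw [List.length_cons, Finset.sum_range_succ', List.map_cons, List.sum_cons, ← ih, add_comm]
    rfl

variable {G : Type u} [CommGroup G] {X Y : FinGSet G}

theorem card_cycle (g : G) (x : X) :
    (Finset.univ.filter fun x' => cycleRel g X x x').card = MulAction.period g x := by
  change _ = Function.minimalPeriod (g • ·) x
  have : Fintype (MulAction.orbit (Subgroup.zpowers g) x) := Fintype.ofFinite _
  rw [MulAction.minimalPeriod_eq_card, ← Fintype.card_coe]
  refine Fintype.card_congr (Equiv.subtypeEquivRight fun x' => ?_)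
  rw [Finset.mem_filter, cycleRel_iff, MulAction.mem_orbit_iff]
  simp only [Finset.mem_univ, true_and, Subtype.exists, Subgroup.mem_zpowers_iff]
  constructor
  · rintro ⟨k, hk⟩
    exact ⟨g ^ k, ⟨k, rfl⟩, hk⟩
  · rintro ⟨_, ⟨k, rfl⟩, hk⟩
    exact ⟨k, hk⟩

/-- The product over a fibre, taken cycle by cycle. -/
theorem prod_fibre_eq_prod_cycles {A : Type*} [CommMonoid A] (f : X →[G] Y) {g : G} {y : Y}
    (hy : g • y = y) (F : X → A) (hF : ∀ x x', cycleRel g X x x' → F x = F x') :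
    ∏ x with f x = y, F x =
      ∏ o ∈ classesIn (cycleRel g X) (fun x => f x = y), F o.out ^ MulAction.period g o.out := by
  rw [prod_eq_prod_classesIn_pow (cycleRel g X) (fun x => f x = y) F
    (fun x x' h => map_eq_of_cycleRel f hy h) fun x x' h _ => hF x x' h]
  simp_rw [card_cycle]

theorem sum_period (f : X →[G] Y) {g : G} {y : Y} (hy : g • y = y) :
    ∑ o ∈ classesIn (cycleRel g X) (fun x => f x = y), MulAction.period g o.out =
      Nat.card {x : X // f x = y} := by
  have h := sum_eq_sum_classesIn_nsmul (cycleRel g X) (fun x => f x = y) (fun _ => 1)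
    (fun x x' h => map_eq_of_cycleRel f hy h) fun x x' h _ => rfl
  simp only [card_cycle, smul_eq_mul, mul_one] at h
  rw [← h, Finset.sum_const, smul_eq_mul, mul_one, Nat.card_eq_fintype_card, Fintype.card_subtype]

/-- The length of the cycle of `k` through `x` is the order of `k` modulo the stabilizer of `x`. -/
theorem period_eq_orderOf (K : Subgroup G) (k : K) (x : X) :
    MulAction.period (k : G) x =
      orderOf (k : K ⧸ (MulAction.stabilizer G x).subgroupOf K) := by
  have key : ∀ n : ℕ, (k : K ⧸ (MulAction.stabilizer G x).subgroupOf K) ^ n = 1 ↔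
      (k : G) ^ n • x = x := by
    intro n
    rw [← QuotientGroup.mk_pow, QuotientGroup.eq_one_iff, Subgroup.mem_subgroupOf]
    simp
  refine Nat.dvd_antisymm ?_ ?_
  · rw [← MulAction.pow_smul_eq_iff_period_dvd, ← key, pow_orderOf_eq_one]
  · rw [orderOf_dvd_iff_pow_eq_one, key, MulAction.pow_period_smul]

theorem orbitRel_iff {K : Subgroup G} {x x' : X} :
    MulAction.orbitRel K X x x' ↔ ∃ k : K, (k : G) • x' = x := by
  rw [MulAction.orbitRel_apply, MulAction.mem_orbit_iff]
  rfl

theorem card_orbit (K : Subgroup G) (x : X) :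
    (Finset.univ.filter fun x' => MulAction.orbitRel K X x x').card =
      Nat.card (K ⧸ (MulAction.stabilizer G x).subgroupOf K) := by
  have h1 : (MulAction.stabilizer G x).subgroupOf K = MulAction.stabilizer K x := by
    ext k; rfl
  rw [h1, ← Subgroup.index_eq_card, MulAction.index_stabilizer, ← Set.ncard_coe_finset]
  congr 1
  ext x'
  simp only [Finset.coe_filter, Finset.mem_univ, true_and, Set.mem_ofPred_eq]
  rw [← MulAction.orbitRel_apply]
  exact ⟨fun h => (MulAction.orbitRel K X).symm h, fun h => (MulAction.orbitRel K X).symm h⟩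

theorem map_eq_of_orbitRel (f : X →[G] Y) {y : Y} {x x' : X}
    (h : MulAction.orbitRel (MulAction.stabilizer G y) X x x') (hx : f x = y) : f x' = y := by
  obtain ⟨k, rfl⟩ := orbitRel_iff.1 h
  have hk : (k : G) • y = y := k.2
  rw [map_smul] at hx
  exact smul_left_cancel (k : G) (hx.trans hk.symm)

theorem cycleRel_le_orbitRel {K : Subgroup G} (k : K) {x x' : X} (h : cycleRel (k : G) X x x') :
    MulAction.orbitRel K X x x' := by
  obtain ⟨n, rfl⟩ := h
  exact orbitRel_iff.2 ⟨(k ^ n)⁻¹, by simp⟩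

end Sizes

/-! ### The weight filtration on ghosts -/

section Weights

open FinGSet

variable {G : Type u} [CommGroup G] {X Y Z : FinGSet G}

/-- A ghost has weight `d : X → ℕ` when, for every `x`, its coefficient of degree `n` over `x` is
in the power `n + d x` of the augmentation ideal of the stabilizer of `x`; equivalently, of the
augmentation ideal of `G`, since characters of the stabilizer extend to `G`. -/
def HasWeight (d : X → ℕ) (a : Ghost X) : Prop :=
  ∀ x, ∃ F ∈ reesPow G (d x), ∀ g : G, g • x = x → ev a.1 g x = F g

theorem HasWeight.res {d : Y → ℕ} {a : Ghost Y} (h : HasWeight d a) (f : X →[G] Y) :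
    HasWeight (fun x => d (f x)) (gRes f a) := by
  intro x
  obtain ⟨F, hF, hF'⟩ := h (f x)
  refine ⟨F, hF, fun g hg => ?_⟩
  rw [ev_gRes _ _ hg]
  exact hF' g (by rw [← map_smul, hg])

theorem HasWeight.mono {d e : X → ℕ} {a : Ghost X} (h : HasWeight d a) (hde : ∀ x, e x ≤ d x) :
    HasWeight e a := by
  intro x
  obtain ⟨F, hF, hF'⟩ := h x
  exact ⟨F, reesPow_antitone (hde x) hF, hF'⟩

theorem HasWeight.add {d : X → ℕ} {a b : Ghost X} (ha : HasWeight d a) (hb : HasWeight d b) :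
    HasWeight d (a + b) := by
  intro x
  obtain ⟨F, hF, hF'⟩ := ha x
  obtain ⟨E, hE, hE'⟩ := hb x
  refine ⟨F + E, add_mem hF hE, fun g hg => ?_⟩
  rw [Pi.add_apply, ← hF' g hg, ← hE' g hg]
  exact ev_add a.1 b.1 g x

theorem HasWeight.neg {d : X → ℕ} {a : Ghost X} (ha : HasWeight d a) : HasWeight d (-a) := by
  intro x
  obtain ⟨F, hF, hF'⟩ := ha x
  refine ⟨-F, neg_mem hF, fun g hg => ?_⟩
  rw [Pi.neg_apply, ← hF' g hg]
  exact ev_neg a.1 g x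

theorem HasWeight.sub {d : X → ℕ} {a b : Ghost X} (ha : HasWeight d a) (hb : HasWeight d b) :
    HasWeight d (a - b) := by
  rw [sub_eq_add_neg]; exact ha.add hb.neg

theorem HasWeight.mul {d e : X → ℕ} {a b : Ghost X} (ha : HasWeight d a) (hb : HasWeight e b) :
    HasWeight (fun x => d x + e x) (a * b) := by
  intro x
  obtain ⟨F, hF, hF'⟩ := ha x
  obtain ⟨E, hE, hE'⟩ := hb x
  refine ⟨F * E, reesPow_mul hF hE, fun g hg => ?_⟩
  rw [Pi.mul_apply, ← hF' g hg, ← hE' g hg]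
  exact ev_mul a.1 b.1 g x

theorem hasWeight_zero (d : X → ℕ) : HasWeight d (0 : Ghost X) := fun _ =>
  ⟨0, zero_mem _, fun _ _ => ev_zero _ _⟩

theorem hasWeight_one : HasWeight (fun _ => 0) (1 : Ghost X) := fun _ =>
  ⟨1, one_mem_reesPow, fun _ hg => ev_one hg⟩

variable [Finite G]

/-- Functions on a stabilizer lift to functions on `G` of the same weight. -/
theorem hasWeight_of_local {d : X → ℕ} {a : Ghost X}
    (h : ∀ x, (fun k : MulAction.stabilizer G x => ev a.1 k x) ∈
      reesPow (MulAction.stabilizer G x) (d x)) : HasWeight d a := by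
  intro x
  obtain ⟨F, hF, hF'⟩ := exists_reesPow_lift _ (h x)
  exact ⟨F, hF, fun g hg => (hF' ⟨g, hg⟩).symm⟩

/-- Induction respects weights. Over the orbit `K / H`, induction takes the restriction of `F` from
`K` to `H` to `∑ θ F`, where `θ` runs over the characters of `K / H`. -/
theorem HasWeight.ind (f : X →[G] Y) {d : Y → ℕ} {a : Ghost X}
    (ha : HasWeight (fun x => d (f x)) a) : HasWeight d (gInd f a) := by
  refine hasWeight_of_local fun y => ?_
  set K := MulAction.stabilizer G y with hK
  choose F hF hF' using ha
  have e1 : (fun k : K => ev (gInd f a).1 k y) =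
      ∑ o ∈ classesIn (MulAction.orbitRel K X) (fun x => f x = y),
        ∑ θ : (K ⧸ (MulAction.stabilizer G o.out).subgroupOf K) →* ℂˣ,
          (fun k : K => Polynomial.monomial 0 ((θ.comp (QuotientGroup.mk' _) k : ℂˣ) : ℂ)) *
            fun k : K => F o.out k := by
    funext k
    have hk : (k : G) • y = y := k.2
    rw [ev_gInd _ _ hk, Finset.sum_apply]
    rw [sum_eq_sum_classesIn_nsmul (MulAction.orbitRel K X) (fun x => f x = y)
      (fun x => ev a.1 k x) (fun x x' h => map_eq_of_orbitRel f h)]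
    · refine Finset.sum_congr rfl fun o _ => ?_
      rw [card_orbit, Finset.sum_apply]
      simp only [Pi.mul_apply]
      rw [← Finset.sum_mul, ← map_sum]
      simp only [MonoidHom.comp_apply, sum_char_apply, QuotientGroup.mk'_apply,
        QuotientGroup.eq_one_iff, Subgroup.mem_subgroupOf, MulAction.mem_stabilizer_iff]
      by_cases hko : (k : G) • o.out = o.out
      · rw [if_pos hko, hF' _ _ hko, nsmul_eq_mul]
        congr 1
      · rw [if_neg hko, ev_of_not_fixed _ hko]; simp
    · intro x x' h _
      obtain ⟨l, rfl⟩ := orbitRel_iff.1 h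
      rw [ev_smul]
  rw [e1]
  refine sum_mem fun o ho => sum_mem fun θ _ => ?_
  rw [mem_classesIn] at ho
  have h1 := reesPow_mul (monomial_mem_reesPow (n := 0) (d := 0) (char_mem_augPow
    (θ.comp (QuotientGroup.mk' _)))) (reesPow_comp K.subtype (hF o.out))
  rw [zero_add] at h1
  change _ ∈ reesPow K (d (f o.out)) at h1
  rw [ho] at h1
  exact h1

/-- The norm of a ghost given over each orbit by an admissible function `β`: over `y`, with
stabilizer `K`, it is the product over the orbits of `K` on the fibre of the norms of `β`. -/
theorem hasWeight_gNorm_of_admissible (f : X →[G] Y) (d : X → ℕ) (hd : ∀ (g : G) x, d (g • x) = d x)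
    (β : X → G → Polynomial ℂ) (hβ : ∀ (g : G) x, β (g • x) = β x)
    (hadm : ∀ x, Admissible (d x) (β x)) (b : Ghost X)
    (hb : ∀ g x, g • x = x → ev b.1 g x = β x g) :
    HasWeight (fun y => ∑ x with f x = y, d x) (gNorm f b) := by
  refine hasWeight_of_local fun y => ?_
  set K := MulAction.stabilizer G y with hK
  have e1 : (fun k : K => ev (gNorm f b).1 k y) =
      ∏ o ∈ classesIn (MulAction.orbitRel K X) (fun x => f x = y),
        orbitNorm K (MulAction.stabilizer G o.out) (β o.out) := by
    funext k
    have hk : (k : G) • y = y := k.2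
    rw [ev_gNorm _ _ hk, Finset.prod_apply]
    have hfib := prod_classesIn_fiberwise (cycleRel (k : G) X) (MulAction.orbitRel K X) (fun x => x)
      (fun x => f x = y) (cycleValue b.1 k) (fun x x' h => map_eq_of_orbitRel f h)
    beta_reduce at hfib
    rw [← hfib]
    refine Finset.prod_congr rfl fun o _ => ?_
    obtain ⟨x₀, hx₀⟩ : ∃ x₀, o.out = x₀ := ⟨_, rfl⟩
    rw [hx₀]
    have hper : ∀ x, MulAction.orbitRel K X x x₀ →
        MulAction.period (k : G) x = MulAction.period (k : G) x₀ := by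
      intro x hx
      obtain ⟨l, rfl⟩ := orbitRel_iff.1 hx
      exact period_smul _ _ _
    have hval : ∀ x, MulAction.orbitRel K X x x₀ → cycleValue b.1 k x =
        Polynomial.expand ℂ (MulAction.period (k : G) x₀)
          (β x₀ ((k : G) ^ MulAction.period (k : G) x₀)) := by
      intro x hx
      rw [cycleValue_eq _ _ _ (hper x hx), hb]
      · obtain ⟨l, rfl⟩ := orbitRel_iff.1 hx
        rw [hβ]
      · rw [← hper x hx, MulAction.pow_period_smul]
    rw [Finset.prod_congr rfl fun o' ho' => hval _ (mem_classesIn.1 ho'), Finset.prod_const]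
    unfold orbitNorm
    rw [← period_eq_orderOf, ← card_orbit]
    congr 1
    refine (Nat.div_eq_of_eq_mul_left (period_pos _ _) ?_).symm
    have h := sum_eq_sum_classesIn_nsmul (cycleRel (k : G) X)
      (fun x => MulAction.orbitRel K X x x₀) (fun _ => 1)
      (fun x x' h hx => (MulAction.orbitRel K X).trans
        ((MulAction.orbitRel K X).symm (cycleRel_le_orbitRel k h)) hx) fun x x' h _ => rfl
    simp only [card_cycle, smul_eq_mul, mul_one] at h
    rw [Finset.sum_congr rfl fun o' ho' => hper _ (mem_classesIn.1 ho'), Finset.sum_const,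
      Finset.sum_const, smul_eq_mul, smul_eq_mul, mul_one] at h
    rw [← h]
    congr 1
    ext x
    simp only [Finset.mem_filter, Finset.mem_univ, true_and]
    exact ⟨fun h => (MulAction.orbitRel K X).symm h, fun h => (MulAction.orbitRel K X).symm h⟩
  have e2 : ∑ x with f x = y, d x = ∑ o ∈ classesIn (MulAction.orbitRel K X) (fun x => f x = y),
      d o.out * Nat.card (K ⧸ (MulAction.stabilizer G o.out).subgroupOf K) := by
    rw [sum_eq_sum_classesIn_nsmul (MulAction.orbitRel K X) (fun x => f x = y) d
      (fun x x' h => map_eq_of_orbitRel f h)]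
    · refine Finset.sum_congr rfl fun o _ => ?_
      rw [card_orbit, smul_eq_mul, mul_comm]
    · intro x x' h _
      obtain ⟨l, rfl⟩ := orbitRel_iff.1 h
      exact hd _ _
  rw [e1, e2]
  exact reesPow_prod _ _ _ fun o _ => hadm _ _ _

/-- The product of a `G`-set with a set of `M` elements with trivial action. -/
def copies (X : FinGSet G) (M : ℕ) : FinGSet G where
  carrier := X × Fin M
  mulAction :=
    { smul := fun g z => (g • z.1, z.2)
      one_smul := fun z => Prod.ext (one_smul G z.1) rfl
      mul_smul := fun g h z => Prod.ext (mul_smul g h z.1) rfl }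

/-- The projection of the copies of `X` to `X`. -/
def copies.fst (X : FinGSet G) (M : ℕ) : copies X M →[G] X :=
  ⟨fun z => Prod.fst z, fun _ _ => rfl⟩

/-- Every ghost of weight `d` is induced from a ghost given over each orbit by an admissible
function of weight `d`. -/
theorem exists_admissible_decomposition {d : X → ℕ} (hd : ∀ (g : G) x, d (g • x) = d x)
    {a : Ghost X} (ha : HasWeight d a) :
    ∃ (M : ℕ) (β : copies X M → G → Polynomial ℂ) (b : Ghost (copies X M)),
      (∀ (g : G) z, β (g • z) = β z) ∧ (∀ z, Admissible (d (copies.fst X M z)) (β z)) ∧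
      (∀ g z, g • z = z → ev b.1 g z = β z g) ∧ gInd (copies.fst X M) b = a := by
  have h1 : ∀ x, ∃ l : List (G → Polynomial ℂ), (∀ β ∈ l, Admissible (d x) β) ∧
      ∀ g : G, g • x = x → ev a.1 g x = (l.map fun β => β g).sum := by
    intro x
    obtain ⟨F, hF, hF'⟩ := ha x
    obtain ⟨l, hl, hl'⟩ := exists_admissible_list (⊤ : Subgroup G)
      (reesPow_comp (⊤ : Subgroup G).subtype hF)
    exact ⟨l, hl, fun g hg => by rw [hF' g hg]; exact hl' ⟨g, trivial⟩⟩
  choose l hl hl' using h1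
  -- use the same functions for all points of an orbit
  set rep : X → X := fun x => (Quotient.mk (MulAction.orbitRel G X) x).out with hrep
  have hrep_smul : ∀ (g : G) x, rep (g • x) = rep x := by
    intro g x
    have : Quotient.mk (MulAction.orbitRel G X) (g • x) = Quotient.mk (MulAction.orbitRel G X) x :=
      Quotient.sound ⟨g, rfl⟩
    simp only [hrep, this]
  have hrep_orbit : ∀ x, ∃ g : G, g • x = rep x := fun x =>
    Quotient.mk_out (s := MulAction.orbitRel G X) x
  have hd_rep : ∀ x, d (rep x) = d x := fun x => by
    obtain ⟨g, hg⟩ := hrep_orbit x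
    rw [← hg, hd]
  set M := (Finset.univ : Finset X).sup fun x => (l x).length with hM
  have hlen : ∀ x, (l x).length ≤ M := fun x =>
    Finset.le_sup (f := fun x => (l x).length) (Finset.mem_univ x)
  set β : copies X M → G → Polynomial ℂ := fun z => (l (rep z.1)).getD z.2 0 with hβ
  have hβ_smul : ∀ (g : G) z, β (g • z) = β z := fun g z => by
    simp only [hβ]
    rw [← hrep_smul g z.1]; rfl
  let b : Ghost (copies X M) := ⟨fun t => β t.1.2 t.1.1, fun g h z _ _ => by
    change β (h • z) g = β z g
    rw [hβ_smul]⟩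
  have hb : ∀ g z, g • z = z → ev b.1 g z = β z g := fun g z hz => ev_of_fixed _ hz
  refine ⟨M, β, b, hβ_smul, fun z => ?_, hb, ghost_ext fun g x hx => ?_⟩
  · change Admissible (d z.1) _
    rw [← hd_rep]
    by_cases h : (z.2 : ℕ) < (l (rep z.1)).length
    · simp only [hβ, List.getD_eq_getElem _ _ h]
      exact hl _ _ (List.getElem_mem h)
    · simp only [hβ, List.getD_eq_default _ _ (not_lt.1 h)]
      exact admissible_zero _
  · rw [ev_gInd _ _ hx]
    have e1 : ∑ z : copies X M with copies.fst X M z = x, ev b.1 g z =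
        ∑ j : Fin M, β (x, j) g := by
      refine Finset.sum_bij' (fun z _ => Prod.snd z) (fun j _ => ((x, j) : X × Fin M))
        ?_ ?_ ?_ ?_ ?_
      · intro z _; exact Finset.mem_univ _
      · intro j _; exact Finset.mem_filter.2 ⟨Finset.mem_univ _, rfl⟩
      · intro z hz; exact Prod.ext (Finset.mem_filter.1 hz).2.symm rfl
      · intro j _; rfl
      · intro z hz
        obtain rfl : z.1 = x := (Finset.mem_filter.1 hz).2
        exact hb g z (Prod.ext hx rfl)
    rw [e1]
    obtain ⟨h, hh⟩ := hrep_orbit x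
    have hgr : g • rep x = rep x := by rw [← hh, fixed_smul_iff, hx]
    rw [← ev_smul a g h x, hh, hl' _ g hgr]
    simp only [hβ]
    rw [Fin.sum_univ_eq_sum_range (fun j => (l (rep x)).getD j 0 g) M]
    rw [← Finset.sum_subset (Finset.range_subset_range.2 (hlen (rep x)))]
    · exact sum_range_getD (l (rep x)) g
    · intro j _ hj
      rw [Finset.mem_range, not_lt] at hj
      rw [List.getD_eq_default _ _ hj]; rfl

/-- The norm takes ghosts of weight `d` to ghosts of weight the sum of `d` over the fibres. By the
exponential formula the norm is induced from the norm of an admissible ghost. -/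
theorem HasWeight.norm (f : X →[G] Y) {d : X → ℕ} (hd : ∀ (g : G) x, d (g • x) = d x)
    {a : Ghost X} (ha : HasWeight d a) :
    HasWeight (fun y => ∑ x with f x = y, d x) (gNorm f a) := by
  obtain ⟨M, β, b, h1, h2, h3, rfl⟩ := exists_admissible_decomposition hd ha
  set p := copies.fst X M
  rw [gNorm_gInd_eval]
  refine HasWeight.ind _ ?_
  set snd := fibreProd.snd f (depProd.proj p f)
  set e := depProd.eval p f
  have key := hasWeight_gNorm_of_admissible snd (fun w => d (p (e w)))
    (fun g w => by rw [map_smul, map_smul, hd]) (fun w => β (e w))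
    (fun g w => by rw [map_smul, h1]) (fun w => h2 _) (gRes e b) (fun g w hw => by
      rw [ev_gRes _ _ hw]
      exact h3 _ _ (by rw [← map_smul, hw]))
  refine key.mono fun s => le_of_eq ?_
  symm
  have hpe : ∀ w, p (e w) = fibreProd.fst f (depProd.proj p f) w := fun w =>
    Sections.sec_spec w.1.2 ⟨w.1.1, w.2⟩
  refine Finset.sum_bij' (fun w _ => fibreProd.fst f (depProd.proj p f) w)
    (fun x hx => ⟨(x, s), (Finset.mem_filter.1 hx).2⟩) ?_ ?_ ?_ ?_ ?_
  · intro w hw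
    refine Finset.mem_filter.2 ⟨Finset.mem_univ _, ?_⟩
    rw [← (Finset.mem_filter.1 hw).2]
    exact w.2
  · intro x hx
    exact Finset.mem_filter.2 ⟨Finset.mem_univ _, rfl⟩
  · intro w hw
    exact Subtype.ext (Prod.ext rfl (Finset.mem_filter.1 hw).2.symm)
  · intro x hx; rfl
  · intro w _; rw [hpe]

/-- The fold map of the disjoint union of two copies of `X`. -/
def fold (X : FinGSet G) : X.sum X →[G] X := ⟨Sum.elim id id, by rintro g (x | x) <;> rfl⟩

/-- The norm descends to the associated graded rings: changing a ghost by one of weight one changes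
its norm by a ghost of weight one. In the exponential formula for the norm of `a + b`, the sections
that meet the second summand have positive weight, and the others contribute the norm of `a`. -/
theorem hasWeight_gNorm_add_sub (f : X →[G] Y) {a b : Ghost X} (ha : HasWeight (fun _ => 0) a)
    (hb : HasWeight (fun _ => 1) b) : HasWeight (fun _ => 1) (gNorm f (a + b) - gNorm f a) := by
  set p := fold X
  set δ : X.sum X → ℕ := Sum.elim (fun _ => 0) (fun _ => 1) with hδ
  have hδ_smul : ∀ (g : G) w, δ (g • w) = δ w := by rintro g (x | x) <;> rfl
  have hl : HasWeight δ (gInd (inl X X) a) := HasWeight.ind _ ha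
  have hr : HasWeight δ (gInd (inr X X) b) := HasWeight.ind _ hb
  have hpl : ∀ a, gInd p (gInd (inl X X) a) = a := fun a => by
    rw [← gInd_comp]; exact gInd_id a
  have hpr : ∀ a, gInd p (gInd (inr X X) a) = a := fun a => by
    rw [← gInd_comp]; exact gInd_id a
  have hab : a + b = gInd p (gInd (inl X X) a + gInd (inr X X) b) := by
    rw [map_add, hpl, hpr]
  set c := gInd (inl X X) a + gInd (inr X X) b with hc
  set c₀ := gInd (inl X X) a with hc₀
  have hcw : HasWeight δ c := hl.add hr
  have hcc : gRes (inl X X) c = gRes (inl X X) c₀ := by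
    rw [hc, map_add, gRes_gInd_of_disjoint fun y x => (inl_ne_inr x y).symm, add_zero]
  have ha₀ : gNorm f a = gNorm f (gInd p c₀) := by rw [hpl]
  rw [hab, ha₀]
  rw [gNorm_gInd_eval, gNorm_gInd_eval, ← map_sub]
  refine HasWeight.ind _ fun s => ?_
  set snd := fibreProd.snd f (depProd.proj p f)
  set e := depProd.eval p f
  -- if `s` meets the second summand, both norms have weight one at `s`; if not, they agree at `s`
  by_cases hs : ∃ w, snd w = s ∧ δ (e w) = 1
  · obtain ⟨w, hw, hw'⟩ := hs
    have h1 := ((hcw.res e).norm snd fun g w => by rw [map_smul, hδ_smul]).sub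
      ((hl.res e).norm snd fun g w => by rw [map_smul, hδ_smul])
    obtain ⟨F, hF, hF'⟩ := h1 s
    refine ⟨F, reesPow_antitone ?_ hF, hF'⟩
    have : δ (e w) ≤ ∑ w with snd w = s, δ (e w) :=
      Finset.single_le_sum (f := fun w => δ (e w)) (fun _ _ => Nat.zero_le _)
        (Finset.mem_filter.2 ⟨Finset.mem_univ _, hw⟩)
    rwa [hw'] at this
  · refine ⟨0, zero_mem _, fun g hg => ?_⟩
    change ev ((gNorm snd (gRes e c)).1 - (gNorm snd (gRes e c₀)).1) g s = 0
    rw [ev_sub, sub_eq_zero, ev_gNorm _ _ hg, ev_gNorm _ _ hg]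
    refine Finset.prod_congr rfl fun o ho => ?_
    rw [mem_classesIn] at ho
    unfold cycleValue
    rw [ev_gRes _ _ (MulAction.pow_period_smul _ _), ev_gRes _ _ (MulAction.pow_period_smul _ _)]
    have hfix : g ^ MulAction.period g o.out • e o.out = e o.out := by
      rw [← map_smul, MulAction.pow_period_smul]
    rcases hw : e o.out with x | x
    · rw [hw] at hfix
      have hx : g ^ MulAction.period g o.out • x = x := Sum.inl_injective hfix
      have := congrArg (fun c => ev c.1 (g ^ MulAction.period g o.out) x) hcc
      simp only [ev_gRes _ _ hx] at this
      congr 1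
    · exact absurd ⟨o.out, ho, by rw [hw]; rfl⟩ hs

end Weights

/-! ### Characters of bundles -/

section BundleCharacters

open FinGSet

variable {G : Type u} [CommGroup G] {X Y : FinGSet G}

theorem Bundle.map_congr (V : Bundle X) {g g' : G} (hg : g = g') {x y : X} (h : g • x = y)
    (h' : g' • x = y) : V.map g x y h = V.map g' x y h' := by
  subst hg; rfl

theorem Bundle.map_comp (V : Bundle X) {g g' : G} {x y z : X} (h : g' • x = y) (h' : g • y = z)
    (h'' : (g * g') • x = z) : V.map g y z h' ∘ₗ V.map g' x y h = V.map (g * g') x z h'' :=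
  (LinearMap.ext (V.map_mul g g' x y z h h' h'')).symm

theorem Bundle.map_eq_id (V : Bundle X) {g : G} (hg : g = 1) {x : X} (h : g • x = x) :
    V.map g x x h = LinearMap.id := by
  subst hg; exact LinearMap.ext (V.map_one x h)

/-- The isomorphism of fibres given by an element of the group. -/
def Bundle.mapEquiv (V : Bundle X) (g : G) {x y : X} (h : g • x = y) : V.fib x ≃ₗ[ℂ] V.fib y :=
  LinearEquiv.ofLinearMap (V.map g x y h) (V.map g⁻¹ y x (by rw [← h, inv_smul_smul]))
    (by rw [V.map_comp _ _ (by rw [mul_inv_cancel, one_smul]), V.map_eq_id (mul_inv_cancel g)])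
    (by rw [V.map_comp _ _ (by rw [inv_mul_cancel, one_smul]), V.map_eq_id (inv_mul_cancel g)])

theorem Bundle.character_smul (V : Bundle X) (g h : G) (x : X) (hx : g • x = x)
    (hx' : g • h • x = h • x) :
    V.character ⟨(g, h • x), hx'⟩ = V.character ⟨(g, x), hx⟩ := by
  change LinearMap.trace ℂ _ (V.map g (h • x) (h • x) hx') = LinearMap.trace ℂ _ (V.map g x x hx)
  have h1 : (h⁻¹ * g) • h • x = x := by rw [mul_smul, hx', inv_smul_smul]
  have e1 := V.map_comp h1 (rfl : h • x = h • x) (by rw [mul_smul, h1])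
  have e2 := V.map_comp (rfl : h • x = h • x) h1 (by rw [mul_smul, h1])
  rw [V.map_congr (show g = h * (h⁻¹ * g) by simp) hx' (by rw [mul_smul, h1]), ← e1,
    LinearMap.trace_comp_comm', e2,
    V.map_congr (show h⁻¹ * g * h = g by rw [mul_right_comm, inv_mul_cancel, one_mul]) _ hx]

theorem character_pullback (f : X →[G] Y) (V : Bundle Y) {g : G} {x : X} (hx : g • x = x) :
    ev (V.pullback f).character g x = ev V.character g (f x) := by
  rw [ev_of_fixed _ hx, ev_of_fixed _ (by rw [← map_smul, hx])]; rfl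

theorem trace_pi {ι : Type*} [Fintype ι] [DecidableEq ι] {M : ι → Type*} [∀ i, AddCommGroup (M i)]
    [∀ i, Module ℂ (M i)] [∀ i, FiniteDimensional ℂ (M i)] (L : (∀ i, M i) →ₗ[ℂ] ∀ i, M i) :
    LinearMap.trace ℂ _ L =
      ∑ i, LinearMap.trace ℂ (M i) (LinearMap.proj i ∘ₗ L ∘ₗ LinearMap.single ℂ M i) := by
  set b := fun i => Module.finBasis ℂ (M i)
  rw [LinearMap.trace_eq_matrix_trace ℂ (Pi.basis b), Matrix.trace, Fintype.sum_sigma]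
  refine Finset.sum_congr rfl fun i _ => ?_
  rw [LinearMap.trace_eq_matrix_trace ℂ (b i), Matrix.trace]
  refine Finset.sum_congr rfl fun j _ => ?_
  rw [Matrix.diag_apply, LinearMap.toMatrix_apply, Matrix.diag_apply, LinearMap.toMatrix_apply,
    Pi.basis_repr, Pi.basis_apply]
  rfl

theorem character_pushforward (f : X →[G] Y) (V : Bundle X) {g : G} {y : Y} (hy : g • y = y) :
    ev (V.pushforward f).character g y = ∑ x : X with f x = y, ev V.character g x := by
  rw [ev_of_fixed _ hy]
  change LinearMap.trace ℂ (∀ x : {x : X // f x = y}, V.fib x.1) (Bundle.sumMap f V g hy) = _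
  rw [trace_pi, Finset.sum_subtype (Finset.univ.filter fun x => f x = y) (p := fun x => f x = y)
    (by simp)]
  refine Finset.sum_congr rfl fun x _ => ?_
  by_cases hx : g • x.1 = x.1
  · rw [ev_of_fixed _ hx]
    refine congrArg (LinearMap.trace ℂ _) (LinearMap.ext fun v => ?_)
    have key : ∀ (x' : {x : X // f x = y}) (h1 : g • x'.1 = x.1), x' = x →
        V.map g x'.1 x.1 h1 (Pi.single (M := fun x : {x : X // f x = y} => V.fib x.1) x v x') =
          V.map g x.1 x.1 hx v := by
      rintro x' h1 rfl
      rw [Pi.single_eq_same]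
    exact key ((Bundle.fibreEquiv f g hy).symm x) _
      (Subtype.ext (inv_smul_eq_iff.2 hx.symm))
  · rw [ev_of_not_fixed _ hx]
    refine (congrArg (LinearMap.trace ℂ _) (LinearMap.ext fun v => ?_)).trans (map_zero _)
    change Bundle.fibreMap f V g hy x (Pi.single (M := fun x : {x : X // f x = y} => V.fib x.1) x v
      ((Bundle.fibreEquiv f g hy).symm x)) = 0
    rw [Pi.single_eq_of_ne, map_zero]
    intro h
    exact hx (inv_smul_eq_iff.1 (congrArg Subtype.val h)).symm

/-- The `G`-set of pairs of a point `x` and a natural number less than `n x`. -/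
def tower (n : X → ℕ) (hn : ∀ (g : G) x, n (g • x) = n x) : FinGSet G where
  carrier := {z : X × ℕ // z.2 < n z.1}
  mulAction :=
    { smul := fun g z => ⟨(g • z.1.1, z.1.2), (hn g z.1.1).symm ▸ z.2⟩
      one_smul := fun z => Subtype.ext (Prod.ext (one_smul G z.1.1) rfl)
      mul_smul := fun g h z => Subtype.ext (Prod.ext (mul_smul g h z.1.1) rfl) }
  finite := Finite.of_injective (β := Σ x : X, Fin (n x)) (fun z => ⟨z.1.1, ⟨z.1.2, z.2⟩⟩) (by
    rintro ⟨⟨x, i⟩, hi⟩ ⟨⟨x', i'⟩, hi'⟩ h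
    obtain ⟨rfl, h⟩ := Sigma.mk.inj_iff.1 h
    obtain rfl := Fin.mk.inj_iff.1 (eq_of_heq h)
    rfl)

/-- The projection of the pairs to their first entry. -/
def tower.fst (n : X → ℕ) (hn : ∀ (g : G) x, n (g • x) = n x) : tower n hn →[G] X :=
  ⟨fun z => z.1.1, fun _ _ => rfl⟩

/-- A bundle has bases of its fibres that are permuted by the group up to scalars given by
characters: for a suitable `G`-set `Z` over `X` it is induced from a line bundle over `Z` on which
`G` acts by the character `χ z` over the orbit of `z`. -/
theorem exists_monomial_basis [Finite G] (V : Bundle X) :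
    ∃ (Z : FinGSet G) (p : Z →[G] X) (χ : Z → G →* ℂˣ)
      (b : ∀ x, Module.Basis {z : Z // p z = x} ℂ (V.fib x)), (∀ (g : G) z, χ (g • z) = χ z) ∧
      ∀ (g : G) (x y : X) (h : g • x = y) (z : {z : Z // p z = x}),
        V.map g x y h (b x z) =
          (χ z.1 g : ℂ) • b y ⟨g • z.1, by rw [map_smul, z.2, h]⟩ := by
  have h1 : ∀ r, ∃ (E : Module.Basis (Fin (Module.finrank ℂ (V.fib r))) ℂ (V.fib r))
      (χ : Fin (Module.finrank ℂ (V.fib r)) → G →* ℂˣ), ∀ (g : G) (h : g • r = r) i,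
        V.map g r r h (E i) = (χ i g : ℂ) • E i := by
    intro r
    obtain ⟨E, χ, hE⟩ := exists_eigenbasis (V.fibreRep r).ρ
    choose ψ hψ using fun i => exists_char_extension _ (χ i)
    refine ⟨E, ψ, fun g h i => ?_⟩
    have := hE ⟨g, h⟩ i
    rw [← hψ i ⟨g, h⟩] at this
    exact this
  choose E ψ hE using h1
  set rep : X → X := fun x => (Quotient.mk (MulAction.orbitRel G X) x).out with hrep
  have hrep_smul : ∀ (g : G) x, rep (g • x) = rep x := by
    intro g x
    have : Quotient.mk (MulAction.orbitRel G X) (g • x) = Quotient.mk (MulAction.orbitRel G X) x :=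
      Quotient.sound ⟨g, rfl⟩
    simp only [hrep, this]
  have hrep_orbit : ∀ x, ∃ g : G, g • rep x = x := fun x =>
    (MulAction.orbitRel G X).symm (Quotient.mk_out (s := MulAction.orbitRel G X) x)
  choose t ht using hrep_orbit
  -- the basis over `x` is the eigenbasis over `rep x` moved by `t x`, and scaled by `ψ (t x)⁻¹`
  -- so that the scalar by which `g` acts is `ψ g`, independent of the choice of `t`
  set n : X → ℕ := fun x => Module.finrank ℂ (V.fib (rep x)) with hn
  have hn_smul : ∀ (g : G) x, n (g • x) = n x := fun g x =>
    congrArg (fun r => Module.finrank ℂ (V.fib r)) (hrep_smul g x)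
  -- `rep (g • x) = rep x` holds only propositionally, so the two basis vectors are compared with
  -- the representatives as variables
  have key : ∀ (r r' : X), r' = r → ∀ (i : ℕ) (hi : i < Module.finrank ℂ (V.fib r))
      (hi' : i < Module.finrank ℂ (V.fib r')) (s s' g : G) (x y : X) (h : s • r = x)
      (h' : s' • r' = y) (hg : g • x = y),
      V.map g x y hg (((ψ r ⟨i, hi⟩ s)⁻¹ : ℂˣ) • V.map s r x h (E r ⟨i, hi⟩)) =
        (ψ r ⟨i, hi⟩ g : ℂ) • (((ψ r' ⟨i, hi'⟩ s')⁻¹ : ℂˣ) • V.map s' r' y h' (E r' ⟨i, hi'⟩)) := by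
    rintro _ r rfl i hi hi' s s' g x y h h' hg
    have h2 : (s'⁻¹ * (g * s)) • r = r := by
      rw [mul_smul, mul_smul, h, hg, ← h', inv_smul_smul]
    have h3 : V.map g x y hg (V.map s r x h (E r ⟨i, hi⟩)) =
        V.map s' r y h' (V.map (s'⁻¹ * (g * s)) r r h2 (E r ⟨i, hi⟩)) := by
      have h4 : (g * s) • r = y := by rw [mul_smul, h, hg]
      have h5 : (s' * (s'⁻¹ * (g * s))) • r = y := by rw [mul_smul, h2, h']
      rw [← V.map_mul g s r x y h hg h4, ← V.map_mul s' _ r r y h2 h' h5,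
        V.map_congr (mul_inv_cancel_left s' (g * s)).symm h4 h5]
    simp only [Units.smul_def]
    rw [map_smul, h3, hE, map_smul, smul_smul, smul_smul]
    congr 1
    rw [← Units.val_mul, ← Units.val_mul]
    congr 1
    rw [map_mul, map_mul, map_inv, mul_left_comm, mul_comm (ψ r ⟨i, hi⟩ g) (ψ r ⟨i, hi⟩ s),
      inv_mul_cancel_left, mul_comm]
  set Z : FinGSet G := tower n hn_smul
  set p : Z →[G] X := tower.fst n hn_smul
  let ε : ∀ x, Fin (n x) ≃ {z : Z // p z = x} := fun x =>
    { toFun := fun i => ⟨⟨(x, i.1), i.2⟩, rfl⟩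
      invFun := fun z => ⟨z.1.1.2, by
        obtain ⟨z, rfl⟩ := z
        exact z.2⟩
      left_inv := fun i => rfl
      right_inv := by rintro ⟨z, rfl⟩; rfl }
  let b : ∀ x, Module.Basis {z : Z // p z = x} ℂ (V.fib x) := fun x =>
    (((E (rep x)).map (V.mapEquiv (t x) (ht x))).unitsSMul
      fun i => (ψ (rep x) i (t x))⁻¹).reindex (ε x)
  have hb : ∀ x i (hi : i < n x), b x ⟨⟨(x, i), hi⟩, rfl⟩ =
      ((ψ (rep x) ⟨i, hi⟩ (t x))⁻¹ : ℂˣ) • V.map (t x) (rep x) x (ht x) (E (rep x) ⟨i, hi⟩) := by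
    intro x i hi
    simp only [b]
    rw [Module.Basis.reindex_apply, Module.Basis.unitsSMul_apply, Module.Basis.map_apply]
    rfl
  have hψ : ∀ (r r' : X), r' = r → ∀ (i : ℕ) (hi : i < Module.finrank ℂ (V.fib r))
      (hi' : i < Module.finrank ℂ (V.fib r')), ψ r' ⟨i, hi'⟩ = ψ r ⟨i, hi⟩ := by
    rintro _ r rfl i hi hi'; rfl
  refine ⟨Z, p, fun z => ψ (rep z.1.1) ⟨z.1.2, z.2⟩, b, fun g z => ?_, ?_⟩
  · exact hψ _ _ (hrep_smul g z.1.1) _ _ _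
  · rintro g x y rfl ⟨⟨⟨x', i⟩, hi⟩, hx⟩
    obtain rfl : x' = x := hx
    rw [hb]
    refine (key _ _ (hrep_smul g x') i hi
      (lt_of_lt_of_eq hi (hn_smul g x').symm) _ _ _ _ _ _ (ht _) _).trans ?_
    congr 1
    exact (hb (g • x') i _).symm

/-- Virtual bundles have invariant characters. -/
theorem KRing_invariant (v : KRing X) (g h : G) (x : X) (hx : g • x = x)
    (hx' : g • h • x = h • x) : v.1 ⟨(g, h • x), hx'⟩ = v.1 ⟨(g, x), hx⟩ := by
  obtain ⟨v, hv⟩ := v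
  refine AddSubgroup.closure_induction
    (p := fun (v : FixedPair X → ℂ) _ => v ⟨(g, h • x), hx'⟩ = v ⟨(g, x), hx⟩) ?_ ?_ ?_ ?_ hv
  · rintro _ ⟨V, rfl⟩
    exact V.character_smul g h x hx hx'
  · rfl
  · intro a b _ _ ha hb
    rw [Pi.add_apply, Pi.add_apply, ha, hb]
  · intro a _ ha
    rw [Pi.neg_apply, Pi.neg_apply, ha]

/-- The ghost `v tⁿ` of a virtual bundle `v`. -/
def degreeGhost (n : ℕ) : KRing X →+ Ghost X where
  toFun v := ⟨fun t => Polynomial.monomial n (v.1 t), fun g h x hx hx' =>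
    congrArg (Polynomial.monomial n) (KRing_invariant v g h x hx hx')⟩
  map_zero' := Subtype.ext (funext fun _ => map_zero _)
  map_add' _ _ := Subtype.ext (funext fun _ => map_add _ _ _)

theorem ev_degreeGhost (n : ℕ) (v : KRing X) (g : G) (x : X) :
    ev (degreeGhost n v).1 g x = Polynomial.monomial n (ev v.1 g x) := by
  by_cases hx : g • x = x
  · rw [ev_of_fixed _ hx, ev_of_fixed _ hx]; rfl
  · rw [ev_of_not_fixed _ hx, ev_of_not_fixed _ hx, map_zero]

theorem gRes_degreeGhost_cls (n : ℕ) (f : X →[G] Y) (V : Bundle Y) :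
    gRes f (degreeGhost n V.cls) = degreeGhost n (V.pullback f).cls := by
  refine ghost_ext fun g x hx => ?_
  rw [ev_gRes _ _ hx, ev_degreeGhost, ev_degreeGhost]
  exact congrArg _ (character_pullback f V hx).symm

theorem gInd_degreeGhost_cls (n : ℕ) (f : X →[G] Y) (V : Bundle X) :
    gInd f (degreeGhost n V.cls) = degreeGhost n (V.pushforward f).cls := by
  refine ghost_ext fun g y hy => ?_
  rw [ev_gInd _ _ hy, ev_degreeGhost]
  simp_rw [ev_degreeGhost]
  rw [← map_sum]
  exact congrArg _ (character_pushforward f V hy).symm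

/-- The character of a bundle of which `g` permutes bases of the fibres up to scalars. -/
theorem ev_character_of_monomial (V : Bundle X) {Z : FinGSet G} (p : Z →[G] X)
    (χ : Z → G →* ℂˣ) (b : ∀ x, Module.Basis {z : Z // p z = x} ℂ (V.fib x))
    (hb : ∀ (g : G) (x y : X) (h : g • x = y) (z : {z : Z // p z = x}),
      V.map g x y h (b x z) = (χ z.1 g : ℂ) • b y ⟨g • z.1, by rw [map_smul, z.2, h]⟩)
    {g : G} {x : X} (hx : g • x = x) :
    ev V.character g x = ∑ z : Z with p z = x, if g • z = z then (χ z g : ℂ) else 0 := by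
  rw [ev_of_fixed _ hx]
  change LinearMap.trace ℂ _ (V.map g x x hx) = _
  rw [trace_of_monomial (b x) _ (fun z => ⟨g • z.1, by rw [map_smul, z.2, hx]⟩)
    (fun z => (χ z.1 g : ℂ)) (hb g x x hx), Finset.sum_filter,
    Finset.sum_subtype (Finset.univ.filter fun z => p z = x) (p := fun z => p z = x) (by simp)]
  refine Finset.sum_congr rfl fun z _ => ?_
  simp only [Subtype.ext_iff]

/-- The character of the tensor induction of a bundle of which `g` permutes bases of the fibres up
to scalars: the basis vectors are permuted like the sections of `Z` over the fibre. -/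
theorem ev_character_tensorInd_of_monomial (f : X →[G] Y) (V : Bundle X) {Z : FinGSet G}
    (p : Z →[G] X) (χ : Z → G →* ℂˣ) (hχ : ∀ (g : G) z, χ (g • z) = χ z)
    (b : ∀ x, Module.Basis {z : Z // p z = x} ℂ (V.fib x))
    (hb : ∀ (g : G) (x y : X) (h : g • x = y) (z : {z : Z // p z = x}),
      V.map g x y h (b x z) = (χ z.1 g : ℂ) • b y ⟨g • z.1, by rw [map_smul, z.2, h]⟩)
    {g : G} {y : Y} (hy : g • y = y) :
    ev (V.tensorInd f).character g y =
      ∑ s : depProd p f with depProd.proj p f s = y, if g • s = s then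
        ∏ x : {x : X // f x = Sections.pt s}, (χ (Sections.sec s x) g : ℂ) else 0 := by
  rw [ev_of_fixed _ hy]
  change LinearMap.trace ℂ (⨂[ℂ] x : {x : X // f x = y}, V.fib x.1) (Bundle.tensorMap f V g hy) = _
  set ι := ∀ x : {x : X // f x = y}, {z : Z // p z = x.1}
  set σ := (Bundle.fibreEquiv f g hy).symm with hσ
  have hgσ : ∀ x, g • (σ x).1 = x.1 := fun x => smul_inv_smul g x.1
  set π : ι → ι := fun s x => ⟨g • (s (σ x)).1, by rw [map_smul, (s (σ x)).2, hgσ]⟩ with hπ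
  rw [trace_of_monomial (Basis.piTensorProduct fun x : {x : X // f x = y} => b x.1) _ π
    (fun s => ∏ x, (χ (s (σ x)).1 g : ℂ))]
  · rw [← Finset.sum_filter]
    refine Finset.sum_bij' (fun s _ => (⟨y, fun x => (s x).1, fun x => (s x).2⟩ : Sections p f))
      (fun t ht x => ⟨Sections.sec t ⟨x.1, x.2.trans
        (Finset.mem_filter.1 (Finset.mem_filter.1 ht).1).2.symm⟩, Sections.sec_spec t _⟩)
      ?_ ?_ ?_ ?_ ?_
    · intro s hs
      have hs : π s = s := (Finset.mem_filter.1 hs).2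
      refine Finset.mem_filter.2 ⟨Finset.mem_filter.2 ⟨Finset.mem_univ _, rfl⟩, ?_⟩
      refine Sections.ext_of hy fun x h1 h2 => ?_
      exact congrArg Subtype.val (congrFun hs ⟨x, h2⟩)
    · intro t ht
      obtain ⟨ht1, ht2⟩ := Finset.mem_filter.1 ht
      obtain rfl : Sections.pt t = y := (Finset.mem_filter.1 ht1).2
      refine Finset.mem_filter.2 ⟨Finset.mem_univ _, funext fun x => Subtype.ext ?_⟩
      have h1 : f x.1 = (g • t).pt := by rw [ht2]; exact x.2
      exact sec_eq_of_eq ht2 h1 x.2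
    · intro s _; rfl
    · intro t ht
      refine Sections.ext_of (Finset.mem_filter.1 (Finset.mem_filter.1 ht).1).2.symm
        fun x h1 h2 => rfl
    · intro s hs
      have hs : π s = s := (Finset.mem_filter.1 hs).2
      refine Finset.prod_congr rfl fun x _ => ?_
      have := congrArg Subtype.val (congrFun hs x)
      change (χ (s (σ x)).1 g : ℂ) = χ (s x).1 g
      rw [← this, hχ]
  · intro s
    rw [Basis.piTensorProduct_apply, Basis.piTensorProduct_apply, Bundle.tensorMap_tprod,
      ← MultilinearMap.map_smul_univ]
    congr 1
    funext x
    exact hb g _ _ _ _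

/-- The norm of the character of a bundle is the character of the tensor induction: both are the sum
over the fixed sections of `Z` of the products of the values of the characters `χ`. -/
theorem gNorm_degreeGhost_cls [Finite G] (f : X →[G] Y) (V : Bundle X) :
    gNorm f (degreeGhost 0 V.cls) = degreeGhost 0 (V.tensorInd f).cls := by
  obtain ⟨Z, p, χ, b, hχ, hb⟩ := exists_monomial_basis V
  let a : Ghost Z := ⟨fun t => Polynomial.C (χ t.1.2 t.1.1 : ℂ), fun g h z _ _ => by
    change Polynomial.C (χ (h • z) g : ℂ) = Polynomial.C (χ z g : ℂ)
    rw [hχ]⟩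
  have ha : ∀ (g : G) z, ev a.1 g z = if g • z = z then Polynomial.C (χ z g : ℂ) else 0 := by
    intro g z
    split_ifs with h
    · exact ev_of_fixed _ h
    · exact ev_of_not_fixed _ h
  have h1 : degreeGhost 0 V.cls = gInd p a := by
    refine ghost_ext fun g x hx => ?_
    rw [ev_gInd _ _ hx, ev_degreeGhost]
    change Polynomial.monomial 0 (ev V.character g x) = _
    rw [ev_character_of_monomial V p χ b hb hx, map_sum]
    refine Finset.sum_congr rfl fun z _ => ?_
    rw [ha]
    split_ifs
    · rfl
    · exact map_zero _
  rw [h1, gNorm_gInd_eval]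
  refine ghost_ext fun g y hy => ?_
  rw [ev_gInd _ _ hy, ev_degreeGhost]
  change _ = Polynomial.monomial 0 (ev (V.tensorInd f).character g y)
  rw [ev_character_tensorInd_of_monomial f V p χ hχ b hb hy, map_sum]
  refine Finset.sum_congr rfl fun s hs => ?_
  obtain rfl : Sections.pt s = y := (Finset.mem_filter.1 hs).2
  by_cases hgs : g • s = s
  · rw [if_pos hgs]
    set F : X → Polynomial ℂ := fun x => if h : f x = Sections.pt s then
      Polynomial.C (χ (Sections.sec s ⟨x, h⟩) g : ℂ) else 1 with hF
    have hFinv : ∀ x x', cycleRel g X x x' → F x = F x' := by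
      intro x x' h
      by_cases hx : f x = Sections.pt s
      · have hx' := map_eq_of_cycleRel f hy h hx
        obtain ⟨k, rfl⟩ := h
        simp only [hF]
        rw [dif_pos hx, dif_pos hx', sec_smul_of_fixed (zpow_smul_of_fixed hgs k) hx, hχ]
      · have hx' : f x' ≠ Sections.pt s := fun h' =>
          hx (map_eq_of_cycleRel f hy ((cycleRel g X).symm h) h')
        simp only [hF]
        rw [dif_neg hx, dif_neg hx']
    rw [ev_gNorm_gRes_eval p f a hgs (y := Sections.pt s) rfl fun x => F x ^ MulAction.period g x]
    · rw [← prod_fibre_eq_prod_cycles f hy F hFinv, Polynomial.monomial_zero_left, map_prod,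
        Finset.prod_subtype (Finset.univ.filter fun x => f x = Sections.pt s)
          (p := fun x => f x = Sections.pt s) (by simp)]
      refine Finset.prod_congr rfl fun x _ => ?_
      simp only [hF]
      rw [dif_pos x.2]
    · intro x hx
      have hfix : g ^ MulAction.period g x • Sections.sec s ⟨x, hx⟩ = Sections.sec s ⟨x, hx⟩ := by
        rw [← sec_smul_of_fixed (pow_smul_of_fixed hgs _) hx
          (by rw [MulAction.pow_period_smul]; exact hx)]
        exact Sections.sec_congr s (MulAction.pow_period_smul g x) _ _
      simp only [hF]
      rw [dif_pos hx, ha, if_pos hfix, Polynomial.expand_C, map_pow, Units.val_pow_eq_pow_val,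
        map_pow]
  · rw [if_neg hgs, ev_of_not_fixed _ hgs, map_zero]

end BundleCharacters

/-! ### Virtual bundles and ghosts of weight zero -/

section Coefficients

open FinGSet

variable {G : Type u} [CommGroup G] {X Y : FinGSet G}

/-- The line bundle over `X` on which `G` acts by a character. -/
def Bundle.line (X : FinGSet G) (χ : G →* ℂˣ) : Bundle X where
  fib _ := ℂ
  map g _ _ _ := (χ g : ℂ) • LinearMap.id
  map_one _ _ v := by simp
  map_mul g g' _ _ _ _ _ _ v := by
    simp [mul_assoc]

theorem character_line (χ : G →* ℂˣ) (t : FixedPair X) :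
    (Bundle.line X χ).character t = (χ t.1.1 : ℂ) := by
  change LinearMap.trace ℂ ℂ ((χ t.1.1 : ℂ) • LinearMap.id) = _
  rw [map_smul, LinearMap.trace_id]
  simp

/-- An orbit as a `G`-set. -/
def orbitSet (x : X) : FinGSet G := ⟨MulAction.orbit G x⟩

/-- The inclusion of an orbit. -/
def orbitSet.incl (x : X) : orbitSet x →[G] X := ⟨fun z => z.1, fun _ _ => rfl⟩

theorem indicator_orbit_mem_KRing (x : X) :
    (fun t : FixedPair X => if t.1.2 ∈ MulAction.orbit G x then (1 : ℂ) else 0) ∈ KRing X := by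
  have h := ((Bundle.triv (X := orbitSet x)).pushforward (orbitSet.incl x)).cls.2
  convert h using 1
  refine fixedPair_ext fun g y hy => ?_
  change _ = ev ((Bundle.triv (X := orbitSet x)).pushforward (orbitSet.incl x)).character g y
  rw [character_pushforward _ _ hy, ev_of_fixed _ hy]
  have h1 : ∀ z : orbitSet x, g • z = z → ev (Bundle.triv (X := orbitSet x)).character g z = 1 := by
    intro z hz
    rw [ev_of_fixed _ hz]
    change LinearMap.trace ℂ ℂ LinearMap.id = 1
    simp
  change (if y ∈ MulAction.orbit G x then (1 : ℂ) else 0) = _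
  split_ifs with hyx
  · set z₀ : orbitSet x := ⟨y, hyx⟩
    have h2 : (Finset.univ.filter fun z : orbitSet x => orbitSet.incl x z = y) = {z₀} := by
      ext z
      simp only [Finset.mem_filter, Finset.mem_univ, true_and, Finset.mem_singleton]
      exact ⟨fun h => Subtype.ext h, fun h => congrArg Subtype.val h⟩
    rw [h2, Finset.sum_singleton, h1]
    exact Subtype.ext hy
  · rw [Finset.sum_eq_zero]
    intro z hz
    refine absurd ?_ hyx
    rw [← (Finset.mem_filter.1 hz).2]
    exact z.2

/-- Virtual characters of `G` as virtual bundles over any `G`-set. -/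
theorem charFun_mem_KRing {F : G → ℂ} (hF : F ∈ augPow G 0) :
    (fun t : FixedPair X => F t.1.1) ∈ KRing X := by
  refine augPow_induction (p := fun F => (fun t : FixedPair X => F t.1.1) ∈ KRing X)
    ?_ (zero_mem _) (fun _ _ => add_mem) (fun _ => neg_mem) hF
  intro ψ l hl
  rw [List.length_eq_zero_iff.1 hl]
  convert (Bundle.line X ψ).cls.2 using 1
  funext t
  change (ψ t.1.1 : ℂ) * _ = (Bundle.line X ψ).character t
  rw [character_line, List.map_nil, List.prod_nil, mul_one]

/-- Invariant functions on fixed pairs that are virtual characters over each point are virtual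
bundles: they are sums over the orbits of a virtual character of `G` times the indicator function of
the orbit. -/
theorem mem_KRing_of_local {v : FixedPair X → ℂ}
    (hv : ∀ (g h : G) (x : X), ev v g (h • x) = ev v g x)
    (hloc : ∀ x, ∃ F ∈ augPow G 0, ∀ g : G, g • x = x → ev v g x = F g) : v ∈ KRing X := by
  choose F hF hF' using hloc
  have h1 : v = ∑ o : Quotient (MulAction.orbitRel G X), (fun t : FixedPair X => F o.out t.1.1) *
      fun t : FixedPair X => if t.1.2 ∈ MulAction.orbit G o.out then (1 : ℂ) else 0 := by
    funext t
    rw [Finset.sum_apply, Finset.sum_eq_single (Quotient.mk _ t.1.2)]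
    · have h2 : t.1.2 ∈ MulAction.orbit G
          (Quotient.mk (MulAction.orbitRel G X) t.1.2).out :=
        (MulAction.orbitRel G X).symm (Quotient.mk_out (s := MulAction.orbitRel G X) t.1.2)
      rw [Pi.mul_apply, if_pos h2, mul_one]
      obtain ⟨h, hh⟩ := h2
      have h3 := t.2
      rw [← hh, fixed_smul_iff] at h3
      rw [← hF' _ _ h3, ← hv _ h]
      dsimp only at hh
      rw [hh, ev_of_fixed _ t.2]
    · intro o _ ho
      rw [Pi.mul_apply, if_neg, mul_zero]
      intro h2
      refine ho ?_
      rw [← Quotient.out_eq o]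
      exact Quotient.sound ((MulAction.orbitRel G X).symm h2)
    · intro h; exact absurd (Finset.mem_univ _) h
  rw [h1]
  exact sum_mem fun o _ => mul_mem (charFun_mem_KRing (hF _)) (indicator_orbit_mem_KRing _)

theorem mem_KFiltration {n : ℕ} {v : KRing X} : v ∈ (KFiltration X).level n ↔
    ∀ x, fibreHom X x v ∈ (gammaFiltration (MulAction.stabilizer G x)).level n :=
  AddSubgroup.mem_iInf

/-- The norm of `v tⁿ` is the norm of `v`, times `t` to the power `n` times the size of the
fibre, because the lengths of the cycles add up to the size of the fibre. -/
theorem ev_gNorm_degreeGhost (f : X →[G] Y) (n : ℕ) (v : KRing X) {g : G} {y : Y}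
    (hy : g • y = y) : ev (gNorm f (degreeGhost n v)).1 g y =
      Polynomial.monomial (n * Nat.card {x : X // f x = y})
        (∏ o ∈ classesIn (cycleRel g X) (fun x => f x = y),
          ev v.1 (g ^ MulAction.period g o.out) o.out) := by
  have h1 : ∀ (s : Finset (Quotient (cycleRel g X))) (d : Quotient (cycleRel g X) → ℕ)
      (c : Quotient (cycleRel g X) → ℂ), ∏ o ∈ s, Polynomial.monomial (d o) (c o) =
        Polynomial.monomial (∑ o ∈ s, d o) (∏ o ∈ s, c o) := by
    intro s d c
    induction s using Finset.induction_on with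
    | empty => rfl
    | insert o s ho ih =>
      rw [Finset.prod_insert ho, Finset.prod_insert ho, Finset.sum_insert ho, ih,
        Polynomial.monomial_mul_monomial]
  rw [ev_gNorm _ _ hy, ← sum_period f hy, Finset.mul_sum, ← h1]
  refine Finset.prod_congr rfl fun o _ => ?_
  unfold cycleValue
  rw [ev_degreeGhost, Polynomial.expand_monomial]

variable [Finite G]

/-- The ghost `v tⁿ` has weight `d` exactly if `v ∈ Γⁿ⁺ᵈ`. -/
theorem hasWeight_degreeGhost_iff {n d : ℕ} {v : KRing X} :
    HasWeight (fun _ => d) (degreeGhost n v) ↔ v ∈ (KFiltration X).level (n + d) := by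
  rw [mem_KFiltration]
  constructor
  · intro h x
    obtain ⟨F, hF, hF'⟩ := h x
    rw [mem_gamma_iff]
    convert augPow_comp (MulAction.stabilizer G x).subtype (hF n) using 1
    funext k
    have hk : (k : G) • x = x := k.2
    have := congrArg (fun p => Polynomial.coeff p n) (hF' k hk)
    simp only [ev_degreeGhost, Polynomial.coeff_monomial, if_true] at this
    rw [ev_of_fixed _ hk] at this
    exact this
  · intro h
    refine hasWeight_of_local fun x => ?_
    convert monomial_mem_reesPow (mem_gamma_iff.1 (h x)) using 1
    funext k
    rw [ev_degreeGhost, ev_of_fixed _ k.2]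
    rfl

/-- The coefficient of degree `n` of a ghost of weight zero. -/
def coeffK (n : ℕ) (a : Ghost X) (ha : HasWeight (fun _ => 0) a) : KRing X :=
  ⟨fun t => (a.1 t).coeff n, by
    have h1 : ∀ (g : G) (x : X), ev (fun t => (a.1 t).coeff n) g x = (ev a.1 g x).coeff n := by
      intro g x
      by_cases hx : g • x = x
      · rw [ev_of_fixed _ hx, ev_of_fixed _ hx]
      · rw [ev_of_not_fixed _ hx, ev_of_not_fixed _ hx, Polynomial.coeff_zero]
    refine mem_KRing_of_local (fun g h x => ?_) fun x => ?_
    · rw [h1, h1, ev_smul]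
    · obtain ⟨F, hF, hF'⟩ := ha x
      refine ⟨_, augPow_antitone (Nat.zero_le _) (hF n), fun g hg => ?_⟩
      rw [h1, hF' g hg]⟩

theorem coeffK_mem {n d : ℕ} {a : Ghost X} (ha : HasWeight (fun _ => 0) a)
    (hd : HasWeight (fun _ => d) a) : coeffK n a ha ∈ (KFiltration X).level (n + d) := by
  rw [mem_KFiltration]
  intro x
  obtain ⟨F, hF, hF'⟩ := hd x
  rw [mem_gamma_iff]
  convert augPow_comp (MulAction.stabilizer G x).subtype (hF n) using 1
  funext k
  have hk : (k : G) • x = x := k.2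
  change (a.1 ⟨(k, x), hk⟩).coeff n = (F k).coeff n
  rw [← hF' k hk, ev_of_fixed _ hk]

theorem hasWeight_iff_coeffK {d : ℕ} {a : Ghost X} (ha : HasWeight (fun _ => 0) a) :
    HasWeight (fun _ => d) a ↔ ∀ n, coeffK n a ha ∈ (KFiltration X).level (n + d) := by
  refine ⟨fun h n => coeffK_mem ha h, fun h => hasWeight_of_local fun x n => ?_⟩
  convert mem_gamma_iff.1 (mem_KFiltration.1 (h n) x) using 1
  funext k
  change (ev a.1 k x).coeff n = _
  rw [ev_of_fixed _ k.2]
  rfl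

end Coefficients

/-! ### The Tambara functor of virtual bundles -/

section KTambara

open FinGSet

variable {G : Type u} [CommGroup G] {X Y : FinGSet G}

theorem exists_gRes_degreeGhost (f : X →[G] Y) (v : KRing Y) :
    ∃ w : KRing X, ∀ n, gRes f (degreeGhost n v) = degreeGhost n w := by
  obtain ⟨v, hv⟩ := v
  refine AddSubgroup.closure_induction (p := fun v hv => ∃ w : KRing X, ∀ n,
    gRes f (degreeGhost n ⟨v, hv⟩) = degreeGhost n w) ?_ ?_ ?_ ?_ hv
  · rintro _ ⟨V, rfl⟩
    exact ⟨(V.pullback f).cls, fun n => gRes_degreeGhost_cls n f V⟩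
  · exact ⟨0, fun n => by
      rw [map_zero, ← map_zero (gRes f), ← map_zero (degreeGhost n)]; rfl⟩
  · rintro a b ha hb ⟨w, hw⟩ ⟨w', hw'⟩
    refine ⟨w + w', fun n => ?_⟩
    rw [map_add, ← hw, ← hw', ← map_add, ← map_add]; rfl
  · rintro a ha ⟨w, hw⟩
    refine ⟨-w, fun n => ?_⟩
    rw [map_neg, ← hw, ← map_neg, ← map_neg]; rfl

theorem exists_gInd_degreeGhost (f : X →[G] Y) (v : KRing X) :
    ∃ w : KRing Y, ∀ n, gInd f (degreeGhost n v) = degreeGhost n w := by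
  obtain ⟨v, hv⟩ := v
  refine AddSubgroup.closure_induction (p := fun v hv => ∃ w : KRing Y, ∀ n,
    gInd f (degreeGhost n ⟨v, hv⟩) = degreeGhost n w) ?_ ?_ ?_ ?_ hv
  · rintro _ ⟨V, rfl⟩
    exact ⟨(V.pushforward f).cls, fun n => gInd_degreeGhost_cls n f V⟩
  · exact ⟨0, fun n => by
      rw [map_zero, ← map_zero (gInd f), ← map_zero (degreeGhost n)]; rfl⟩
  · rintro a b ha hb ⟨w, hw⟩ ⟨w', hw'⟩
    refine ⟨w + w', fun n => ?_⟩
    rw [map_add, ← hw, ← hw', ← map_add, ← map_add]; rfl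
  · rintro a ha ⟨w, hw⟩
    refine ⟨-w, fun n => ?_⟩
    rw [map_neg, ← hw, ← map_neg, ← map_neg]; rfl

theorem degreeGhost_injective (n : ℕ) : Function.Injective (degreeGhost (X := X) n) := by
  intro v w h
  refine Subtype.ext (funext fun t => ?_)
  have := congrArg (fun p => Polynomial.coeff p n) (congrFun (congrArg Subtype.val h) t)
  change (Polynomial.monomial n (v.1 t)).coeff n = (Polynomial.monomial n (w.1 t)).coeff n at this
  rwa [Polynomial.coeff_monomial_same, Polynomial.coeff_monomial_same] at this

theorem degreeGhost_mul (m n : ℕ) (v w : KRing X) :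
    degreeGhost m v * degreeGhost n w = degreeGhost (m + n) (v * w) :=
  Subtype.ext (funext fun _ => Polynomial.monomial_mul_monomial _ _ _ _)

/-- Virtual bundles as constant ghosts. -/
def constGhost (X : FinGSet G) : KRing X →+* Ghost X where
  __ := degreeGhost 0
  map_one' := rfl
  map_mul' v w := (degreeGhost_mul 0 0 v w).symm

theorem hasWeight_zero_mul {a b : Ghost X} (ha : HasWeight (fun _ => 0) a)
    (hb : HasWeight (fun _ => 0) b) : HasWeight (fun _ => 0) (a * b) :=
  HasWeight.mul (d := fun _ => 0) (e := fun _ => 0) ha hb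

variable [Finite G]

theorem mem_KFiltration_zero (v : KRing X) : v ∈ (KFiltration X).level 0 :=
  mem_KFiltration.2 fun x =>
    mem_gamma_iff.2 (mem_augPowClass.1 (charRing_le_augPow (fibreHom X x v)))

theorem hasWeight_degreeGhost {n : ℕ} {v : KRing X} (hv : v ∈ (KFiltration X).level n) :
    HasWeight (fun _ => 0) (degreeGhost n v) := hasWeight_degreeGhost_iff.2 hv

theorem HasWeight.norm_zero (f : X →[G] Y) {a : Ghost X} (ha : HasWeight (fun _ => 0) a) :
    HasWeight (fun _ => 0) (gNorm f a) :=
  (ha.norm f fun _ _ => rfl).mono fun _ => Nat.zero_le _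

/-- The norm of a virtual bundle; its constant ghost is the norm of the constant ghost. -/
def normK (f : X →[G] Y) (v : KRing X) : KRing Y :=
  coeffK 0 (gNorm f (degreeGhost 0 v))
    ((hasWeight_degreeGhost (mem_KFiltration_zero v)).norm_zero f)

theorem ev_normK (f : X →[G] Y) (v : KRing X) {g : G} {y : Y} (hy : g • y = y) :
    ev (normK f v).1 g y = ∏ o ∈ classesIn (cycleRel g X) (fun x => f x = y),
      ev v.1 (g ^ MulAction.period g o.out) o.out := by
  have h := ev_gNorm_degreeGhost f 0 v hy
  rw [ev_of_fixed _ hy] at h ⊢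
  refine (congrArg (fun p => Polynomial.coeff p 0) h).trans ?_
  rw [zero_mul, Polynomial.coeff_monomial_same]

theorem gNorm_degreeGhost_zero (f : X →[G] Y) (v : KRing X) :
    gNorm f (degreeGhost 0 v) = degreeGhost 0 (normK f v) := by
  refine ghost_ext fun g y hy => ?_
  rw [ev_gNorm_degreeGhost _ _ _ hy, ev_degreeGhost, ev_normK _ _ hy, zero_mul]

theorem gNorm_degreeGhost (f : X →[G] Y) {k : ℕ} (hk : ∀ y, Nat.card {x : X // f x = y} = k)
    (n : ℕ) (v : KRing X) : gNorm f (degreeGhost n v) = degreeGhost (n * k) (normK f v) := by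
  refine ghost_ext fun g y hy => ?_
  rw [ev_gNorm_degreeGhost _ _ _ hy, ev_degreeGhost, ev_normK _ _ hy, hk]

/-- Virtual bundles are the constant ghosts of weight zero. -/
def kSubquotient : GhostSubquotient (G := G) fun X => KRing X where
  sub X := (constGhost X).range
  proj X := (RingEquiv.ofBijective (constGhost X).rangeRestrict
    ⟨fun _ _ h => degreeGhost_injective 0 (congrArg Subtype.val h),
      (constGhost X).rangeRestrict_surjective⟩).symm.toRingHom
  proj_surjective X := RingEquiv.surjective _
  res_mem := by
    rintro X Y f _ ⟨v, rfl⟩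
    obtain ⟨w, hw⟩ := exists_gRes_degreeGhost f v
    exact ⟨w, (hw 0).symm⟩
  ind_mem := by
    rintro X Y f _ ⟨v, rfl⟩
    obtain ⟨w, hw⟩ := exists_gInd_degreeGhost f v
    exact ⟨w, (hw 0).symm⟩
  norm_mem := by
    rintro X Y f _ ⟨v, rfl⟩
    exact ⟨normK f v, (gNorm_degreeGhost_zero f v).symm⟩
  res_congr f a b h := by rw [RingEquiv.injective _ h]
  ind_congr f a b h := by rw [RingEquiv.injective _ h]
  norm_congr f a b h := by rw [RingEquiv.injective _ h]

theorem kSubquotient_proj (v : KRing X) (h : degreeGhost 0 v ∈ (kSubquotient (G := G)).sub X) :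
    (kSubquotient (G := G)).proj X ⟨degreeGhost 0 v, h⟩ = v :=
  (RingEquiv.symm_apply_eq _).2 rfl

theorem degreeGhost_zero_mem (v : KRing X) : degreeGhost 0 v ∈ (kSubquotient (G := G)).sub X :=
  ⟨v, rfl⟩

theorem degreeGhost_res (f : X →[G] Y) (n : ℕ) (v : KRing Y) :
    gRes f (degreeGhost n v) = degreeGhost n ((kSubquotient (G := G)).tambara.res f v) := by
  obtain ⟨w, hw⟩ := exists_gRes_degreeGhost f v
  rw [hw]
  congr 1
  have h := kSubquotient.res_proj f ⟨_, degreeGhost_zero_mem v⟩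
  rw [kSubquotient_proj] at h
  refine Eq.trans ?_ h.symm
  simp only [hw]
  rw [kSubquotient_proj]

theorem degreeGhost_ind (f : X →[G] Y) (n : ℕ) (v : KRing X) :
    gInd f (degreeGhost n v) = degreeGhost n ((kSubquotient (G := G)).tambara.ind f v) := by
  obtain ⟨w, hw⟩ := exists_gInd_degreeGhost f v
  rw [hw]
  congr 1
  have h := kSubquotient.ind_proj f ⟨_, degreeGhost_zero_mem v⟩
  rw [kSubquotient_proj] at h
  refine Eq.trans ?_ h.symm
  simp only [hw]
  rw [kSubquotient_proj]

theorem tambara_norm_eq (f : X →[G] Y) (v : KRing X) :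
    (kSubquotient (G := G)).tambara.norm f v = normK f v := by
  have h := kSubquotient.norm_proj f ⟨_, degreeGhost_zero_mem v⟩
  rw [kSubquotient_proj] at h
  refine Eq.trans h ?_
  simp only [gNorm_degreeGhost_zero]
  rw [kSubquotient_proj]

theorem extendsBundles_kSubquotient : ExtendsBundles (kSubquotient (G := G)).tambara where
  res f V := degreeGhost_injective 0
    ((degreeGhost_res f 0 V.cls).symm.trans (gRes_degreeGhost_cls 0 f V))
  ind f V := degreeGhost_injective 0
    ((degreeGhost_ind f 0 V.cls).symm.trans (gInd_degreeGhost_cls 0 f V))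
  norm f V := degreeGhost_injective 0 (by
    rw [tambara_norm_eq, ← gNorm_degreeGhost_zero, gNorm_degreeGhost_cls])

end KTambara

/-! ### The Tambara functor of graded character rings -/

section GradedTambara

open FinGSet

variable {G : Type u} [CommGroup G] [Finite G] {X Y : FinGSet G}

/-- The ring of ghosts of weight zero. -/
def weightZero (X : FinGSet G) : Subring (Ghost X) where
  carrier := {a | HasWeight (fun _ => 0) a}
  mul_mem' ha hb := HasWeight.mul (d := fun _ => 0) (e := fun _ => 0) ha hb
  one_mem' := hasWeight_one
  add_mem' ha hb := HasWeight.add ha hb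
  zero_mem' := hasWeight_zero _
  neg_mem' ha := HasWeight.neg ha

instance fintypeFixedPair (X : FinGSet G) : Fintype (FixedPair X) := Fintype.ofFinite _

/-- A bound for the degrees of the values of a ghost. -/
def degreeBound (a : Ghost X) : ℕ :=
  (Finset.univ.sup fun t => (a.1 t).natDegree) + 1

theorem coeffK_eq_zero {n : ℕ} {a : Ghost X} (ha : HasWeight (fun _ => 0) a)
    (hn : degreeBound a ≤ n) : coeffK n a ha = 0 := by
  refine Subtype.ext (funext fun t => Polynomial.coeff_eq_zero_of_natDegree_lt ?_)
  refine lt_of_lt_of_le (Nat.lt_succ_of_le ?_) hn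
  exact Finset.le_sup (f := fun t => (a.1 t).natDegree) (Finset.mem_univ t)

theorem sum_degreeGhost_coeffK {a : Ghost X} (ha : HasWeight (fun _ => 0) a) :
    ∑ n ∈ Finset.range (degreeBound a), degreeGhost n (coeffK n a ha) = a := by
  refine Subtype.ext (funext fun t => ?_)
  rw [AddSubmonoidClass.coe_finsetSum, Finset.sum_apply]
  refine (Polynomial.as_sum_range' (a.1 t) (degreeBound a) ?_).symm
  exact Nat.lt_succ_of_le
    (Finset.le_sup (f := fun t => (a.1 t).natDegree) (Finset.mem_univ t))

/-- Ghosts of weight zero are sums of ghosts `v tⁿ` with `v` in `Γⁿ`. -/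
theorem weightZero_induction {p : Ghost X → Prop} (zero : p 0) (add : ∀ a b, p a → p b → p (a + b))
    (mem : ∀ n, ∀ v ∈ (KFiltration X).level n, p (degreeGhost n v)) {a : Ghost X}
    (ha : HasWeight (fun _ => 0) a) : p a := by
  rw [← sum_degreeGhost_coeffK ha]
  refine Finset.sum_induction (fun n => degreeGhost n (coeffK n a ha)) p add zero fun n _ => ?_
  exact mem n _ (coeffK_mem (n := n) (d := 0) ha ha)

theorem coeffK_mem_level {a : Ghost X} (ha : HasWeight (fun _ => 0) a) (n : ℕ) :
    coeffK n a ha ∈ (KFiltration X).level n := coeffK_mem (n := n) (d := 0) ha ha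

/-- The class of a ghost `∑ₙ vₙ tⁿ` of weight zero in the graded ring: the sum of the classes of
the `vₙ` in degree `n`. -/
def gradedClass (a : Ghost X) (ha : HasWeight (fun _ => 0) a) : gradedK X :=
  DirectSum.mk (KFiltration X).piece (Finset.range (degreeBound a)) fun n =>
    (KFiltration X).pieceMk n (coeffK n a ha) (coeffK_mem_level ha n)

theorem gradedClass_apply {a : Ghost X} (ha : HasWeight (fun _ => 0) a) (n : ℕ) :
    gradedClass a ha n = (KFiltration X).pieceMk n (coeffK n a ha) (coeffK_mem_level ha n) := by
  by_cases h : n ∈ Finset.range (degreeBound a)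
  · exact DirectSum.mk_apply_of_mem h
  · refine (DirectSum.mk_apply_of_notMem h).trans ?_
    rw [Finset.mem_range, not_lt] at h
    rw [← MulFiltration.pieceMk_zero]
    exact MulFiltration.pieceMk_congr _ _ _ (coeffK_eq_zero ha h).symm

theorem gradedClass_add {a b : Ghost X} (ha : HasWeight (fun _ => 0) a)
    (hb : HasWeight (fun _ => 0) b) :
    gradedClass (a + b) (ha.add hb) = gradedClass a ha + gradedClass b hb := by
  refine DFinsupp.ext fun n => ?_
  change gradedClass (a + b) (ha.add hb) n = gradedClass a ha n + gradedClass b hb n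
  rw [gradedClass_apply, gradedClass_apply, gradedClass_apply, MulFiltration.pieceMk_add]
  exact MulFiltration.pieceMk_congr _ _ _
    (Subtype.ext (funext fun t => Polynomial.coeff_add _ _ _))

theorem gradedClass_degreeGhost {n : ℕ} {v : KRing X} (hv : v ∈ (KFiltration X).level n) :
    gradedClass (degreeGhost n v) (hasWeight_degreeGhost hv) = (KFiltration X).cls n v hv := by
  refine DFinsupp.ext fun m => ?_
  change gradedClass _ _ m = (KFiltration X).cls n v hv m
  rw [gradedClass_apply]
  unfold MulFiltration.cls
  by_cases h : n = m
  · subst h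
    rw [DirectSum.of_eq_same]
    exact MulFiltration.pieceMk_congr _ _ _
      (Subtype.ext (funext fun t => Polynomial.coeff_monomial_same n (v.1 t)))
  · rw [DirectSum.of_eq_of_ne _ _ _ (Ne.symm h), ← MulFiltration.pieceMk_zero]
    exact MulFiltration.pieceMk_congr _ _ _
      (Subtype.ext (funext fun t => Polynomial.coeff_monomial_of_ne (v.1 t) (Ne.symm h)))

theorem gradedClass_congr {a b : Ghost X} (h : a = b) (ha : HasWeight (fun _ => 0) a) :
    gradedClass a ha = gradedClass b (h ▸ ha) := by subst h; rfl

theorem gradedClass_zero : gradedClass (0 : Ghost X) (hasWeight_zero _) = 0 := by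
  have h := gradedClass_add (hasWeight_zero (X := X) fun _ => 0) (hasWeight_zero fun _ => 0)
  rw [gradedClass_congr (add_zero (0 : Ghost X))] at h
  exact left_eq_add.1 h

theorem gradedClass_mul {a b : Ghost X} (ha : HasWeight (fun _ => 0) a)
    (hb : HasWeight (fun _ => 0) b) :
    gradedClass (a * b) (hasWeight_zero_mul ha hb) = gradedClass a ha * gradedClass b hb := by
  suffices h : ∃ (h1 : HasWeight (fun _ => 0) a) (h2 : HasWeight (fun _ => 0) b)
      (h3 : HasWeight (fun _ => 0) (a * b)),
      gradedClass (a * b) h3 = gradedClass a h1 * gradedClass b h2 by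
    obtain ⟨_, _, _, h⟩ := h
    exact h
  refine weightZero_induction (p := fun a => ∃ (h1 : HasWeight (fun _ => 0) a)
    (h2 : HasWeight (fun _ => 0) b) (h3 : HasWeight (fun _ => 0) (a * b)),
      gradedClass (a * b) h3 = gradedClass a h1 * gradedClass b h2) ?_ ?_ ?_ ha
  · refine ⟨hasWeight_zero _, hb, hasWeight_zero_mul (hasWeight_zero _) hb, ?_⟩
    rw [gradedClass_congr (zero_mul b), gradedClass_zero, zero_mul]
  · rintro a a' ⟨h1, h2, h3, h⟩ ⟨h1', h2', h3', h'⟩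
    refine ⟨h1.add h1', hb, hasWeight_zero_mul (h1.add h1') hb, ?_⟩
    rw [gradedClass_congr (add_mul a a' b), gradedClass_add h3 h3', gradedClass_add h1 h1',
      add_mul, h, h']
  intro m v hv
  refine weightZero_induction (p := fun b => ∃ (h1 : HasWeight (fun _ => 0) (degreeGhost m v))
    (h2 : HasWeight (fun _ => 0) b) (h3 : HasWeight (fun _ => 0) (degreeGhost m v * b)),
      gradedClass (degreeGhost m v * b) h3 = gradedClass (degreeGhost m v) h1 * gradedClass b h2)
    ?_ ?_ ?_ hb
  · have h1 := hasWeight_degreeGhost hv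
    refine ⟨h1, hasWeight_zero _, hasWeight_zero_mul h1 (hasWeight_zero _), ?_⟩
    rw [gradedClass_congr (mul_zero _), gradedClass_zero, mul_zero]
  · rintro b b' ⟨h1, h2, h3, h⟩ ⟨h1', h2', h3', h'⟩
    refine ⟨h1, h2.add h2', hasWeight_zero_mul h1 (h2.add h2'), ?_⟩
    rw [gradedClass_congr (mul_add _ b b'), gradedClass_add h3 h3', gradedClass_add h2 h2',
      mul_add, h, h']
  · intro n w hw
    have h1 := hasWeight_degreeGhost hv
    have h2 := hasWeight_degreeGhost hw
    refine ⟨h1, h2, hasWeight_zero_mul h1 h2, ?_⟩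
    rw [gradedClass_congr (degreeGhost_mul m n v w), gradedClass_degreeGhost hv,
      gradedClass_degreeGhost hw,
      gradedClass_degreeGhost ((KFiltration X).mul_mem_level hv hw)]
    exact (DirectSum.of_mul_of (A := (KFiltration X).piece) ((KFiltration X).pieceMk m v hv)
      ((KFiltration X).pieceMk n w hw)).symm

/-- The passage from ghosts of weight zero to the graded ring. -/
def gradedProj (X : FinGSet G) : weightZero X →+* gradedK X where
  toFun a := gradedClass a.1 a.2
  map_one' := gradedClass_degreeGhost (KFiltration X).one_mem_level
  map_mul' a b := gradedClass_mul a.2 b.2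
  map_zero' := gradedClass_zero
  map_add' a b := gradedClass_add a.2 b.2

theorem gradedProj_degreeGhost {n : ℕ} {v : KRing X} (hv : v ∈ (KFiltration X).level n)
    (h : degreeGhost n v ∈ weightZero X) :
    gradedProj X ⟨degreeGhost n v, h⟩ = (KFiltration X).cls n v hv := gradedClass_degreeGhost hv

theorem gradedProj_surjective (X : FinGSet G) : Function.Surjective (gradedProj X) := by
  intro z
  induction z using DirectSum.induction_on with
  | zero => exact ⟨0, map_zero _⟩
  | of n z =>
    obtain ⟨v, hv, rfl⟩ := (KFiltration X).exists_pieceMk z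
    exact ⟨⟨_, hasWeight_degreeGhost hv⟩, gradedProj_degreeGhost hv _⟩
  | add x y hx hy =>
    obtain ⟨a, rfl⟩ := hx
    obtain ⟨b, rfl⟩ := hy
    exact ⟨a + b, map_add _ _ _⟩

/-- The ghosts of weight zero that vanish in the graded ring are those of weight one. -/
theorem gradedProj_eq_iff (a b : weightZero X) :
    gradedProj X a = gradedProj X b ↔ HasWeight (fun _ => 1) (b.1 - a.1) := by
  have hab : HasWeight (fun _ => 0) (b.1 - a.1) := HasWeight.sub b.2 a.2
  rw [hasWeight_iff_coeffK hab]
  have h1 : ∀ n, coeffK n _ hab = -coeffK n a.1 a.2 + coeffK n b.1 b.2 := fun n =>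
    Subtype.ext (funext fun t => (Polynomial.coeff_sub _ _ _).trans (sub_eq_neg_add _ _))
  simp_rw [h1]
  constructor
  · intro h n
    refine ((KFiltration X).pieceMk_eq_iff n _ _ (coeffK_mem_level a.2 n)
      (coeffK_mem_level b.2 n)).1 ?_
    rw [← gradedClass_apply a.2, ← gradedClass_apply b.2]
    exact congrArg (fun z : gradedK X => z n) h
  · intro h
    refine DFinsupp.ext fun n => ?_
    change gradedClass a.1 a.2 n = gradedClass b.1 b.2 n
    refine (gradedClass_apply a.2 n).trans (Eq.trans ?_ (gradedClass_apply b.2 n).symm)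
    exact ((KFiltration X).pieceMk_eq_iff n _ _ _ _).2 (h n)

/-- The graded character rings as the quotients of the rings of ghosts of weight zero by the ideals
of ghosts of weight one. -/
def gradedSubquotient : GhostSubquotient (G := G) fun X => gradedK X where
  sub X := weightZero X
  proj X := gradedProj X
  proj_surjective X := gradedProj_surjective X
  res_mem f a ha := HasWeight.res ha f
  ind_mem {X Y} f a ha := HasWeight.ind (d := fun _ => 0) f ha
  norm_mem f a ha := HasWeight.norm_zero f ha
  res_congr f a b h := by
    rw [gradedProj_eq_iff] at h ⊢
    change HasWeight _ (gRes f b.1 - gRes f a.1)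
    rw [← map_sub]
    exact h.res f
  ind_congr f a b h := by
    rw [gradedProj_eq_iff] at h ⊢
    change HasWeight _ (gInd f b.1 - gInd f a.1)
    rw [← map_sub]
    exact HasWeight.ind (d := fun _ => 1) f h
  norm_congr f a b h := by
    rw [gradedProj_eq_iff] at h ⊢
    change HasWeight _ (gNorm f b.1 - gNorm f a.1)
    have := hasWeight_gNorm_add_sub f a.2 h
    rwa [add_sub_cancel] at this

/-- The operations on graded character rings are those of the ghosts `v tⁿ`, which on the
coefficient `v` are the operations on virtual bundles. -/
theorem isInducedBy_gradedSubquotient :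
    IsInducedBy (gradedSubquotient (G := G)).tambara (kSubquotient (G := G)).tambara where
  res f n v hv := by
    have h1 := HasWeight.res (hasWeight_degreeGhost hv) f
    have h2 := gradedSubquotient.res_proj f ⟨_, hasWeight_degreeGhost hv⟩
    rw [degreeGhost_res] at h1
    have h3 := hasWeight_degreeGhost_iff.1 h1
    refine ⟨h3, ?_⟩
    rw [← gradedProj_degreeGhost hv (hasWeight_degreeGhost hv)]
    refine h2.trans ?_
    simp only [degreeGhost_res]
    exact gradedProj_degreeGhost h3 _
  ind f n v hv := by
    have h1 := HasWeight.ind (d := fun _ => 0) f (hasWeight_degreeGhost hv)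
    have h2 := gradedSubquotient.ind_proj f ⟨_, hasWeight_degreeGhost hv⟩
    rw [degreeGhost_ind] at h1
    have h3 := hasWeight_degreeGhost_iff.1 h1
    refine ⟨h3, ?_⟩
    rw [← gradedProj_degreeGhost hv (hasWeight_degreeGhost hv)]
    refine h2.trans ?_
    simp only [degreeGhost_ind]
    exact gradedProj_degreeGhost h3 _
  norm f k hk n v hv := by
    have h1 := HasWeight.norm_zero f (hasWeight_degreeGhost hv)
    have h2 := gradedSubquotient.norm_proj f ⟨_, hasWeight_degreeGhost hv⟩
    rw [gNorm_degreeGhost f hk] at h1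
    have h3 := hasWeight_degreeGhost_iff.1 h1
    refine ⟨by rw [tambara_norm_eq]; exact h3, ?_⟩
    rw [← gradedProj_degreeGhost hv (hasWeight_degreeGhost hv)]
    refine h2.trans ?_
    simp only [gNorm_degreeGhost f hk, tambara_norm_eq]
    exact gradedProj_degreeGhost h3 _

end GradedTambara

/-! ### Isomorphisms of associated graded rings -/

section GradedMap

variable {A B : Type*} [CommRing A] [CommRing B] (F : MulFiltration A) (F' : MulFiltration B)
  (φ : A →+* B) (hφ : ∀ n a, a ∈ F.level n ↔ φ a ∈ F'.level n)

/-- The map on graded pieces given by a ring homomorphism that respects filtrations. -/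
def pieceMap (n : ℕ) : F.piece n →+ F'.piece n :=
  QuotientAddGroup.map _ _
    ((φ.toAddMonoidHom.comp (F.level n).subtype).codRestrict (F'.level n) fun a => (hφ n a.1).1 a.2)
    fun a ha => (hφ (n + 1) a.1).1 ha

theorem pieceMap_mk (n : ℕ) (a : A) (ha : a ∈ F.level n) :
    pieceMap F F' φ hφ n (F.pieceMk n a ha) = F'.pieceMk n (φ a) ((hφ n a).1 ha) := rfl

/-- The homomorphism of associated graded rings given by a ring homomorphism that respects
filtrations. -/
def grMap : F.gr →+* F'.gr :=
  DirectSum.toSemiring (fun n => (DirectSum.of F'.piece n).comp (pieceMap F F' φ hφ n))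
    (congrArg (DirectSum.of F'.piece 0) (F'.pieceMk_congr 0 _ (map_one φ)))
    (by
      intro m n x y
      obtain ⟨a, ha, rfl⟩ := F.exists_pieceMk x
      obtain ⟨b, hb, rfl⟩ := F.exists_pieceMk y
      refine Eq.trans ?_ (DirectSum.of_mul_of (A := F'.piece) (F'.pieceMk m (φ a) ((hφ m a).1 ha))
        (F'.pieceMk n (φ b) ((hφ n b).1 hb))).symm
      exact congrArg (DirectSum.of F'.piece (m + n)) (F'.pieceMk_congr _ _ (map_mul φ a b)))

theorem grMap_cls (n : ℕ) (a : A) (ha : a ∈ F.level n) :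
    grMap F F' φ hφ (F.cls n a ha) = F'.cls n (φ a) ((hφ n a).1 ha) :=
  DirectSum.toSemiring_of _ _ _ _ _

theorem grMap_eq_map (z : F.gr) : grMap F F' φ hφ z = DirectSum.map (pieceMap F F' φ hφ) z := by
  induction z using DirectSum.induction_on with
  | zero => rw [map_zero, map_zero]
  | of n z =>
    rw [DirectSum.map_of]
    exact DirectSum.toSemiring_of _ _ _ _ _
  | add x y hx hy => rw [map_add, map_add, hx, hy]

/-- A surjective ring homomorphism for which the filtration of the source is the preimage of the
filtration of the target induces an isomorphism of graded rings. -/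
theorem grMap_bijective (hsurj : ∀ b ∈ F'.level 0, ∃ a, φ a = b) :
    Function.Bijective (grMap F F' φ hφ) := by
  have h : ⇑(grMap F F' φ hφ) = DirectSum.map (pieceMap F F' φ hφ) :=
    funext fun z => grMap_eq_map F F' φ hφ z
  rw [h]
  constructor
  · refine (DirectSum.map_injective _).2 fun n => (injective_iff_map_eq_zero _).2 fun x hx => ?_
    obtain ⟨a, ha, rfl⟩ := F.exists_pieceMk x
    rw [pieceMap_mk, ← F'.pieceMk_zero, Eq.comm, F'.pieceMk_eq_iff, neg_zero, zero_add] at hx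
    rw [← F.pieceMk_zero, Eq.comm, F.pieceMk_eq_iff, neg_zero, zero_add]
    exact (hφ _ _).2 hx
  · refine (DirectSum.map_surjective _).2 fun n y => ?_
    obtain ⟨b, hb, rfl⟩ := F'.exists_pieceMk y
    obtain ⟨a, rfl⟩ := hsurj b (F'.antitone_level (Nat.zero_le n) hb)
    exact ⟨F.pieceMk n a ((hφ n a).2 hb), rfl⟩

end GradedMap

/-! ### The value on an orbit -/

section Orbit

open FinGSet

variable {G : Type u} [CommGroup G] [Finite G] {X : FinGSet G}

/-- Over a transitive `G`-set the filtration is determined at one point. -/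
theorem mem_KFiltration_iff_of_transitive [MulAction.IsPretransitive G X] (x : X) (n : ℕ)
    (v : KRing X) : v ∈ (KFiltration X).level n ↔
      fibreHom X x v ∈ (gammaFiltration (MulAction.stabilizer G x)).level n := by
  refine ⟨fun h => mem_KFiltration.1 h x, fun h => mem_KFiltration.2 fun y => ?_⟩
  obtain ⟨k, rfl⟩ := MulAction.exists_smul_eq G x y
  rw [mem_gamma_iff] at h ⊢
  -- for a commutative group the stabilizers of all points of an orbit agree
  have hle : MulAction.stabilizer G (k • x) ≤ MulAction.stabilizer G x := fun g hg =>
    fixed_smul_iff.1 hg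
  convert augPow_comp (Subgroup.inclusion hle) h using 1
  funext g
  exact KRing_invariant v g k x (fixed_smul_iff.1 g.2) g.2

/-- Virtual characters of the stabilizer extend to `G`, hence to virtual bundles over `X`. -/
theorem fibreHom_surjective (x : X) : Function.Surjective (fibreHom X x) := by
  intro w
  have h := mem_augPowClass.1 (charRing_le_augPow w)
  obtain ⟨F, hF, hF'⟩ := exists_reesPow_lift _ (monomial_mem_reesPow (n := 0) (d := 0) h)
  refine ⟨⟨_, charFun_mem_KRing (hF 0)⟩, Subtype.ext (funext fun k => ?_)⟩
  change (F k).coeff 0 = w.1 k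
  rw [hF', Polynomial.coeff_monomial_same]

theorem exists_gradedK_equiv (X : FinGSet G) [MulAction.IsPretransitive G X] (x : X) :
    ∃ φ : gradedK X ≃+* gradedCharRing (MulAction.stabilizer G x),
      ∀ (n : ℕ) (v : KRing X) (hv : v ∈ (KFiltration X).level n),
        φ ((KFiltration X).cls n v hv) =
          (gammaFiltration (MulAction.stabilizer G x)).cls n (fibreHom X x v)
            (fibreHom_mem hv x) :=
  ⟨RingEquiv.ofBijective (grMap _ _ (fibreHom X x) (mem_KFiltration_iff_of_transitive x))
    (grMap_bijective _ _ _ _ fun w _ => fibreHom_surjective x w),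
    fun n v hv => grMap_cls _ _ _ _ n v hv⟩

end Orbit

end

end GradedChar

theorem mainTheorem1 {G : Type u} [CommGroup G] [Finite G] :
    (∃ (T : TambaraFunctor G fun X => KRing X) (T' : TambaraFunctor G fun X => gradedK X),
      ExtendsBundles T ∧ IsInducedBy T' T) ∧
    ∀ (X : FinGSet G) [MulAction.IsPretransitive G X] (x : X),
      ∃ φ : gradedK X ≃+* gradedCharRing (MulAction.stabilizer G x),
        ∀ (n : ℕ) (v : KRing X) (hv : v ∈ (KFiltration X).level n),
          φ ((KFiltration X).cls n v hv) =
            (gammaFiltration (MulAction.stabilizer G x)).cls n (fibreHom X x v)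
              (fibreHom_mem hv x) := by
  exact ⟨⟨(kSubquotient (G := G)).tambara, (gradedSubquotient (G := G)).tambara,
    extendsBundles_kSubquotient, isInducedBy_gradedSubquotient⟩,
    fun X _ x => exists_gradedK_equiv X x⟩
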